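/- Let $\mathbb K$ be a field of characteristic $0$, let $a,b\in\mathbb Z$, and let $(\mathcal A,\cdot,[\ ,\ ],d)$ be a differential graded $(a,b)$-algebra over $\mathbb K$: a $\mathbb Z$-graded vector space $\mathcal A=\bigoplus_i\mathcal A_i$ with a product of degree $a$, a bracket of degree $b$ and a differential $d$ of degree $1$, $d^2=0$, such that for homogeneous elements $\alpha\cdot\beta=(-1)^{(|\alpha|+a)(|\beta|+a)}\beta\cdot\alpha$, $\ \alpha\cdot(\beta\cdot\gamma)=(\alpha\cdot\beta)\cdot\gamma$, $\ [\alpha,\beta]=-(-1)^{(|\alpha|+b)(|\beta|+b)}[\beta,\alpha]$, $(-1)^{(|\alpha|+b)(|\gamma|+b)}[[\alpha,\beta],\gamma]+(-1)^{(|\beta|+b)(|\alpha|+b)}[[\beta,\gamma],\alpha]+(-1)^{(|\gamma|+b)(|\beta|+b)}[[\gamma,\alpha],\beta]=0$, $[\alpha,\beta\cdot\gamma]=[\alpha,\beta]\cdot\gamma+(-1)^{(|\beta|+a)(|\alpha|+b)}\beta\cdot[\alpha,\gamma]$, $\ d(\alpha\cdot\beta)=d\alpha\cdot\beta+(-1)^{|\alpha|+a}\alpha\cdot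 d\beta$, $\ d[\alpha,\beta]=[d\alpha,\beta]+(-1)^{|\alpha|+b}[\alpha,d\beta]$. Let $V=\mathcal A[-a+1]$, i.e. $\mathcal A$ with the degree $dg(\alpha)=|\alpha|+a-1$ (written simply $\alpha$ in exponents), and let $\ell(\alpha,\beta)=(-1)^{(b-a+1)\alpha}[\alpha,\beta]$ on $V$. Let $Bat(p,q)$ be the set of $\sigma\in S_{p+q}$ with $\sigma(1)<\dots<\sigma(p)$ and $\sigma(p+1)<\dots<\sigma(p+q)$, let $\varepsilon_\alpha(\sigma^{-1})$ be the signature of the restriction of $\sigma^{-1}$ to the indices of the letters $\alpha_i$ of odd degree, and let $$bat_{p,q}(\alpha_1\otimes\dots\otimes\alpha_p,\alpha_{p+1}\otimes\dots\otimes\alpha_{p+q})=\sum_{\sigma\in Bat(p,q)}\varepsilon_\alpha(\sigma^{-1})\,\alpha_{\sigma^{-1}(1)}\otimes\dots\otimes\alpha_{\sigma^{-1}(p+q)}.$$ Let $\mathcal H=\bigoplus_{n\ge1}\Big(V^{\otimes n}\big/\sum_{p+q=n,\ p,q\ge1}\mathrm{Im}(bat_{p,q})\Big)$, write $\alpha_1\underline\otimes\dots\underline\otimes\alpha_n$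 for the class of $\alpha_1\otimes\dots\otimes\alpha_n$, and give it the degree $\alpha_1+\dots+\alpha_n$; the degree of $X\in\mathcal H$ is denoted $x$. Let $\tau(X\otimes Y)=(-1)^{xy}Y\otimes X$ on $\mathcal H\otimes\mathcal H$, $\tau_{12}=\tau\otimes id$, $\tau_{23}=id\otimes\tau$, and let $\delta:\mathcal H\to\mathcal H\otimes\mathcal H$ be the (well defined) cobracket $$\delta(X)=\sum_{U\underline\otimes W=X,\ U,W\ne\emptyset}U\otimes W-(-1)^{wu}W\otimes U ,$$ the sum being over the cuts of the word $X=\alpha_1\underline\otimes\dots\underline\otimes\alpha_n$ into two non-empty words. Let $\mathrm{pr}:\mathcal H\to V$ be the projection onto the summand $n=1$. Then there is exactly one bilinear map ("bracket") $\ell_2$ on $\mathcal H$, homogeneous of degree $b-a+1$, which extends $\ell$ in the sense that $\mathrm{pr}\circ\ell_2=\ell\circ(\mathrm{pr}\otimes\mathrm{pr})$, and which satisfies $$\delta\circ\ell_2=(\ell_2\otimes id)\circ\big(\tau_{23}\circ(\delta\otimes id)+id\otimes\delta\big)+(id\otimes\ell_2)\circ\big(\delta\otimes id+\tau_{12}\circ(id\otimes\delta)\big),\qquad(\ast)$$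 where $(id\otimes\ell_2)(X\otimes Y\otimes Z)=(-1)^{(b-a+1)x}X\otimes\ell_2(Y,Z)$. It is given, for all $p,q\ge1$ and homogeneous $\alpha_1,\dots,\alpha_{p+q}$, with $X=\alpha_1\underline\otimes\dots\underline\otimes\alpha_p$ and $Y=\alpha_{p+1}\underline\otimes\dots\underline\otimes\alpha_{p+q}$, by $$\ell_2(X,Y)=\sum_{\substack{\sigma\in Bat(p,q),\ k\\ \sigma^{-1}(k)\le p<\sigma^{-1}(k+1)}}\varepsilon_\alpha(\sigma^{-1})\,(-1)^{(b-a+1)\sum_{s<k}\alpha_{\sigma^{-1}(s)}}\ \alpha_{\sigma^{-1}(1)}\underline\otimes\dots\underline\otimes\ell(\alpha_{\sigma^{-1}(k)},\alpha_{\sigma^{-1}(k+1)})\underline\otimes\dots\underline\otimes\alpha_{\sigma^{-1}(p+q)}.$$ -/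

import Mathlib

open scoped TensorProduct DirectSum

namespace ABAlgebra

/-! ### Graded vector spaces -/

section Graded

variable {𝕜 V : Type*} [Field 𝕜] [AddCommGroup V] [Module 𝕜 V]

/-- The shifted grading `V[k]` of a graded vector space `V`: `V[k]_i = V_{i+k}`. -/
def shift (𝒱 : ℤ → Submodule 𝕜 V) (k : ℤ) : ℤ → Submodule 𝕜 V := fun i => 𝒱 (i + k)

noncomputable instance (𝒱 : ℤ → Submodule 𝕜 V) [DirectSum.Decomposition 𝒱] (k : ℤ) :
    DirectSum.Decomposition (shift 𝒱 k) :=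
  DirectSum.IsInternal.chooseDecomposition _ <| by
    have h := DirectSum.Decomposition.isInternal 𝒱
    rw [DirectSum.isInternal_submodule_iff_iSupIndep_and_iSup_eq_top] at h ⊢
    exact ⟨h.1.comp (add_left_injective k),
      ((Equiv.addRight k).iSup_comp (g := 𝒱)).trans h.2⟩

/-- The linear map of `V` equal to `v ↦ (-1)^{c·i} v` on the component of degree `i`. -/
noncomputable def signTwist (𝒱 : ℤ → Submodule 𝕜 V) [DirectSum.Decomposition 𝒱] (c : ℤ) :
    V →ₗ[𝕜] V :=
  DirectSum.toModule 𝕜 ℤ V (fun i => (c * i).negOnePow • (𝒱 i).subtype) ∘ₗ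
    (DirectSum.decomposeLinearEquiv 𝒱).toLinearMap

theorem signTwist_of_mem (𝒱 : ℤ → Submodule 𝕜 V) [DirectSum.Decomposition 𝒱] (c : ℤ)
    {i : ℤ} {v : V} (hv : v ∈ 𝒱 i) : signTwist 𝒱 c v = (c * i).negOnePow • v := by
  rw [signTwist, LinearMap.comp_apply, LinearEquiv.coe_coe, DirectSum.decomposeLinearEquiv_apply,
    DirectSum.decompose_of_mem 𝒱 hv, ← DirectSum.lof_eq_of 𝕜, DirectSum.toModule_lof]
  rfl

end Graded

/-! ### Differential `(a,b)`-algebras -/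

/-- A differential graded `(a,b)`-algebra structure on the graded vector space `A = ⨁ 𝒜 i`:
a product of degree `a`, a bracket of degree `b` and a differential of degree `1`. -/
structure DiffABAlgebra {𝕜 A : Type*} [Field 𝕜] [AddCommGroup A] [Module 𝕜 A]
    (𝒜 : ℤ → Submodule 𝕜 A) (a b : ℤ) where
  /-- the product `α · β` -/
  mul : A →ₗ[𝕜] A →ₗ[𝕜] A
  /-- the bracket `[α, β]` -/
  bracket : A →ₗ[𝕜] A →ₗ[𝕜] A
  /-- the differential -/
  d : A →ₗ[𝕜] A
  mul_mem : ∀ {i j : ℤ} {α β : A}, α ∈ 𝒜 i → β ∈ 𝒜 j → mul α β ∈ 𝒜 (i + j + a)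
  bracket_mem : ∀ {i j : ℤ} {α β : A}, α ∈ 𝒜 i → β ∈ 𝒜 j → bracket α β ∈ 𝒜 (i + j + b)
  d_mem : ∀ {i : ℤ} {α : A}, α ∈ 𝒜 i → d α ∈ 𝒜 (i + 1)
  mul_comm : ∀ {i j : ℤ} {α β : A}, α ∈ 𝒜 i → β ∈ 𝒜 j →
    mul α β = ((i + a) * (j + a)).negOnePow • mul β α
  mul_assoc : ∀ α β γ : A, mul α (mul β γ) = mul (mul α β) γ
  bracket_antisymm : ∀ {i j : ℤ} {α β : A}, α ∈ 𝒜 i → β ∈ 𝒜 j →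
    bracket α β = -(((i + b) * (j + b)).negOnePow • bracket β α)
  jacobi : ∀ {i j k : ℤ} {α β γ : A}, α ∈ 𝒜 i → β ∈ 𝒜 j → γ ∈ 𝒜 k →
    ((i + b) * (k + b)).negOnePow • bracket (bracket α β) γ
      + ((j + b) * (i + b)).negOnePow • bracket (bracket β γ) α
      + ((k + b) * (j + b)).negOnePow • bracket (bracket γ α) β = 0
  leibniz : ∀ {i j : ℤ} {α β : A} (γ : A), α ∈ 𝒜 i → β ∈ 𝒜 j →
    bracket α (mul β γ)
      = mul (bracket α β) γ + ((j + a) * (i + b)).negOnePow • mul β (bracket α γ)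
  d_d : ∀ α : A, d (d α) = 0
  d_mul : ∀ {i : ℤ} {α : A} (β : A), α ∈ 𝒜 i →
    d (mul α β) = mul (d α) β + (i + a).negOnePow • mul α (d β)
  d_bracket : ∀ {i : ℤ} {α : A} (β : A), α ∈ 𝒜 i →
    d (bracket α β) = bracket (d α) β + (i + b).negOnePow • bracket α (d β)

/-- The grading `A[-a+1]` of `A`, that is `dg(α) = |α| + a - 1`. -/
abbrev shifted {𝕜 A : Type*} [Field 𝕜] [AddCommGroup A] [Module 𝕜 A]
    (𝒜 : ℤ → Submodule 𝕜 A) (a : ℤ) : ℤ → Submodule 𝕜 A := shift 𝒜 (-a + 1)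

/-- The shifted bracket `ℓ(α, β) = (-1)^{(b-a+1)·dg(α)} [α, β]` on `A[-a+1]`. -/
noncomputable def DiffABAlgebra.shiftedBracket {𝕜 A : Type*} [Field 𝕜] [AddCommGroup A]
    [Module 𝕜 A] {𝒜 : ℤ → Submodule 𝕜 A} [DirectSum.Decomposition 𝒜] {a b : ℤ}
    (S : DiffABAlgebra 𝒜 a b) : A →ₗ[𝕜] A →ₗ[𝕜] A :=
  S.bracket ∘ₗ signTwist (shifted 𝒜 a) (b - a + 1)

/-! ### Shuffles -/

/-- The Koszul sign `ε_α(σ⁻¹)` of the rearrangement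
`α_1, …, α_n ↦ α_{σ⁻¹(1)}, …, α_{σ⁻¹(n)}` of vectors of degrees `d`: the signature of the
permutation restricted to the letters of odd degree (each inversion of two odd letters
contributes `-1`). -/
def koszulSign {n : ℕ} (d : Fin n → ℤ) (σ : Equiv.Perm (Fin n)) : ℤˣ :=
  ∏ i, ∏ j, if i < j ∧ σ j < σ i then (d i * d j).negOnePow else 1

/-- The set `Bat(p, n-p)` of the `(p, n-p)`-shuffles: the permutations `σ` of `n` letters with
`σ(1) < … < σ(p)` and `σ(p+1) < … < σ(n)`. -/
def battements (n p : ℕ) : Finset (Equiv.Perm (Fin n)) :=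
  Finset.univ.filter fun σ =>
    StrictMonoOn σ {i | i.val < p} ∧ StrictMonoOn σ {i | p ≤ i.val}

/-! Combinatorial facts on shuffles, used to see that the cobracket is well defined. -/

theorem prod_pairs_comp {n : ℕ} (σ : Equiv.Perm (Fin n)) (g : Fin n → Fin n → ℤˣ)
    (hg : ∀ i j, g i j = g j i) :
    (∏ i, ∏ j, if i < j then g (σ i) (σ j) else 1) = ∏ i, ∏ j, if i < j then g i j else 1 := by
  have h1 : (∏ i, ∏ j, if i < j then g (σ i) (σ j) else 1)
      = ∏ i, ∏ j, if σ.symm i < σ.symm j then g i j else 1 := by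
    rw [← Equiv.prod_comp σ (fun i => ∏ j, if σ.symm i < σ.symm j then g i j else 1)]
    refine Finset.prod_congr rfl fun i _ => ?_
    rw [← Equiv.prod_comp σ (fun j => if σ.symm (σ i) < σ.symm j then g (σ i) j else 1)]
    simp
  have e1 : ∀ i j, (if σ.symm i < σ.symm j then g i j else 1)
      = (if σ.symm i < σ.symm j ∧ i < j then g i j else 1)
        * (if σ.symm i < σ.symm j ∧ j < i then g i j else 1) := by
    intro i j
    rcases lt_trichotomy i j with h | h | h
    · simp [h, h.asymm]
    · simp [h]
    · simp [h, h.asymm]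
  have e2 : ∀ i j, (if i < j then g i j else 1)
      = (if σ.symm i < σ.symm j ∧ i < j then g i j else 1)
        * (if σ.symm j < σ.symm i ∧ i < j then g i j else 1) := by
    intro i j
    rcases lt_trichotomy (σ.symm i) (σ.symm j) with h | h | h
    · simp [h, h.asymm]
    · have : i = j := σ.symm.injective h
      simp [this]
    · simp [h, h.asymm]
  rw [h1]
  simp_rw [e1, e2, Finset.prod_mul_distrib]
  congr 1
  rw [Finset.prod_comm]
  simp_rw [hg]

theorem koszulSign_mul {n : ℕ} (d : Fin n → ℤ) (ρ σ : Equiv.Perm (Fin n)) :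
    koszulSign d (ρ * σ) = koszulSign d σ * koszulSign (fun i => d (σ.symm i)) ρ := by
  set g : Fin n → Fin n → ℤˣ := fun x y =>
    if (x < y ∧ ρ y < ρ x) ∨ (y < x ∧ ρ x < ρ y) then
      (d (σ.symm x) * d (σ.symm y)).negOnePow else 1 with hgdef
  have hg : ∀ x y, g x y = g y x := by
    intro x y
    simp only [hgdef, mul_comm (d (σ.symm x)), or_comm]
  have h2 : koszulSign (fun i => d (σ.symm i)) ρ = ∏ i, ∏ j, if i < j then g i j else 1 := by
    unfold koszulSign
    refine Finset.prod_congr rfl fun i _ => Finset.prod_congr rfl fun j _ => ?_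
    by_cases h : i < j
    · simp [hgdef, h, h.asymm]
    · simp [h]
  rw [h2, ← prod_pairs_comp σ g hg, koszulSign, koszulSign, ← Finset.prod_mul_distrib]
  refine Finset.prod_congr rfl fun i _ => ?_
  rw [← Finset.prod_mul_distrib]
  refine Finset.prod_congr rfl fun j _ => ?_
  by_cases h : i < j
  · have hne : σ i ≠ σ j := fun e => h.ne (σ.injective e)
    have hne' : ρ (σ i) ≠ ρ (σ j) := fun e => hne (ρ.injective e)
    simp only [hgdef, Equiv.Perm.mul_apply, h, true_and, Equiv.symm_apply_apply, if_true]
    rcases lt_or_gt_of_ne hne with h3 | h3 <;> rcases lt_or_gt_of_ne hne' with h4 | h4 <;>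
      simp [h3, h4, h3.asymm, h4.asymm]
  · simp [h]

/-- block permutation -/
def block {j m : ℕ} (ρ₁ : Equiv.Perm (Fin j)) (ρ₂ : Equiv.Perm (Fin m)) :
    Equiv.Perm (Fin (j + m)) :=
  finSumFinEquiv.permCongr (Equiv.sumCongr ρ₁ ρ₂)

theorem block_castAdd {j m : ℕ} (ρ₁ : Equiv.Perm (Fin j)) (ρ₂ : Equiv.Perm (Fin m)) (x : Fin j) :
    block ρ₁ ρ₂ (Fin.castAdd m x) = Fin.castAdd m (ρ₁ x) := by
  simp [block, Equiv.permCongr_apply]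

theorem block_natAdd {j m : ℕ} (ρ₁ : Equiv.Perm (Fin j)) (ρ₂ : Equiv.Perm (Fin m)) (x : Fin m) :
    block ρ₁ ρ₂ (Fin.natAdd j x) = Fin.natAdd j (ρ₂ x) := by
  simp [block, Equiv.permCongr_apply]

theorem block_symm {j m : ℕ} (ρ₁ : Equiv.Perm (Fin j)) (ρ₂ : Equiv.Perm (Fin m)) :
    (block ρ₁ ρ₂).symm = block ρ₁.symm ρ₂.symm := by
  rfl

theorem koszulSign_block {j m : ℕ} (d : Fin (j + m) → ℤ) (ρ₁ : Equiv.Perm (Fin j))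
    (ρ₂ : Equiv.Perm (Fin m)) :
    koszulSign d (block ρ₁ ρ₂) = koszulSign (fun x => d (Fin.castAdd m x)) ρ₁
      * koszulSign (fun y => d (Fin.natAdd j y)) ρ₂ := by
  have a1 : ∀ (x : Fin j) (y : Fin m), ¬ (Fin.natAdd j y < Fin.castAdd m x) := by
    intro x y; rw [Fin.lt_def]; simp; omega
  simp only [koszulSign, Fin.prod_univ_add, block_castAdd, block_natAdd]
  have l11 : ∀ (x x' : Fin j), Fin.castAdd m x < Fin.castAdd m x' ↔ x < x' := fun _ _ => Iff.rfl
  simp [a1, l11]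

/-- The number of letters `< p` -/
def lowCount {j n : ℕ} (p : ℕ) (s : Fin j → Fin n) : ℕ :=
  (Finset.univ.filter fun x => (s x).val < p).card

theorem lt_lowCount {j n : ℕ} (p : ℕ) {s : Fin j → Fin n} (hs : StrictMono s) (x : Fin j) :
    x.val < lowCount p s ↔ (s x).val < p := by
  constructor
  · intro h
    by_contra hx
    have : (Finset.univ.filter fun x => (s x).val < p) ⊆ Finset.Iio x := by
      intro y hy
      simp only [Finset.mem_filter, Finset.mem_univ, true_and, Finset.mem_Iio] at hy ⊢
      by_contra hxy
      have := hs.monotone (not_lt.1 hxy)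
      rw [Fin.le_def] at this
      omega
    have := Finset.card_le_card this
    rw [Fin.card_Iio] at this
    unfold lowCount at h
    omega
  · intro h
    have : Finset.Iic x ⊆ (Finset.univ.filter fun x => (s x).val < p) := by
      intro y hy
      simp only [Finset.mem_filter, Finset.mem_univ, true_and, Finset.mem_Iic] at hy ⊢
      have := hs.monotone hy
      rw [Fin.le_def] at this
      omega
    have := Finset.card_le_card this
    rw [Fin.card_Iic] at this
    unfold lowCount
    omega

theorem mem_battements {n p : ℕ} {σ : Equiv.Perm (Fin n)} :
    σ ∈ battements n p ↔
      (∀ i i' : Fin n, i < i' → i'.val < p → σ i < σ i') ∧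
      (∀ i i' : Fin n, i < i' → p ≤ i.val → σ i < σ i') := by
  rw [battements, Finset.mem_filter]
  simp only [Finset.mem_univ, true_and, StrictMonoOn, Set.mem_ofPred_eq]
  constructor
  · rintro ⟨h1, h2⟩
    refine ⟨fun i i' h h' => h1 ?_ h' h, fun i i' h h' => h2 h' ?_ h⟩
    · rw [Fin.lt_def] at h; omega
    · rw [Fin.lt_def] at h; omega
  · rintro ⟨h1, h2⟩
    exact ⟨fun i _ i' h' h => h1 i i' h h', fun i h' i' _ h => h2 i i' h h'⟩

section
variable {j m : ℕ}

/-- both halves of the word of `σ` are increasing -/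
def Sorted (j m : ℕ) (σ : Equiv.Perm (Fin (j + m))) : Prop :=
  StrictMono (fun x : Fin j => σ.symm (Fin.castAdd m x)) ∧
    StrictMono (fun y : Fin m => σ.symm (Fin.natAdd j y))

theorem mem_of_block_mul {p : ℕ} {σ : Equiv.Perm (Fin (j + m))} (hs : Sorted j m σ)
    (ρ₁ : Equiv.Perm (Fin j)) (ρ₂ : Equiv.Perm (Fin m)) :
    block ρ₁ ρ₂ * σ ∈ battements (j + m) p ↔
      σ ∈ battements (j + m) p ∧
      ρ₁ ∈ battements j (lowCount p fun x : Fin j => σ.symm (Fin.castAdd m x)) ∧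
      ρ₂ ∈ battements m (lowCount p fun y : Fin m => σ.symm (Fin.natAdd j y)) := by
  have c1 := lt_lowCount p hs.1
  have c2 := lt_lowCount p hs.2
  have l12 : ∀ (x : Fin j) (y : Fin m), Fin.castAdd m x < Fin.natAdd j y := by
    intro x y; rw [Fin.lt_def]; simp; omega
  have l11 : ∀ (x x' : Fin j), Fin.castAdd m x < Fin.castAdd m x' ↔ x < x' := by
    exact fun _ _ => Iff.rfl
  have l22 : ∀ (x x' : Fin m), Fin.natAdd j x < Fin.natAdd j x' ↔ x < x' := by
    intro x y; rw [Fin.lt_def, Fin.lt_def]; simp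
  -- a general comparison
  have key : ∀ i i' : Fin (j + m), i < i' →
      ((block ρ₁ ρ₂ * σ) i < (block ρ₁ ρ₂ * σ) i' → σ i < σ i') := by
    intro i i' h
    obtain ⟨k, rfl⟩ := σ.symm.surjective i
    obtain ⟨k', rfl⟩ := σ.symm.surjective i'
    simp only [Equiv.Perm.mul_apply, Equiv.apply_symm_apply]
    revert h
    refine Fin.addCases (fun x => ?_) (fun y => ?_) k <;>
    refine Fin.addCases (fun x' => ?_) (fun y' => ?_) k'
    · intro h _
      rw [l11]; exact hs.1.lt_iff_lt.1 h
    · intro h _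
      exact l12 _ _
    · intro h
      rw [block_castAdd, block_natAdd]
      intro h'
      exact absurd h' (l12 _ _).asymm
    · intro h _
      rw [l22]; exact hs.2.lt_iff_lt.1 h
  constructor
  · intro h
    rw [mem_battements] at h
    refine ⟨mem_battements.2 ⟨fun i i' a b => key i i' a (h.1 i i' a b),
      fun i i' a b => key i i' a (h.2 i i' a b)⟩, mem_battements.2 ⟨?_, ?_⟩,
      mem_battements.2 ⟨?_, ?_⟩⟩
    · intro x x' hx hx'
      have := h.1 _ _ (hs.1 hx) ((c1 x').1 hx')
      simpa [block_castAdd, l11] using this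
    · intro x x' hx hx'
      have := h.2 _ _ (hs.1 hx) (not_lt.1 fun h0 => (not_lt.2 hx') ((c1 x).2 h0))
      simpa [block_castAdd, l11] using this
    · intro x x' hx hx'
      have := h.1 _ _ (hs.2 hx) ((c2 x').1 hx')
      simpa [block_natAdd, l22] using this
    · intro x x' hx hx'
      have := h.2 _ _ (hs.2 hx) (not_lt.1 fun h0 => (not_lt.2 hx') ((c2 x).2 h0))
      simpa [block_natAdd, l22] using this
  · rintro ⟨h, h1, h2⟩
    rw [mem_battements] at h h1 h2 ⊢
    constructor
    · intro i i' hi hi'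
      have h3 := h.1 i i' hi hi'
      obtain ⟨k, rfl⟩ := σ.symm.surjective i
      obtain ⟨k', rfl⟩ := σ.symm.surjective i'
      simp only [Equiv.Perm.mul_apply, Equiv.apply_symm_apply] at h3 ⊢
      revert hi hi' h3
      refine Fin.addCases (fun x => ?_) (fun y => ?_) k <;>
      refine Fin.addCases (fun x' => ?_) (fun y' => ?_) k' <;> intro hi' hi h3
      · rw [block_castAdd, block_castAdd, l11]
        exact h1.1 _ _ ((l11 _ _).1 h3) ((c1 _).2 hi')
      · rw [block_castAdd, block_natAdd]; exact l12 _ _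
      · exact absurd h3 (l12 _ _).asymm
      · rw [block_natAdd, block_natAdd, l22]
        exact h2.1 _ _ ((l22 _ _).1 h3) ((c2 _).2 hi')
    · intro i i' hi hi'
      have h3 := h.2 i i' hi hi'
      obtain ⟨k, rfl⟩ := σ.symm.surjective i
      obtain ⟨k', rfl⟩ := σ.symm.surjective i'
      simp only [Equiv.Perm.mul_apply, Equiv.apply_symm_apply] at h3 ⊢
      revert hi hi' h3
      refine Fin.addCases (fun x => ?_) (fun y => ?_) k <;>
      refine Fin.addCases (fun x' => ?_) (fun y' => ?_) k' <;> intro hi' hi h3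
      · rw [block_castAdd, block_castAdd, l11]
        exact h1.2 _ _ ((l11 _ _).1 h3) (not_lt.1 fun h0 => not_lt.2 hi' ((c1 _).1 h0))
      · rw [block_castAdd, block_natAdd]; exact l12 _ _
      · exact absurd h3 (l12 _ _).asymm
      · rw [block_natAdd, block_natAdd, l22]
        exact h2.2 _ _ ((l22 _ _).1 h3) (not_lt.1 fun h0 => not_lt.2 hi' ((c2 _).1 h0))

theorem exists_block_sorted (σ : Equiv.Perm (Fin (j + m))) :
    ∃ (ρ₁ : Equiv.Perm (Fin j)) (ρ₂ : Equiv.Perm (Fin m)) (σ₀ : Equiv.Perm (Fin (j + m))),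
      Sorted j m σ₀ ∧ σ = block ρ₁ ρ₂ * σ₀ := by
  set f₁ : Fin j → Fin (j + m) := fun x => σ.symm (Fin.castAdd m x)
  set f₂ : Fin m → Fin (j + m) := fun x => σ.symm (Fin.natAdd j x)
  have i1 : Function.Injective f₁ := σ.symm.injective.comp (Fin.castAdd_injective _ _)
  have i2 : Function.Injective f₂ := σ.symm.injective.comp (Fin.natAdd_injective _ _)
  refine ⟨Tuple.sort f₁, Tuple.sort f₂, (block (Tuple.sort f₁) (Tuple.sort f₂)).symm * σ,
    ⟨?_, ?_⟩, ?_⟩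
  · have := (Tuple.monotone_sort f₁).strictMono_of_injective (i1.comp (Equiv.injective _))
    intro x x' h
    have := this h
    simpa [Equiv.Perm.mul_def, block_castAdd, f₁] using this
  · have := (Tuple.monotone_sort f₂).strictMono_of_injective (i2.comp (Equiv.injective _))
    intro x x' h
    have := this h
    simpa [Equiv.Perm.mul_def, block_natAdd, f₂] using this
  · ext x; simp

theorem block_sorted_inj {ρ₁ ρ₁' : Equiv.Perm (Fin j)} {ρ₂ ρ₂' : Equiv.Perm (Fin m)}
    {σ σ' : Equiv.Perm (Fin (j + m))} (hs : Sorted j m σ) (hs' : Sorted j m σ')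
    (h : block ρ₁ ρ₂ * σ = block ρ₁' ρ₂' * σ') : σ = σ' ∧ ρ₁ = ρ₁' ∧ ρ₂ = ρ₂' := by
  have hsy : ∀ k, σ.symm ((block ρ₁ ρ₂).symm k) = σ'.symm ((block ρ₁' ρ₂').symm k) := by
    intro k
    have := congrArg (fun e : Equiv.Perm (Fin (j + m)) => e.symm k) h
    simpa [Equiv.Perm.mul_def] using this
  have e1 : (fun x : Fin j => σ.symm (Fin.castAdd m x)) = fun x => σ'.symm (Fin.castAdd m x) := by
    refine (hs.1.range_inj hs'.1).1 ?_
    ext z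
    constructor
    · rintro ⟨x, rfl⟩
      refine ⟨ρ₁'.symm (ρ₁ x), ?_⟩
      have := hsy (Fin.castAdd m (ρ₁ x))
      simp only [block_symm, block_castAdd, Equiv.symm_apply_apply] at this
      exact this.symm
    · rintro ⟨x, rfl⟩
      refine ⟨ρ₁.symm (ρ₁' x), ?_⟩
      have := hsy (Fin.castAdd m (ρ₁' x))
      simp only [block_symm, block_castAdd, Equiv.symm_apply_apply] at this
      exact this
  have e2 : (fun x : Fin m => σ.symm (Fin.natAdd j x)) = fun x => σ'.symm (Fin.natAdd j x) := by
    refine (hs.2.range_inj hs'.2).1 ?_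
    ext z
    constructor
    · rintro ⟨x, rfl⟩
      refine ⟨ρ₂'.symm (ρ₂ x), ?_⟩
      have := hsy (Fin.natAdd j (ρ₂ x))
      simp only [block_symm, block_natAdd, Equiv.symm_apply_apply] at this
      exact this.symm
    · rintro ⟨x, rfl⟩
      refine ⟨ρ₂.symm (ρ₂' x), ?_⟩
      have := hsy (Fin.natAdd j (ρ₂' x))
      simp only [block_symm, block_natAdd, Equiv.symm_apply_apply] at this
      exact this
  have hσ : σ = σ' := by
    apply Equiv.symm_bijective.injective
    ext k : 1
    induction k using Fin.addCases with
    | left x => exact congrFun e1 x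
    | right y => exact congrFun e2 y
  subst hσ
  have hb := mul_right_cancel h
  refine ⟨rfl, ?_, ?_⟩
  · ext x : 1
    have := congrArg (fun e : Equiv.Perm (Fin (j + m)) => e (Fin.castAdd m x)) hb
    simpa [block_castAdd] using this
  · ext x : 1
    have := congrArg (fun e : Equiv.Perm (Fin (j + m)) => e (Fin.natAdd j x)) hb
    simpa [block_natAdd] using this

open Classical in
theorem sum_battements {W : Type*} [AddCommMonoid W] (p : ℕ)
    (F : Equiv.Perm (Fin (j + m)) → W) :
    ∑ σ ∈ battements (j + m) p, F σ =
      ∑ σ ∈ (battements (j + m) p).filter (Sorted j m),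
        ∑ ρ₁ ∈ battements j (lowCount p fun x : Fin j => σ.symm (Fin.castAdd m x)),
          ∑ ρ₂ ∈ battements m (lowCount p fun y : Fin m => σ.symm (Fin.natAdd j y)),
            F (block ρ₁ ρ₂ * σ) := by
  simp_rw [← Finset.sum_product']
  rw [Finset.sum_sigma']
  symm
  refine Finset.sum_bij (fun x _ => block x.2.1 x.2.2 * x.1) ?_ ?_ ?_ ?_
  · rintro ⟨σ, ρ₁, ρ₂⟩ h
    simp only [Finset.mem_sigma, Finset.mem_filter, Finset.mem_product] at h ⊢
    exact (mem_of_block_mul h.1.2 _ _).2 ⟨h.1.1, h.2⟩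
  · rintro ⟨σ, ρ₁, ρ₂⟩ h ⟨σ', ρ₁', ρ₂'⟩ h' e
    simp only [Finset.mem_sigma, Finset.mem_filter, Finset.mem_product] at h h'
    obtain ⟨rfl, rfl, rfl⟩ := block_sorted_inj h.1.2 h'.1.2 e
    rfl
  · intro σ h
    obtain ⟨ρ₁, ρ₂, σ₀, hs, rfl⟩ := exists_block_sorted σ
    have := (mem_of_block_mul hs _ _).1 h
    refine ⟨⟨σ₀, ρ₁, ρ₂⟩, ?_, rfl⟩
    simp only [Finset.mem_sigma, Finset.mem_filter, Finset.mem_product]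
    exact ⟨⟨this.1, hs⟩, this.2⟩
  · intros; rfl

end

/-! ### The space `⨂̲⁺ V` -/

section Packets

variable {𝕜 V : Type*} [Field 𝕜] [AddCommGroup V] [Module 𝕜 V]

/-- The shuffle product `bat_{p,n-p}(v_1 ⊗ … ⊗ v_p, v_{p+1} ⊗ … ⊗ v_n)` of homogeneous vectors
`v_i` of degrees `d i`. -/
noncomputable def bat {n : ℕ} (p : ℕ) (d : Fin n → ℤ) (v : Fin n → V) : ⨂[𝕜]^n V :=
  ∑ σ ∈ battements n p, ((koszulSign d σ : ℤ) : 𝕜) • PiTensorProduct.tprod 𝕜 fun i => v (σ.symm i)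

variable (𝒱 : ℤ → Submodule 𝕜 V)

/-- The sum of the images of all `bat_{p,q}` with `p + q = n` and `p, q ≥ 1`; since homogeneous
tensors span the tensor power, each image is the span of the shuffle products of homogeneous
vectors. -/
def batImage (n : ℕ) : Submodule 𝕜 (⨂[𝕜]^n V) :=
  ⨆ p ∈ Finset.Ioo 0 n,
    Submodule.span 𝕜 {t | ∃ (d : Fin n → ℤ) (v : Fin n → V), (∀ i, v i ∈ 𝒱 (d i)) ∧ t = bat p d v}

/-- `⨂̲ⁿ V = (⨂ⁿ V) / ∑_{p+q=n} Im bat_{p,q}`. -/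
def PacketPower (n : ℕ) : Type _ := (⨂[𝕜]^n V) ⧸ batImage 𝒱 n

noncomputable instance (n : ℕ) : AddCommGroup (PacketPower 𝒱 n) :=
  inferInstanceAs (AddCommGroup ((⨂[𝕜]^n V) ⧸ batImage 𝒱 n))

noncomputable instance (n : ℕ) : Module 𝕜 (PacketPower 𝒱 n) :=
  inferInstanceAs (Module 𝕜 ((⨂[𝕜]^n V) ⧸ batImage 𝒱 n))

/-- The quotient map `⨂ⁿ V → ⨂̲ⁿ V`. -/
noncomputable def PacketPower.mk (n : ℕ) : (⨂[𝕜]^n V) →ₗ[𝕜] PacketPower 𝒱 n :=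
  (batImage 𝒱 n).mkQ

/-- A linear map on `⨂ⁿ V` vanishing on the images of the `bat_{p,q}` factors through `⨂̲ⁿ V`. -/
noncomputable def PacketPower.lift {W : Type*} [AddCommGroup W] [Module 𝕜 W] (n : ℕ)
    (f : (⨂[𝕜]^n V) →ₗ[𝕜] W) (hf : batImage 𝒱 n ≤ LinearMap.ker f) :
    PacketPower 𝒱 n →ₗ[𝕜] W :=
  (batImage 𝒱 n).liftQ f hf

theorem PacketPower.lift_mk {W : Type*} [AddCommGroup W] [Module 𝕜 W] (n : ℕ)
    (f : (⨂[𝕜]^n V) →ₗ[𝕜] W) (hf : batImage 𝒱 n ≤ LinearMap.ker f) (t : ⨂[𝕜]^n V) :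
    PacketPower.lift 𝒱 n f hf (PacketPower.mk 𝒱 n t) = f t := rfl

theorem PacketPower.mk_eq_zero {n : ℕ} {t : ⨂[𝕜]^n V} :
    PacketPower.mk 𝒱 n t = 0 ↔ t ∈ batImage 𝒱 n :=
  Submodule.Quotient.mk_eq_zero _

/-- `⨂̲⁺ V = ⨁_{n ≥ 1} ⨂̲ⁿ V`; the summand of index `n : ℕ` is `⨂̲ⁿ⁺¹ V`. -/
abbrev Packets : Type _ := ⨁ n : ℕ, PacketPower 𝒱 (n + 1)

/-- The class in `⨂̲⁺ V` of a tensor of length `n` (it is `0` for `n = 0`, as `⨂̲⁺ V` starts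
with `n = 1`). -/
noncomputable def cls : (n : ℕ) → (⨂[𝕜]^n V) →ₗ[𝕜] Packets 𝒱
  | 0 => 0
  | n + 1 =>
    DirectSum.lof 𝕜 ℕ (fun n => PacketPower 𝒱 (n + 1)) n ∘ₗ PacketPower.mk 𝒱 (n + 1)

/-- The packet `v_1 ⊗̲ … ⊗̲ v_n`. -/
noncomputable def packet {n : ℕ} (v : Fin n → V) : Packets 𝒱 :=
  cls 𝒱 n (PiTensorProduct.tprod 𝕜 v)

/-- The component of degree `k` of `⨂̲⁺ V`, where the degree of `v_1 ⊗̲ … ⊗̲ v_n` is the sum of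
the degrees of the `v_i`. -/
noncomputable def packetDegree (k : ℤ) : Submodule 𝕜 (Packets 𝒱) :=
  Submodule.span 𝕜 {X | ∃ (n : ℕ) (d : Fin n → ℤ) (v : Fin n → V),
    0 < n ∧ (∀ i, v i ∈ 𝒱 (d i)) ∧ ∑ i, d i = k ∧ X = packet 𝒱 v}

theorem batImage_one : batImage 𝒱 1 = ⊥ := by
  have : Finset.Ioo 0 1 = (∅ : Finset ℕ) := by decide
  simp [batImage, this]

/-- The projection of `⨂̲⁺ V` onto its space of cogenerators `V = ⨂̲¹ V`. -/
noncomputable def cogenProj : Packets 𝒱 →ₗ[𝕜] V :=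
  PacketPower.lift 𝒱 1
      (PiTensorProduct.subsingletonEquiv (R := 𝕜) (s := fun _ : Fin 1 => V) 0).toLinearMap
      ((batImage_one 𝒱).trans_le bot_le) ∘ₗ
    DirectSum.component 𝕜 ℕ (fun n => PacketPower 𝒱 (n + 1)) 0

variable {𝒱} in
theorem mem_batImage {n p : ℕ} (hp : 0 < p) (hn : p < n) {d : Fin n → ℤ} {v : Fin n → V}
    (hv : ∀ i, v i ∈ 𝒱 (d i)) : bat p d v ∈ batImage 𝒱 n :=
  Submodule.mem_iSup_of_mem p (Submodule.mem_iSup_of_mem (by simp [hp, hn])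
    (Submodule.subset_span ⟨d, v, hv, rfl⟩))

variable {𝒱} in
theorem batImage_le {n : ℕ} {S : Submodule 𝕜 (⨂[𝕜]^n V)}
    (h : ∀ p, 0 < p → p < n → ∀ (d : Fin n → ℤ) (v : Fin n → V), (∀ i, v i ∈ 𝒱 (d i)) →
      bat p d v ∈ S) : batImage 𝒱 n ≤ S := by
  refine iSup₂_le fun p hp => Submodule.span_le.2 ?_
  rw [Finset.mem_Ioo] at hp
  rintro _ ⟨d, v, hv, rfl⟩
  exact h p hp.1 hp.2 d v hv

theorem cls_of_mem {n : ℕ} {t : ⨂[𝕜]^n V} (ht : t ∈ batImage 𝒱 n) : cls 𝒱 n t = 0 := by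
  cases n with
  | zero => rfl
  | succ n =>
    rw [cls, LinearMap.comp_apply, (PacketPower.mk_eq_zero 𝒱).2 ht, map_zero]

theorem packet_zero (v : Fin 0 → V) : packet 𝒱 v = 0 := rfl

theorem negOnePow_sum {n : ℕ} (d : Fin n → ℤ) :
    (∑ i, d i).negOnePow = ∏ i, (d i).negOnePow := by
  induction n with
  | zero => simp
  | succ n ih => rw [Fin.sum_univ_succ, Fin.prod_univ_succ, Int.negOnePow_add, ih]

/-! ### Cutting tensors -/

/-- The map `⨂^(j+m) V → ⨂̲⁺ V ⊗ ⨂̲⁺ V` cutting a tensor of length `n = j + m` after its `j`-th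
letter: `v_1 ⊗ … ⊗ v_n ↦ (v_1 ⊗̲ … ⊗̲ v_j) ⊗ (v_{j+1} ⊗̲ … ⊗̲ v_n)` (this is `0` if `j = 0` or
`m = 0`). -/
noncomputable def cut {n : ℕ} (j m : ℕ) (h : j + m = n) :
    (⨂[𝕜]^n V) →ₗ[𝕜] Packets 𝒱 ⊗[𝕜] Packets 𝒱 :=
  TensorProduct.map (cls 𝒱 j) (cls 𝒱 m) ∘ₗ
    (TensorPower.mulEquiv (R := 𝕜) (M := V) (n := j) (m := m)).symm.toLinearMap ∘ₗ
      (TensorPower.cast 𝕜 V h.symm).toLinearMap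

theorem cut_tprod {n : ℕ} (j m : ℕ) (h : j + m = n) (w : Fin n → V) :
    cut 𝒱 j m h (PiTensorProduct.tprod 𝕜 w)
      = packet 𝒱 (fun x : Fin j => w (Fin.cast h (Fin.castAdd m x))) ⊗ₜ
        packet 𝒱 (fun y : Fin m => w (Fin.cast h (Fin.natAdd j y))) := by
  subst h
  have : TensorPower.mulEquiv (R := 𝕜) (M := V) (n := j) (m := m)
      (PiTensorProduct.tprod 𝕜 (fun x : Fin j => w (Fin.castAdd m x)) ⊗ₜ[𝕜]
        PiTensorProduct.tprod 𝕜 (fun y : Fin m => w (Fin.natAdd j y)))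
      = PiTensorProduct.tprod 𝕜 w := by
    rw [← TensorPower.gMul_def, TensorPower.tprod_mul_tprod]
    congr 1
    exact Fin.append_castAdd_natAdd
  simp only [cut, LinearMap.comp_apply, LinearEquiv.coe_coe, TensorPower.cast_refl,
    LinearEquiv.refl_apply]
  rw [← this, LinearEquiv.symm_apply_apply, TensorProduct.map_tmul]
  rfl

theorem battements_trivial {n p : ℕ} (h : p = 0 ∨ n ≤ p) : battements n p = {1} := by
  ext σ
  rw [mem_battements, Finset.mem_singleton]
  constructor
  · rintro ⟨h1, h2⟩
    have hs : StrictMono σ := by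
      intro i i' hi
      rcases h with h | h
      · exact h2 _ _ hi (by omega)
      · exact h1 _ _ hi (by omega)
    have := (hs.range_inj strictMono_id).1 (by simp [σ.surjective.range_eq])
    ext i : 1
    exact congrFun this i
  · rintro rfl
    exact ⟨fun _ _ h _ => h, fun _ _ h _ => h⟩

theorem koszulSign_one {n : ℕ} (d : Fin n → ℤ) : koszulSign d 1 = 1 := by
  refine Finset.prod_eq_one fun i _ => Finset.prod_eq_one fun j _ => if_neg ?_
  rintro ⟨h1, h2⟩
  exact h1.asymm h2

theorem bat_trivial {n p : ℕ} (h : p = 0 ∨ n ≤ p) (d : Fin n → ℤ) (v : Fin n → V) :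
    bat (𝕜 := 𝕜) p d v = PiTensorProduct.tprod 𝕜 v := by
  rw [bat, battements_trivial h, Finset.sum_singleton, koszulSign_one]
  simp only [Units.val_one, Int.cast_one, one_smul]
  rfl

/-- The permutation exchanging the blocks of the first `m` and of the last `j` letters. -/
def blockSwap (j m : ℕ) : Equiv.Perm (Fin (j + m)) :=
  (finAddFlip.trans (finCongr (add_comm m j))).symm

theorem blockSwap_symm_castAdd (j m : ℕ) (x : Fin j) :
    (blockSwap j m).symm (Fin.castAdd m x) = Fin.cast (add_comm m j) (Fin.natAdd m x) := by
  simp [blockSwap]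

theorem blockSwap_symm_natAdd (j m : ℕ) (y : Fin m) :
    (blockSwap j m).symm (Fin.natAdd j y) = Fin.cast (add_comm m j) (Fin.castAdd j y) := by
  simp [blockSwap]

theorem koszulSign_blockSwap {j m : ℕ} (d : Fin (j + m) → ℤ) :
    koszulSign d (blockSwap j m) =
      ((∑ y : Fin m, d (Fin.cast (add_comm m j) (Fin.castAdd j y))) *
        ∑ x : Fin j, d (Fin.cast (add_comm m j) (Fin.natAdd m x))).negOnePow := by
  rw [koszulSign, ← Equiv.prod_comp (blockSwap j m).symm]
  have : ∀ i, (∏ k, if i < k ∧ blockSwap j m k < blockSwap j m i then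
      (d i * d k).negOnePow else 1) = ∏ k, if i < (blockSwap j m).symm k ∧
        k < blockSwap j m i then (d i * d ((blockSwap j m).symm k)).negOnePow else 1 := by
    intro i
    rw [← Equiv.prod_comp (blockSwap j m).symm]
    simp
  simp_rw [this, Equiv.apply_symm_apply, Fin.prod_univ_add, blockSwap_symm_castAdd,
    blockSwap_symm_natAdd]
  have a1 : ∀ x x' : Fin j, ¬ (Fin.cast (add_comm m j) (Fin.natAdd m x) <
      Fin.cast (add_comm m j) (Fin.natAdd m x') ∧ Fin.castAdd m x' < Fin.castAdd m x) := by
    intro x x'; simp only [Fin.lt_def, Fin.val_cast, Fin.val_natAdd, Fin.val_castAdd]; omega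
  have a2 : ∀ (x : Fin j) (y : Fin m), ¬ (Fin.cast (add_comm m j) (Fin.natAdd m x) <
      Fin.cast (add_comm m j) (Fin.castAdd j y) ∧ Fin.natAdd j y < Fin.castAdd m x) := by
    intro x x'; simp only [Fin.lt_def, Fin.val_cast, Fin.val_natAdd, Fin.val_castAdd]; omega
  have a3 : ∀ (x : Fin j) (y : Fin m), (Fin.cast (add_comm m j) (Fin.castAdd j y) <
      Fin.cast (add_comm m j) (Fin.natAdd m x) ∧ Fin.castAdd m x < Fin.natAdd j y) := by
    intro x x'; simp only [Fin.lt_def, Fin.val_cast, Fin.val_natAdd, Fin.val_castAdd]; omega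
  have a4 : ∀ y y' : Fin m, ¬ (Fin.cast (add_comm m j) (Fin.castAdd j y) <
      Fin.cast (add_comm m j) (Fin.castAdd j y') ∧ Fin.natAdd j y' < Fin.natAdd j y) := by
    intro x x'; simp only [Fin.lt_def, Fin.val_cast, Fin.val_natAdd, Fin.val_castAdd]; omega
  simp only [if_neg (a1 _ _), if_neg (a2 _ _), if_pos (a3 _ _), if_neg (a4 _ _),
    Finset.prod_const_one, one_mul, mul_one]
  rw [Finset.sum_mul, negOnePow_sum]
  refine Finset.prod_congr rfl fun y _ => ?_
  rw [Finset.mul_sum, negOnePow_sum]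

theorem sorted_one (j m : ℕ) : Sorted j m 1 := by
  constructor <;> intro x x' h
  · exact h
  · change Fin.natAdd j x < Fin.natAdd j x'
    simpa using h

theorem sorted_blockSwap (j m : ℕ) : Sorted j m (blockSwap j m) := by
  constructor <;> intro x x' h <;>
    simp only [blockSwap_symm_castAdd, blockSwap_symm_natAdd, Fin.lt_def, Fin.val_cast,
      Fin.val_natAdd, Fin.val_castAdd] at h ⊢ <;> omega

theorem sorted_low_high {j m p : ℕ} (hj : 0 < j) (hm : 0 < m) {σ : Equiv.Perm (Fin (j + m))}
    (hs : Sorted j m σ) :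
    ((∀ x : Fin j, (σ.symm (Fin.castAdd m x)).val < p) ∧
      ∀ y : Fin m, ¬ (σ.symm (Fin.natAdd j y)).val < p) ↔ σ = 1 ∧ j = p := by
  constructor
  · rintro ⟨h1, h2⟩
    have hmono : StrictMono σ.symm := by
      intro i i'
      refine Fin.addCases (fun x => ?_) (fun y => ?_) i <;>
      refine Fin.addCases (fun x' => ?_) (fun y' => ?_) i' <;> intro h
      · exact hs.1 h
      · have := h1 x
        have := h2 y'
        rw [Fin.lt_def]; omega
      · rw [Fin.lt_def] at h
        simp at h; omega
      · exact hs.2 (by simpa using h)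
    have he := (hmono.range_inj strictMono_id).1 (by simp [σ.symm.surjective.range_eq])
    have hσ : σ = 1 := by
      apply Equiv.symm_bijective.injective
      ext i : 1
      exact congrFun he i
    refine ⟨hσ, ?_⟩
    subst hσ
    have e1 := h1 ⟨j - 1, by omega⟩
    have e2 := h2 ⟨0, hm⟩
    change j - 1 < p at e1
    change ¬ (j + 0 < p) at e2
    omega
  · rintro ⟨rfl, rfl⟩
    refine ⟨fun x => x.2, fun y => ?_⟩
    change ¬ (j + y.val < j)
    omega

theorem sorted_high_low {j m p : ℕ} (hj : 0 < j) (hm : 0 < m) {σ : Equiv.Perm (Fin (j + m))}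
    (hs : Sorted j m σ) :
    ((∀ x : Fin j, ¬ (σ.symm (Fin.castAdd m x)).val < p) ∧
      ∀ y : Fin m, (σ.symm (Fin.natAdd j y)).val < p) ↔ σ = blockSwap j m ∧ m = p := by
  constructor
  · rintro ⟨h1, h2⟩
    set g : Fin (j + m) → Fin (j + m) := fun i => σ.symm (blockSwap j m i) with hg
    have hb : ∀ i, (∃ y : Fin m, i.val = y.val ∧ blockSwap j m i = Fin.natAdd j y) ∨
        ∃ x : Fin j, i.val = m + x.val ∧ blockSwap j m i = Fin.castAdd m x := by
      intro i
      obtain ⟨k, rfl⟩ := (blockSwap j m).symm.surjective i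
      rw [Equiv.apply_symm_apply]
      refine Fin.addCases (fun x => ?_) (fun y => ?_) k
      · right
        exact ⟨x, by rw [blockSwap_symm_castAdd]; rfl, rfl⟩
      · left
        exact ⟨y, by rw [blockSwap_symm_natAdd]; rfl, rfl⟩
    have hmono : StrictMono g := by
      intro i i' h
      rw [Fin.lt_def] at h
      rcases hb i with ⟨y, e, e'⟩ | ⟨x, e, e'⟩ <;> rcases hb i' with ⟨y', f, f'⟩ | ⟨x', f, f'⟩ <;>
        simp only [hg, e', f']
      · exact hs.2 (by rw [Fin.lt_def]; omega)
      · have := h1 x'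
        have := h2 y
        rw [Fin.lt_def]; omega
      · omega
      · exact hs.1 (by rw [Fin.lt_def]; omega)
    have he := (hmono.range_inj strictMono_id).1 (by
      simp [show g = (blockSwap j m).trans σ.symm from rfl])
    have hσ : σ = blockSwap j m := by
      ext i : 1
      have := congrFun he ((blockSwap j m).symm (σ i))
      simp only [hg, Equiv.apply_symm_apply, Equiv.symm_apply_apply, id] at this
      rw [this, Equiv.apply_symm_apply, ← this]
    refine ⟨hσ, ?_⟩
    subst hσ
    have e1 := h1 ⟨0, hj⟩
    have e2 := h2 ⟨m - 1, by omega⟩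
    rw [blockSwap_symm_castAdd] at e1
    rw [blockSwap_symm_natAdd] at e2
    change ¬ (m + 0 < p) at e1
    change m - 1 < p at e2
    omega
  · rintro ⟨rfl, rfl⟩
    refine ⟨fun x => ?_, fun y => ?_⟩
    · rw [blockSwap_symm_castAdd]
      change ¬ (m + x.val < m)
      omega
    · rw [blockSwap_symm_natAdd]
      exact y.2

theorem lowCount_le {j n : ℕ} (p : ℕ) (s : Fin j → Fin n) : lowCount p s ≤ j :=
  (Finset.card_le_univ _).trans (by simp)

/-- The part of the cut of a shuffle product in which the set of the first `j` letters is fixed. -/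
theorem sum_cut_block {j m : ℕ} {d : Fin (j + m) → ℤ} {v : Fin (j + m) → V}
    (σ : Equiv.Perm (Fin (j + m))) (r s : ℕ) :
    ∑ ρ₁ ∈ battements j r, ∑ ρ₂ ∈ battements m s,
        cut 𝒱 j m rfl (((koszulSign d (block ρ₁ ρ₂ * σ) : ℤ) : 𝕜) •
          PiTensorProduct.tprod 𝕜 fun i => v ((block ρ₁ ρ₂ * σ).symm i))
      = ((koszulSign d σ : ℤ) : 𝕜) •
        (cls 𝒱 j (bat r (fun x => d (σ.symm (Fin.castAdd m x)))
            fun x => v (σ.symm (Fin.castAdd m x))) ⊗ₜ[𝕜]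
          cls 𝒱 m (bat s (fun y => d (σ.symm (Fin.natAdd j y)))
            fun y => v (σ.symm (Fin.natAdd j y)))) := by
  simp only [bat, map_sum, map_smul, TensorProduct.sum_tmul, TensorProduct.tmul_sum,
    Finset.smul_sum]
  rw [Finset.sum_comm]
  refine Finset.sum_congr rfl fun ρ₂ _ => ?_
  refine Finset.sum_congr rfl fun ρ₁ _ => ?_
  rw [cut_tprod, koszulSign_mul, koszulSign_block, TensorProduct.smul_tmul_smul, smul_smul]
  push_cast
  congr 1
  have e1 : ∀ x : Fin j, (block ρ₁ ρ₂ * σ).symm (Fin.castAdd m x)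
      = σ.symm (Fin.castAdd m (ρ₁.symm x)) := fun x => by
    rw [← block_castAdd ρ₁.symm ρ₂.symm, ← block_symm]; rfl
  have e2 : ∀ x : Fin m, (block ρ₁ ρ₂ * σ).symm (Fin.natAdd j x)
      = σ.symm (Fin.natAdd j (ρ₂.symm x)) := fun x => by
    rw [← block_natAdd ρ₁.symm ρ₂.symm, ← block_symm]; rfl
  simp only [Fin.cast_eq_self, e1, e2]
  rfl

open Classical in
theorem cut_bat {j m p : ℕ} (hp : 0 < p) (hp' : p < j + m) {d : Fin (j + m) → ℤ}
    {v : Fin (j + m) → V} (hv : ∀ i, v i ∈ 𝒱 (d i)) :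
    cut 𝒱 j m rfl (bat p d v)
      = (if j = p then packet 𝒱 (fun x : Fin j => v (Fin.castAdd m x)) ⊗ₜ[𝕜]
          packet 𝒱 (fun y : Fin m => v (Fin.natAdd j y)) else 0)
        + (if m = p then
          ((koszulSign d (blockSwap j m) : ℤ) : 𝕜) •
            (packet 𝒱 (fun x : Fin j => v (Fin.cast (add_comm m j) (Fin.natAdd m x))) ⊗ₜ[𝕜]
              packet 𝒱 (fun y : Fin m => v (Fin.cast (add_comm m j) (Fin.castAdd j y)))) else 0) := by
  rcases Nat.eq_zero_or_pos j with rfl | hj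
  · have h0 : ∀ w : Fin 0 → V, packet 𝒱 w = 0 := packet_zero 𝒱
    rw [bat, map_sum]
    simp only [map_smul, cut_tprod, h0, TensorProduct.zero_tmul, smul_zero, Finset.sum_const_zero,
      ite_self, add_zero]
  rcases Nat.eq_zero_or_pos m with rfl | hm
  · have h0 : ∀ w : Fin 0 → V, packet 𝒱 w = 0 := packet_zero 𝒱
    rw [bat, map_sum]
    simp only [map_smul, cut_tprod, h0, TensorProduct.tmul_zero, smul_zero, Finset.sum_const_zero,
      ite_self, add_zero]
  rw [bat, map_sum, sum_battements]
  set T₁ := packet 𝒱 (fun x : Fin j => v (Fin.castAdd m x)) ⊗ₜ[𝕜]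
          packet 𝒱 (fun y : Fin m => v (Fin.natAdd j y)) with hT₁
  set T₂ := ((koszulSign d (blockSwap j m) : ℤ) : 𝕜) •
            (packet 𝒱 (fun x : Fin j => v (Fin.cast (add_comm m j) (Fin.natAdd m x))) ⊗ₜ[𝕜]
              packet 𝒱 (fun y : Fin m => v (Fin.cast (add_comm m j) (Fin.castAdd j y)))) with hT₂
  have hne : (1 : Equiv.Perm (Fin (j + m))) ≠ blockSwap j m := by
    intro h
    have := blockSwap_symm_castAdd j m ⟨0, hj⟩
    rw [← h] at this
    have := congrArg Fin.val this
    change 0 = m + 0 at this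
    omega
  have hterm : ∀ σ ∈ (battements (j + m) p).filter (Sorted j m),
      ∑ ρ₁ ∈ battements j (lowCount p fun x : Fin j => σ.symm (Fin.castAdd m x)),
        ∑ ρ₂ ∈ battements m (lowCount p fun y : Fin m => σ.symm (Fin.natAdd j y)),
          cut 𝒱 j m rfl (((koszulSign d (block ρ₁ ρ₂ * σ) : ℤ) : 𝕜) •
            PiTensorProduct.tprod 𝕜 fun i => v ((block ρ₁ ρ₂ * σ).symm i))
      = (if 1 = σ then (if j = p then T₁ else 0) else 0)
        + (if blockSwap j m = σ then (if m = p then T₂ else 0) else 0) := by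
    intro σ hσ
    have hs : Sorted j m σ := (Finset.mem_filter.1 hσ).2
    rw [sum_cut_block 𝒱]
    have c1 := lt_lowCount p hs.1
    have c2 := lt_lowCount p hs.2
    have l1 := lowCount_le p fun x : Fin j => σ.symm (Fin.castAdd m x)
    have l2 := lowCount_le p fun y : Fin m => σ.symm (Fin.natAdd j y)
    set r := lowCount p fun x : Fin j => σ.symm (Fin.castAdd m x)
    set s := lowCount p fun y : Fin m => σ.symm (Fin.natAdd j y)
    have hA : r = j ∧ s = 0 ↔ σ = 1 ∧ j = p := by
      rw [← sorted_low_high hj hm hs]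
      constructor
      · rintro ⟨h1, h2⟩
        exact ⟨fun x => (c1 x).1 (by omega), fun y h => by have := (c2 y).2 h; omega⟩
      · rintro ⟨h1, h2⟩
        have e1 := (c1 ⟨j - 1, by omega⟩).2 (h1 _)
        have e2 := mt (c2 ⟨0, hm⟩).1 (h2 _)
        simp only at e1 e2
        omega
    have hB : r = 0 ∧ s = m ↔ σ = blockSwap j m ∧ m = p := by
      rw [← sorted_high_low hj hm hs]
      constructor
      · rintro ⟨h1, h2⟩
        exact ⟨fun x h => by have := (c1 x).2 h; omega, fun y => (c2 y).1 (by omega)⟩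
      · rintro ⟨h1, h2⟩
        have e1 := (c2 ⟨m - 1, by omega⟩).2 (h2 _)
        have e2 := mt (c1 ⟨0, hj⟩).1 (h1 _)
        simp only at e1 e2
        omega
    by_cases hAc : r = j ∧ s = 0
    · obtain ⟨rfl, rfl⟩ := hA.1 hAc
      rw [bat_trivial (Or.inr hAc.1.ge), bat_trivial (Or.inl hAc.2), koszulSign_one]
      rw [if_pos rfl, if_pos rfl, if_neg hne.symm, add_zero]
      simp only [Units.val_one, Int.cast_one, one_smul]
      rfl
    by_cases hBc : r = 0 ∧ s = m
    · obtain ⟨rfl, rfl⟩ := hB.1 hBc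
      rw [bat_trivial (Or.inl hBc.1), bat_trivial (Or.inr hBc.2.ge)]
      rw [if_neg hne, if_pos rfl, if_pos rfl, zero_add, hT₂]
      simp only [blockSwap_symm_castAdd, blockSwap_symm_natAdd]
      rfl
    have z1 : (if 1 = σ then (if j = p then T₁ else 0) else 0) = 0 := by
      rw [← ite_and, if_neg]
      rintro ⟨h1, h2⟩
      exact hAc (hA.2 ⟨h1.symm, h2⟩)
    have z2 : (if blockSwap j m = σ then (if m = p then T₂ else 0) else 0) = 0 := by
      rw [← ite_and, if_neg]
      rintro ⟨h1, h2⟩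
      exact hBc (hB.2 ⟨h1.symm, h2⟩)
    rw [z1, z2, add_zero]
    by_cases h1 : 0 < r ∧ r < j
    · rw [cls_of_mem 𝒱 (mem_batImage h1.1 h1.2 fun x => hv _), TensorProduct.zero_tmul, smul_zero]
    by_cases h2 : 0 < s ∧ s < m
    · rw [cls_of_mem 𝒱 (mem_batImage h2.1 h2.2 fun x => hv _), TensorProduct.tmul_zero, smul_zero]
    exfalso
    rcases (show r = 0 ∧ s = 0 ∨ r = j ∧ s = m by omega) with ⟨h3, h4⟩ | ⟨h3, h4⟩
    · obtain ⟨k, hk⟩ := σ.symm.surjective ⟨0, by omega⟩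
      revert hk
      refine Fin.addCases (fun x hk => ?_) (fun y hk => ?_) k
      · have := (c1 x).2 (by simp only [hk]; omega)
        omega
      · have := (c2 y).2 (by simp only [hk]; omega)
        omega
    · obtain ⟨k, hk⟩ := σ.symm.surjective ⟨p, hp'⟩
      revert hk
      refine Fin.addCases (fun x hk => ?_) (fun y hk => ?_) k
      · have := (c1 x).1 (by omega)
        simp only [hk] at this
        omega
      · have := (c2 y).1 (by omega)
        simp only [hk] at this
        omega
  rw [Finset.sum_congr rfl hterm, Finset.sum_add_distrib, Finset.sum_ite_eq, Finset.sum_ite_eq]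
  congr 1
  · rw [← ite_and]
    refine if_congr ?_ rfl rfl
    refine ⟨fun h => h.2, fun h => ⟨?_, h⟩⟩
    rw [Finset.mem_filter, mem_battements]
    exact ⟨⟨fun _ _ h _ => h, fun _ _ h _ => h⟩, sorted_one j m⟩
  · rw [← ite_and]
    refine if_congr ?_ rfl rfl
    refine ⟨fun h => h.2, fun h => ⟨?_, h⟩⟩
    subst h
    rw [Finset.mem_filter]
    refine ⟨?_, sorted_blockSwap j m⟩
    rw [← mul_one (blockSwap j m), mul_one, mem_battements]
    have hb : ∀ i, (∃ y : Fin m, i.val = y.val ∧ blockSwap j m i = Fin.natAdd j y) ∨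
        ∃ x : Fin j, i.val = m + x.val ∧ blockSwap j m i = Fin.castAdd m x := by
      intro i
      obtain ⟨k, rfl⟩ := (blockSwap j m).symm.surjective i
      rw [Equiv.apply_symm_apply]
      refine Fin.addCases (fun x => ?_) (fun y => ?_) k
      · right
        exact ⟨x, by rw [blockSwap_symm_castAdd]; rfl, rfl⟩
      · left
        exact ⟨y, by rw [blockSwap_symm_natAdd]; rfl, rfl⟩
    constructor <;> intro i i' h h' <;> rw [Fin.lt_def] at h ⊢ <;>
      rcases hb i with ⟨y, e, e'⟩ | ⟨x, e, e'⟩ <;>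
      rcases hb i' with ⟨y', f, f'⟩ | ⟨x', f, f'⟩ <;>
      rw [e', f'] <;> simp only [Fin.val_natAdd, Fin.val_castAdd] <;> omega


/-! ### Signs -/

variable [DirectSum.Decomposition 𝒱]

theorem map_signTwist_tprod (c : ℤ) {n : ℕ} {d : Fin n → ℤ} {v : Fin n → V}
    (hv : ∀ i, v i ∈ 𝒱 (d i)) :
    PiTensorProduct.map (fun _ : Fin n => signTwist 𝒱 c) (PiTensorProduct.tprod 𝕜 v)
      = (((c * ∑ i, d i).negOnePow : ℤ) : 𝕜) • PiTensorProduct.tprod 𝕜 v := by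
  rw [PiTensorProduct.map_tprod]
  have : (fun i => signTwist 𝒱 c (v i))
      = fun i => (((c * d i).negOnePow : ℤ) : 𝕜) • v i := by
    funext i
    rw [signTwist_of_mem 𝒱 c (hv i), Units.smul_def, Int.cast_smul_eq_zsmul]
  rw [this, MultilinearMap.map_smul_univ, Finset.mul_sum, negOnePow_sum]
  push_cast
  rfl

theorem map_signTwist_bat (c : ℤ) {n p : ℕ} {d : Fin n → ℤ} {v : Fin n → V}
    (hv : ∀ i, v i ∈ 𝒱 (d i)) :
    PiTensorProduct.map (fun _ : Fin n => signTwist 𝒱 c) (bat (𝕜 := 𝕜) p d v)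
      = (((c * ∑ i, d i).negOnePow : ℤ) : 𝕜) • bat (𝕜 := 𝕜) p d v := by
  rw [bat, map_sum, Finset.smul_sum]
  refine Finset.sum_congr rfl fun σ _ => ?_
  rw [map_smul, map_signTwist_tprod 𝒱 c fun i => hv (σ.symm i), smul_comm,
    Equiv.sum_comp σ.symm d]

/-- The linear map of `⨂̲⁺ V` equal to `X ↦ (-1)^{c·x} X` in degree `x`. -/
noncomputable def packetTwist (c : ℤ) : Packets 𝒱 →ₗ[𝕜] Packets 𝒱 :=
  DirectSum.lmap fun n : ℕ => PacketPower.lift 𝒱 (n + 1)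
    (PacketPower.mk 𝒱 (n + 1) ∘ₗ PiTensorProduct.map fun _ => signTwist 𝒱 c) <|
      batImage_le fun p hp hn d v hv => by
        rw [LinearMap.mem_ker, LinearMap.comp_apply, map_signTwist_bat 𝒱 c hv,
          map_smul, (PacketPower.mk_eq_zero 𝒱).2 (mem_batImage hp hn hv),
          smul_zero]

theorem packetTwist_packet (c : ℤ) {n : ℕ} {d : Fin n → ℤ} {v : Fin n → V}
    (hv : ∀ i, v i ∈ 𝒱 (d i)) :
    packetTwist 𝒱 c (packet 𝒱 v) = (((c * ∑ i, d i).negOnePow : ℤ) : 𝕜) • packet 𝒱 v := by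
  cases n with
  | zero => rw [packet_zero, map_zero, smul_zero]
  | succ n =>
    rw [packet, cls, LinearMap.comp_apply, packetTwist, DirectSum.lmap_lof,
      PacketPower.lift_mk, LinearMap.comp_apply, map_signTwist_tprod 𝒱 c hv,
      map_smul, map_smul]

/-- The volte `τ(X ⊗ Y) = (-1)^{x·y} Y ⊗ X`: with `s(X) = (-1)^x X`, the even part of `X` is
`(X + s(X))/2` and its odd part is `(X - s(X))/2`, so that `X ⊗ Y` is sent to
`Y ⊗ X_even + s(Y) ⊗ X_odd`. -/
noncomputable def volte : Packets 𝒱 ⊗[𝕜] Packets 𝒱 →ₗ[𝕜] Packets 𝒱 ⊗[𝕜] Packets 𝒱 :=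
  (TensorProduct.comm 𝕜 (Packets 𝒱) (Packets 𝒱)).toLinearMap ∘ₗ
    (TensorProduct.map ((2 : 𝕜)⁻¹ • ((LinearMap.id : Packets 𝒱 →ₗ[𝕜] Packets 𝒱) + packetTwist 𝒱 1))
        (LinearMap.id : Packets 𝒱 →ₗ[𝕜] Packets 𝒱)
      + TensorProduct.map ((2 : 𝕜)⁻¹ • ((LinearMap.id : Packets 𝒱 →ₗ[𝕜] Packets 𝒱) - packetTwist 𝒱 1))
        (packetTwist 𝒱 1))

theorem volte_packet [CharZero 𝕜] {n m : ℕ} {d : Fin n → ℤ} {v : Fin n → V} {e : Fin m → ℤ}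
    {w : Fin m → V} (hv : ∀ i, v i ∈ 𝒱 (d i)) (hw : ∀ i, w i ∈ 𝒱 (e i)) :
    volte 𝒱 (packet 𝒱 v ⊗ₜ packet 𝒱 w)
      = ((((∑ i, d i) * ∑ i, e i).negOnePow : ℤ) : 𝕜) • (packet 𝒱 w ⊗ₜ[𝕜] packet 𝒱 v) := by
  have hx := packetTwist_packet 𝒱 1 hv
  have hy := packetTwist_packet 𝒱 1 hw
  rw [one_mul] at hx hy
  simp only [volte, LinearMap.comp_apply, LinearMap.add_apply, LinearMap.sub_apply,
    LinearMap.smul_apply, TensorProduct.map_tmul, LinearMap.id_apply, hx, hy, map_add,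
    LinearEquiv.coe_coe, TensorProduct.comm_tmul]
  have half : ∀ X : Packets 𝒱, (2 : 𝕜)⁻¹ • (X + X) = X := fun X => by
    rw [← two_smul 𝕜 X, smul_smul, inv_mul_cancel₀ two_ne_zero, one_smul]
  rcases Int.even_or_odd (∑ i, d i) with h | h
  · rw [Int.negOnePow_even _ h, Int.negOnePow_even _ (h.mul_right _)]
    simp [half]
  · rw [Int.negOnePow_odd _ h]
    have : ((∑ i, d i) * ∑ i, e i).negOnePow = (∑ i, e i).negOnePow := by
      rw [Int.negOnePow_eq_iff]
      obtain ⟨k, hk⟩ := h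
      exact ⟨k * ∑ i, e i, by rw [hk]; ring⟩
    rw [this]
    simp only [Units.val_neg, Units.val_one, Int.cast_neg, Int.cast_one, neg_smul, one_smul,
      add_neg_cancel, smul_zero, TensorProduct.tmul_zero, zero_add, sub_neg_eq_add, half,
      TensorProduct.smul_tmul']

/-! ### The cobracket -/

/-- `v_1 ⊗ … ⊗ v_n ↦ ∑_{U ⊗̲ V = X, U, V ≠ ∅} U ⊗ V - (-1)^{vu} V ⊗ U`, with
`X = v_1 ⊗̲ … ⊗̲ v_n`. -/
noncomputable def tensorCobracket (n : ℕ) :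
    (⨂[𝕜]^n V) →ₗ[𝕜] Packets 𝒱 ⊗[𝕜] Packets 𝒱 :=
  (LinearMap.id - volte 𝒱) ∘ₗ
    ∑ x : Finset.HasAntidiagonal.antidiagonal n, cut 𝒱 x.1.1 x.1.2 (Finset.HasAntidiagonal.mem_antidiagonal.1 x.2)

theorem batImage_le_ker_tensorCobracket [CharZero 𝕜] (n : ℕ) :
    batImage 𝒱 n ≤ LinearMap.ker (tensorCobracket 𝒱 n) := by
  refine batImage_le fun p hp hn d v hv => ?_
  obtain ⟨q, rfl⟩ : ∃ q, n = p + q := ⟨n - p, by omega⟩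
  set T := packet 𝒱 (fun x : Fin p => v (Fin.castAdd q x)) ⊗ₜ[𝕜]
    packet 𝒱 (fun y : Fin q => v (Fin.natAdd p y)) with hT
  have hvT := volte_packet 𝒱 (fun x : Fin p => hv (Fin.castAdd q x))
    (fun y : Fin q => hv (Fin.natAdd p y))
  have hvT' := volte_packet 𝒱 (fun y : Fin q => hv (Fin.natAdd p y))
    (fun x : Fin p => hv (Fin.castAdd q x))
  have hcut : ∀ (j m : ℕ) (h : j + m = p + q), cut 𝒱 j m h (bat p d v)
      = (if j = p then T else 0) + if m = p then volte 𝒱 T else 0 := by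
    intro j m h
    have key : ∀ (n : ℕ) (h : j + m = n) (hn : n = p + q) (d : Fin n → ℤ) (v : Fin n → V)
        (_ : ∀ i, v i ∈ 𝒱 (d i)), cut 𝒱 j m h (bat p d v)
      = (if j = p then packet 𝒱 (fun x : Fin p => v (Fin.cast hn.symm (Fin.castAdd q x))) ⊗ₜ[𝕜]
          packet 𝒱 (fun y : Fin q => v (Fin.cast hn.symm (Fin.natAdd p y))) else 0)
        + if m = p then volte 𝒱
          (packet 𝒱 (fun x : Fin p => v (Fin.cast hn.symm (Fin.castAdd q x))) ⊗ₜ[𝕜]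
          packet 𝒱 (fun y : Fin q => v (Fin.cast hn.symm (Fin.natAdd p y)))) else 0 := by
      rintro n rfl hn d' v' hv'
      rw [cut_bat 𝒱 hp (by omega) hv']
      congr 1
      · split_ifs with hj
        · subst hj
          obtain rfl : m = q := by omega
          rfl
        · rfl
      · split_ifs with hj
        · subst hj
          obtain rfl : j = q := by omega
          rw [volte_packet 𝒱 (fun x : Fin m => hv' (Fin.cast hn.symm (Fin.castAdd j x)))
            (fun y : Fin j => hv' (Fin.cast hn.symm (Fin.natAdd m y))), koszulSign_blockSwap]
        · rfl
    exact key (p + q) h rfl d v hv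
  rw [LinearMap.mem_ker, tensorCobracket, LinearMap.comp_apply, LinearMap.sum_apply]
  simp only [hcut]
  rw [Finset.sum_coe_sort (Finset.HasAntidiagonal.antidiagonal (p + q))
    (fun x : ℕ × ℕ => (if x.1 = p then T else 0) + if x.2 = p then volte 𝒱 T else 0),
    Finset.sum_add_distrib,
    Finset.sum_eq_single (p, q) (fun x hx hne => if_neg fun h => hne (by
      rw [Finset.HasAntidiagonal.mem_antidiagonal] at hx; ext <;> simp only <;> omega))
      (fun h => absurd (by simp) h),
    Finset.sum_eq_single (q, p) (fun x hx hne => if_neg fun h => hne (by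
      rw [Finset.HasAntidiagonal.mem_antidiagonal] at hx; ext <;> simp only <;> omega))
      (fun h => absurd (by simp [add_comm]) h), if_pos rfl, if_pos rfl]
  have h2 : volte 𝒱 (volte 𝒱 T) = T := by
    rw [hT, hvT, map_smul, hvT', smul_smul, mul_comm (∑ i, d (Fin.natAdd p i)), ← Int.cast_mul,
      ← Units.val_mul, Int.units_mul_self, Units.val_one, Int.cast_one, one_smul]
  rw [LinearMap.sub_apply, LinearMap.id_apply, map_add, h2]
  abel

/-- The Lie cobracket `δ` of `⨂̲⁺ V`. -/
noncomputable def cobracket [CharZero 𝕜] : Packets 𝒱 →ₗ[𝕜] Packets 𝒱 ⊗[𝕜] Packets 𝒱 :=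
  DirectSum.toModule 𝕜 ℕ _ fun n =>
    PacketPower.lift 𝒱 (n + 1) (tensorCobracket 𝒱 (n + 1))
      (batImage_le_ker_tensorCobracket 𝒱 (n + 1))

/-! ### Compatibility of a bracket with the cobracket -/

/-- `τ₁₂ = τ ⊗ id` on `⨂̲⁺ V ⊗ ⨂̲⁺ V ⊗ ⨂̲⁺ V`. -/
noncomputable def volte₁₂ :
    (Packets 𝒱 ⊗[𝕜] Packets 𝒱) ⊗[𝕜] Packets 𝒱 →ₗ[𝕜] (Packets 𝒱 ⊗[𝕜] Packets 𝒱) ⊗[𝕜] Packets 𝒱 :=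
  (volte 𝒱).rTensor (Packets 𝒱)

/-- `τ₂₃ = id ⊗ τ` on `⨂̲⁺ V ⊗ ⨂̲⁺ V ⊗ ⨂̲⁺ V`. -/
noncomputable def volte₂₃ :
    (Packets 𝒱 ⊗[𝕜] Packets 𝒱) ⊗[𝕜] Packets 𝒱 →ₗ[𝕜] (Packets 𝒱 ⊗[𝕜] Packets 𝒱) ⊗[𝕜] Packets 𝒱 :=
  (TensorProduct.assoc 𝕜 (Packets 𝒱) (Packets 𝒱) (Packets 𝒱)).symm.toLinearMap ∘ₗ
    (volte 𝒱).lTensor (Packets 𝒱) ∘ₗ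
      (TensorProduct.assoc 𝕜 (Packets 𝒱) (Packets 𝒱) (Packets 𝒱)).toLinearMap

/-- `δ ⊗ id`. -/
noncomputable def cobracketLeft [CharZero 𝕜] :
    Packets 𝒱 ⊗[𝕜] Packets 𝒱 →ₗ[𝕜] (Packets 𝒱 ⊗[𝕜] Packets 𝒱) ⊗[𝕜] Packets 𝒱 :=
  (cobracket 𝒱).rTensor (Packets 𝒱)

/-- `id ⊗ δ` (no sign, as `δ` has degree `0`). -/
noncomputable def cobracketRight [CharZero 𝕜] :
    Packets 𝒱 ⊗[𝕜] Packets 𝒱 →ₗ[𝕜] (Packets 𝒱 ⊗[𝕜] Packets 𝒱) ⊗[𝕜] Packets 𝒱 :=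
  (TensorProduct.assoc 𝕜 (Packets 𝒱) (Packets 𝒱) (Packets 𝒱)).symm.toLinearMap ∘ₗ
    (cobracket 𝒱).lTensor (Packets 𝒱)

/-- `m ⊗ id`. -/
noncomputable def bracketLeft (m : Packets 𝒱 ⊗[𝕜] Packets 𝒱 →ₗ[𝕜] Packets 𝒱) :
    (Packets 𝒱 ⊗[𝕜] Packets 𝒱) ⊗[𝕜] Packets 𝒱 →ₗ[𝕜] Packets 𝒱 ⊗[𝕜] Packets 𝒱 :=
  m.rTensor (Packets 𝒱)

/-- `id ⊗ m` for `m` of degree `c`, with the Koszul sign: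
`(id ⊗ m)(X ⊗ Y ⊗ Z) = (-1)^{c·x} X ⊗ m(Y ⊗ Z)`. -/
noncomputable def bracketRight (c : ℤ) (m : Packets 𝒱 ⊗[𝕜] Packets 𝒱 →ₗ[𝕜] Packets 𝒱) :
    (Packets 𝒱 ⊗[𝕜] Packets 𝒱) ⊗[𝕜] Packets 𝒱 →ₗ[𝕜] Packets 𝒱 ⊗[𝕜] Packets 𝒱 :=
  TensorProduct.map (packetTwist 𝒱 c) m ∘ₗ
    (TensorProduct.assoc 𝕜 (Packets 𝒱) (Packets 𝒱) (Packets 𝒱)).toLinearMap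

/-- The bracket `m` is of degree `c`. -/
def IsOfDegree (c : ℤ) (m : Packets 𝒱 ⊗[𝕜] Packets 𝒱 →ₗ[𝕜] Packets 𝒱) : Prop :=
  ∀ (x y : ℤ) (X Y : Packets 𝒱), X ∈ packetDegree 𝒱 x → Y ∈ packetDegree 𝒱 y →
    m (X ⊗ₜ Y) ∈ packetDegree 𝒱 (x + y + c)

/-- The bracket `m` of `⨂̲⁺ V` extends the bracket `ℓ` of the space of cogenerators `V`:
its corestriction to `V` is `ℓ`, that is `pr ∘ m = ℓ ∘ (pr ⊗ pr)` for the projection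
`pr : ⨂̲⁺ V → V`. -/
def Extends (l : V →ₗ[𝕜] V →ₗ[𝕜] V) (m : Packets 𝒱 ⊗[𝕜] Packets 𝒱 →ₗ[𝕜] Packets 𝒱) : Prop :=
  ∀ X Y : Packets 𝒱, cogenProj 𝒱 (m (X ⊗ₜ Y)) = l (cogenProj 𝒱 X) (cogenProj 𝒱 Y)

/-- The identity
`δ ∘ m = (m ⊗ id) ∘ (τ₂₃ ∘ (δ ⊗ id) + id ⊗ δ) + (id ⊗ m) ∘ (δ ⊗ id + τ₁₂ ∘ (id ⊗ δ))`
for a bracket `m` of degree `c`. -/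
def IsCompatible [CharZero 𝕜] (c : ℤ) (m : Packets 𝒱 ⊗[𝕜] Packets 𝒱 →ₗ[𝕜] Packets 𝒱) : Prop :=
  cobracket 𝒱 ∘ₗ m =
    bracketLeft 𝒱 m ∘ₗ (volte₂₃ 𝒱 ∘ₗ cobracketLeft 𝒱 + cobracketRight 𝒱) +
      bracketRight 𝒱 c m ∘ₗ (cobracketLeft 𝒱 + volte₁₂ 𝒱 ∘ₗ cobracketRight 𝒱)

end Packets

/-- The space `ℋ = ⨂̲⁺(A[-a+1])`. -/
abbrev HSpace {𝕜 A : Type*} [Field 𝕜] [AddCommGroup A] [Module 𝕜 A]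
    (𝒜 : ℤ → Submodule 𝕜 A) (a : ℤ) : Type _ := Packets (shifted 𝒜 a)

end ABAlgebra

open ABAlgebra

/-! Uniqueness is the statement that $\mathcal H$ is cogenerated by $V$: an element killed by both
$\delta$ and $\mathrm{pr}$ is zero (`eq_zero_of_cobracket_eq_zero`). On a pair of words $(u,v)$ the
right-hand side of the identity $(\ast)$ only involves brackets of pairs of smaller total length,
because cuts with an empty side give zero. By induction on the total length, two solutions therefore
differ by an element of the kernel of $\delta$ without component in $V$
(`eq_of_extends_of_isCompatible`). That kernel is controlled by a dual form of the Dynkin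
idempotent. Iterating $(\mathrm{pr}\otimes id)\circ\delta$ defines a map from packets to tensors,
and on a word it equals the convolution of the length-weighted identity with the antipode of the
shuffle algebra (`iteratedCobracket_wordPacket`). Modulo proper shuffles only the term with empty
antipode part survives, so the composite with the class map multiplies a word of length $n$ by $n$
(`map_dynkin`). In characteristic $0$ this is injective. Existence is proved on free modules over
words in homogeneous letters, where products are defined by recursion on first letters and
identities are checked by induction. The bracket of two words is a graded biderivation of the
shuffle product (`wordBracket_shuffle_left`, `wordBracket_shuffle_right`), hence respects the
quotient by shuffles in each argument. Its deconcatenation is a sum of terms (bracket) ⊗ (shuffle)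
and (shuffle) ⊗ (bracket) (`deconcat_wordBracket`). In the quotient a shuffle survives only when one
factor is empty, and what remains is one half of $(\ast)$, while the graded flip supplies the other
half (`isCompatible_of_apply_wordPacket`). Two translations link the recursions to the stated
formulas. Sorting shuffles by their first letter identifies the recursive shuffle with the sum over
$Bat(p,q)$ (`sum_battements_word`), and colouring the letters by their word of origin turns the
recursive bracket into the sum over contracted positions (`bracketWord_eq_sum`). Since degrees are
only attached to homogeneous vectors, the formula is extended to all tensors by splitting each
argument into its even and odd parts (`exists_multilinear_of_parity`). -/

open ABAlgebra

namespace ABAlgebra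

/-! ### The combinatorial model: shuffle product, bracket and coproduct on words -/

section Words

variable {R L M : Type*} [CommRing R]

/-! ### Commutation signs -/

/-- The Koszul sign `(-1)^{xy}` in the ring `R`. -/
def commSign (R : Type*) [CommRing R] (x y : ℤ) : R := (((x * y).negOnePow : ℤ) : R)

theorem commSign_add_left (x y z : ℤ) :
    commSign R (x + y) z = commSign R x z * commSign R y z := by
  simp [commSign, add_mul, Int.negOnePow_add]

theorem commSign_add_right (x y z : ℤ) :
    commSign R x (y + z) = commSign R x y * commSign R x z := by
  simp [commSign, mul_add, Int.negOnePow_add]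

theorem commSign_zero_left (x : ℤ) : commSign R 0 x = 1 := by simp [commSign]

theorem commSign_zero_right (x : ℤ) : commSign R x 0 = 1 := by simp [commSign]

theorem commSign_comm (x y : ℤ) : commSign R x y = commSign R y x := by
  rw [commSign, commSign, mul_comm]

theorem commSign_mul_self (x y : ℤ) : commSign R x y * commSign R x y = 1 := by
  rw [commSign, ← Int.cast_mul, ← Units.val_mul, Int.units_mul_self, Units.val_one, Int.cast_one]

theorem commSign_mul_self_mul (x y : ℤ) (r : R) :
    commSign R x y * (commSign R x y * r) = r := by
  rw [← mul_assoc, commSign_mul_self, one_mul]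

/-! ### Linear combinations of words -/

/-- The word `w` as an element of the free module on words. -/
noncomputable def word (R : Type*) [CommRing R] (w : List L) : List L →₀ R := Finsupp.single w 1

/-- Linear extension of a map defined on words. -/
noncomputable def wordLift [AddCommMonoid M] [Module R M] (f : List L → M) :
    (List L →₀ R) →ₗ[R] M :=
  Finsupp.linearCombination R f

theorem wordLift_word [AddCommMonoid M] [Module R M] (f : List L → M) (w : List L) :
    wordLift (R := R) f (word R w) = f w := by
  simp [wordLift, word]

theorem word_ext [AddCommMonoid M] [Module R M] {f g : (List L →₀ R) →ₗ[R] M}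
    (h : ∀ w, f (word R w) = g (word R w)) : f = g :=
  Finsupp.lhom_ext' fun w => LinearMap.ext_ring (h w)

/-- Adding the letter `a` in front of words. -/
noncomputable def consLetter (a : L) : (List L →₀ R) →ₗ[R] (List L →₀ R) :=
  wordLift fun w => word R (a :: w)

theorem word_cons (a : L) (w : List L) : word R (a :: w) = consLetter a (word R w) := by
  rw [consLetter, wordLift_word]

variable (deg : L → ℤ)

/-- The degree of a word. -/
def wordDeg (w : List L) : ℤ := (w.map deg).sum

theorem wordDeg_nil : wordDeg deg [] = 0 := rfl

theorem wordDeg_cons (a : L) (w : List L) : wordDeg deg (a :: w) = deg a + wordDeg deg w := by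
  simp [wordDeg]

theorem wordDeg_append (u v : List L) : wordDeg deg (u ++ v) = wordDeg deg u + wordDeg deg v := by
  simp [wordDeg]

/-- The linear map `w ↦ (-1)^{x·w} w`. -/
noncomputable def twist (x : ℤ) : (List L →₀ R) →ₗ[R] (List L →₀ R) :=
  wordLift fun w => commSign R x (wordDeg deg w) • word R w

theorem twist_word (x : ℤ) (w : List L) :
    twist deg x (word R w) = commSign R x (wordDeg deg w) • word R w := wordLift_word _ _

theorem twist_cons (x : ℤ) (a : L) (t : List L →₀ R) :
    twist deg x (consLetter a t) = commSign R x (deg a) • consLetter a (twist deg x t) := by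
  have : twist deg x ∘ₗ consLetter a
      = commSign R x (deg a) • (consLetter a ∘ₗ twist (R := R) deg x) := by
    refine word_ext fun w => ?_
    simp only [LinearMap.comp_apply, LinearMap.smul_apply, ← word_cons, twist_word, map_smul,
      wordDeg_cons, commSign_add_right, smul_smul]
  exact LinearMap.congr_fun this t

/-! ### The shuffle product -/

/-- The graded shuffle product of two words. -/
noncomputable def shuffleWord (R : Type*) [CommRing R] : List L → List L → (List L →₀ R)
  | [], v => word R v
  | a :: u, [] => word R (a :: u)
  | a :: u, b :: v => consLetter a (shuffleWord R u (b :: v)) +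
      commSign R (deg b) (wordDeg deg (a :: u)) • consLetter b (shuffleWord R (a :: u) v)
termination_by u v => u.length + v.length

theorem shuffleWord_nil_left (v : List L) : shuffleWord deg R [] v = word R v := by
  rw [shuffleWord]

theorem shuffleWord_nil_right (u : List L) : shuffleWord deg R u [] = word R u := by
  cases u <;> rw [shuffleWord]

theorem shuffleWord_cons_cons (a b : L) (u v : List L) :
    shuffleWord deg R (a :: u) (b :: v) = consLetter a (shuffleWord deg R u (b :: v)) +
      commSign R (deg b) (wordDeg deg (a :: u)) • consLetter b (shuffleWord deg R (a :: u) v) := by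
  rw [shuffleWord]

/-- The graded shuffle product. -/
noncomputable def shuffle : (List L →₀ R) →ₗ[R] (List L →₀ R) →ₗ[R] (List L →₀ R) :=
  wordLift fun u => wordLift fun v => shuffleWord deg R u v

theorem shuffle_word (u v : List L) :
    shuffle deg (word R u) (word R v) = shuffleWord deg R u v := by
  rw [shuffle, wordLift_word, wordLift_word]

theorem shuffle_nil_left (t : List L →₀ R) : shuffle deg (word R []) t = t := by
  have : shuffle deg (word R ([] : List L)) = LinearMap.id :=
    word_ext fun w => by rw [shuffle_word, shuffleWord_nil_left, LinearMap.id_apply]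
  rw [this, LinearMap.id_apply]

theorem shuffle_nil_right (t : List L →₀ R) : shuffle deg t (word R []) = t := by
  have : (shuffle deg).flip (word R ([] : List L)) = LinearMap.id :=
    word_ext fun w => by
      rw [LinearMap.flip_apply, shuffle_word, shuffleWord_nil_right, LinearMap.id_apply]
  rw [← LinearMap.flip_apply, this, LinearMap.id_apply]

/-- Bilinear identities may be checked on words. -/
theorem word_ext₂ [AddCommMonoid M] [Module R M]
    {f g : (List L →₀ R) →ₗ[R] (List L →₀ R) →ₗ[R] M}
    (h : ∀ u v, f (word R u) (word R v) = g (word R u) (word R v)) : f = g :=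
  word_ext fun u => word_ext fun v => h u v

/-- The sign for moving `b` past the first factor depends on the degree of `t`. Absorbing it into
`twist` gives a recursion valid for arbitrary linear combinations, which can then be used as a
rewriting rule. -/
theorem shuffle_cons_cons (a b : L) (t s : List L →₀ R) :
    shuffle deg (consLetter a t) (consLetter b s) =
      consLetter a (shuffle deg t (consLetter b s)) +
        commSign R (deg b) (deg a) •
          consLetter b (shuffle deg (consLetter a (twist deg (deg b) t)) s) := by
  have : (shuffle deg).compl₁₂ (consLetter a) (consLetter b) =
      ((shuffle deg).compl₂ (consLetter b)).compr₂ (consLetter a) + commSign R (deg b) (deg a) •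
        ((shuffle deg).comp (consLetter a ∘ₗ twist (R := R) deg (deg b))).compr₂
          (consLetter b) := by
    refine word_ext₂ fun u v => ?_
    simp only [LinearMap.compl₁₂_apply, LinearMap.add_apply, LinearMap.compr₂_apply,
      LinearMap.compl₂_apply, LinearMap.smul_apply, LinearMap.comp_apply, twist_word,
      ← word_cons, map_smul, shuffle_word, shuffleWord_cons_cons, wordDeg_cons,
      commSign_add_right, smul_smul]
  exact LinearMap.congr_fun₂ this t s

/-- Every term of a shuffle contains the same letters, so the sign attached to the degree is
multiplicative. -/
theorem twist_shuffle (x : ℤ) (t s : List L →₀ R) :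
    twist deg x (shuffle deg t s) = shuffle deg (twist deg x t) (twist deg x s) := by
  suffices h : ∀ u v : List L, twist deg x (shuffle deg (word R u) (word R v)) =
      shuffle deg (twist deg x (word R u)) (twist deg x (word R v)) by
    have : (shuffle (R := R) deg).compr₂ (twist deg x)
        = (shuffle deg).compl₁₂ (twist deg x) (twist deg x) := word_ext₂ h
    exact LinearMap.congr_fun₂ this t s
  intro u
  induction u with
  | nil => intro v; simp [shuffle_nil_left, twist_word, wordDeg_nil, commSign_zero_right]
  | cons a u ihu =>
    intro v
    induction v with
    | nil => simp [shuffle_nil_right, twist_word, wordDeg_nil, commSign_zero_right]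
    | cons b v ihv =>
      have h1 := ihu (b :: v)
      simp only [word_cons, twist_cons, twist_word, map_smul, map_add, LinearMap.smul_apply,
        shuffle_cons_cons, smul_add, smul_smul] at h1 ihv ⊢
      rw [h1, ihv]
      simp only [map_smul, smul_smul, mul_comm, mul_left_comm]

theorem shuffle_assoc (t s r : List L →₀ R) :
    shuffle deg (shuffle deg t s) r = shuffle deg t (shuffle deg s r) := by
  suffices h : ∀ u v w : List L, shuffle deg (shuffle deg (word R u) (word R v)) (word R w) =
      shuffle deg (word R u) (shuffle deg (word R v) (word R w)) by
    have h1 : ∀ w, (shuffle (R := R) deg).compr₂ ((shuffle deg).flip (word R w))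
        = (shuffle deg).compl₂ ((shuffle deg).flip (word R w)) := fun w =>
      word_ext₂ fun u v => h u v w
    have h2 : ∀ t s, (shuffle (R := R) deg) (shuffle deg t s)
        = (shuffle deg t).comp (shuffle deg s) := fun t s => word_ext fun w =>
      LinearMap.congr_fun₂ (h1 w) t s
    exact LinearMap.congr_fun (h2 t s) r
  intro u
  induction u with
  | nil => intro v w; simp only [shuffle_nil_left]
  | cons a u ihu =>
    intro v
    induction v with
    | nil => intro w; simp only [shuffle_nil_left, shuffle_nil_right]
    | cons b v ihv =>
      intro w
      induction w with
      | nil => simp only [shuffle_nil_right]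
      | cons e w ihw =>
        have h1 := ihu (b :: v) (e :: w)
        have h2 := ihv (e :: w)
        clear ihu ihv
        simp only [word_cons, twist_cons, twist_word, twist_shuffle, map_smul, map_add,
          LinearMap.smul_apply, LinearMap.add_apply,
          shuffle_cons_cons, smul_add, smul_smul] at h1 h2 ihw ⊢
        -- The three hypotheses treat the terms whose first letter is `a`, `b` and `e` respectively.
        rw [h1, h2, ← ihw]
        simp only [map_add, map_smul, smul_add, smul_smul]
        simp only [mul_comm, mul_left_comm, commSign_comm]
        abel
end Words

section Words

variable {R L M : Type*} [CommRing R] (deg : L → ℤ)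

theorem shuffle_comm_word (u v : List L) :
    shuffle deg (word R u) (word R v) =
      commSign R (wordDeg deg u) (wordDeg deg v) • shuffle deg (word R v) (word R u) := by
  induction u generalizing v with
  | nil => simp only [shuffle_nil_left, shuffle_nil_right, wordDeg_nil, commSign_zero_left, one_smul]
  | cons a u ihu =>
    induction v with
    | nil =>
      simp only [shuffle_nil_left, shuffle_nil_right, wordDeg_nil, commSign_zero_right, one_smul]
    | cons b v ihv =>
      have h1 := ihu (b :: v)
      simp only [word_cons, twist_word, map_smul, LinearMap.smul_apply,
        shuffle_cons_cons, smul_add, smul_smul, wordDeg_cons] at h1 ihv ⊢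
      rw [h1, ihv]
      simp only [map_smul, smul_smul, commSign_add_left, commSign_add_right]
      simp only [mul_comm, mul_left_comm, commSign_comm,
        commSign_mul_self_mul]
      abel

/-! ### The bracket of words -/

variable (c : ℤ) (l : L → L → L)

/-- The bracket of two words: the sum over their shuffles of the contractions by `l` of a letter
of the first word followed by a letter of the second word. -/
noncomputable def bracketWord (R : Type*) [CommRing R] : List L → List L → (List L →₀ R)
  | [], _ => 0
  | _ :: _, [] => 0
  | a :: u, b :: v => commSign R c (deg a) • consLetter a (bracketWord R u (b :: v)) +
      (commSign R (deg b) (wordDeg deg (a :: u)) * commSign R c (deg b)) •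
        consLetter b (bracketWord R (a :: u) v) +
      commSign R (deg b) (wordDeg deg u) • consLetter (l a b) (shuffleWord deg R u v)
termination_by u v => u.length + v.length

theorem bracketWord_nil_left (v : List L) : bracketWord deg c l R [] v = 0 := by
  rw [bracketWord]

theorem bracketWord_nil_right (u : List L) : bracketWord deg c l R u [] = 0 := by
  cases u <;> rw [bracketWord]

theorem bracketWord_cons_cons (a b : L) (u v : List L) :
    bracketWord deg c l R (a :: u) (b :: v) =
      commSign R c (deg a) • consLetter a (bracketWord deg c l R u (b :: v)) +
      (commSign R (deg b) (wordDeg deg (a :: u)) * commSign R c (deg b)) •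
        consLetter b (bracketWord deg c l R (a :: u) v) +
      commSign R (deg b) (wordDeg deg u) • consLetter (l a b) (shuffleWord deg R u v) := by
  rw [bracketWord]

/-- The bilinear extension of `bracketWord`. -/
noncomputable def wordBracket : (List L →₀ R) →ₗ[R] (List L →₀ R) →ₗ[R] (List L →₀ R) :=
  wordLift fun u => wordLift fun v => bracketWord deg c l R u v

theorem wordBracket_word (u v : List L) :
    wordBracket deg c l (word R u) (word R v) = bracketWord deg c l R u v := by
  rw [wordBracket, wordLift_word, wordLift_word]

theorem wordBracket_nil_left (t : List L →₀ R) : wordBracket deg c l (word R []) t = 0 := by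
  have : wordBracket deg c l (word R ([] : List L)) = 0 :=
    word_ext fun w => by rw [wordBracket_word, bracketWord_nil_left, LinearMap.zero_apply]
  rw [this, LinearMap.zero_apply]

theorem wordBracket_nil_right (t : List L →₀ R) : wordBracket deg c l t (word R []) = 0 := by
  have : (wordBracket deg c l).flip (word R ([] : List L)) = 0 :=
    word_ext fun w => by
      rw [LinearMap.flip_apply, wordBracket_word, bracketWord_nil_right, LinearMap.zero_apply]
  rw [← LinearMap.flip_apply, this, LinearMap.zero_apply]

theorem wordBracket_cons_cons (a b : L) (t s : List L →₀ R) :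
    wordBracket deg c l (consLetter a t) (consLetter b s) =
      commSign R c (deg a) • consLetter a (wordBracket deg c l t (consLetter b s)) +
        (commSign R (deg b) (deg a) * commSign R c (deg b)) •
          consLetter b (wordBracket deg c l (consLetter a (twist deg (deg b) t)) s) +
        consLetter (l a b) (shuffle deg (twist deg (deg b) t) s) := by
  have : (wordBracket deg c l).compl₁₂ (consLetter a) (consLetter b) =
      commSign R c (deg a) •
        ((wordBracket deg c l).compl₂ (consLetter b)).compr₂ (consLetter a) +
      (commSign R (deg b) (deg a) * commSign R c (deg b)) •
        ((wordBracket deg c l).comp (consLetter a ∘ₗ twist (R := R) deg (deg b))).compr₂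
          (consLetter b) +
      ((shuffle deg).comp (twist (R := R) deg (deg b))).compr₂ (consLetter (l a b)) := by
    refine word_ext₂ fun u v => ?_
    simp only [LinearMap.compl₁₂_apply, LinearMap.add_apply, LinearMap.compr₂_apply,
      LinearMap.compl₂_apply, LinearMap.smul_apply, LinearMap.comp_apply, twist_word,
      ← word_cons, map_smul, wordBracket_word, shuffle_word, bracketWord_cons_cons, wordDeg_cons,
      commSign_add_right, smul_smul, mul_comm, mul_left_comm]
  exact LinearMap.congr_fun₂ this t s

-- The extra sign is due to the degree `c` of the bracket. As for the shuffle product, this lets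
-- `twist` pass through the recursion.
variable {deg c l} in
theorem twist_wordBracket (hl : ∀ a b, deg (l a b) = deg a + deg b + c) (x : ℤ)
    (t s : List L →₀ R) :
    twist deg x (wordBracket deg c l t s) =
      commSign R x c • wordBracket deg c l (twist deg x t) (twist deg x s) := by
  suffices h : ∀ u v : List L, twist deg x (wordBracket deg c l (word R u) (word R v)) =
      commSign R x c •
        wordBracket deg c l (twist deg x (word R u)) (twist deg x (word R v)) by
    have : (wordBracket (R := R) deg c l).compr₂ (twist deg x)
        = commSign R x c • (wordBracket deg c l).compl₁₂ (twist deg x) (twist deg x) :=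
      word_ext₂ h
    exact LinearMap.congr_fun₂ this t s
  intro u
  induction u with
  | nil => intro v; simp [wordBracket_nil_left, twist_word]
  | cons a u ihu =>
    intro v
    induction v with
    | nil => simp [wordBracket_nil_right, twist_word]
    | cons b v ihv =>
      have h1 := ihu (b :: v)
      simp only [word_cons, twist_cons, twist_word, map_smul, map_add, LinearMap.smul_apply,
        wordBracket_cons_cons, smul_add, smul_smul, twist_shuffle, hl, commSign_add_right]
        at h1 ihv ⊢
      rw [h1, ihv]
      simp only [map_smul, smul_smul]
      simp only [mul_comm, mul_left_comm
        ]

-- The bracket is a graded derivation in its first argument: the letter contracted with one of `w`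
-- comes from `u` or from `v`, and the letters of the other word are merely shuffled in. The
-- induction compares the first letters on the two sides. This is what makes the bracket descend to
-- the quotient by shuffles.
variable {deg c l} in
theorem wordBracket_shuffle_left (hl : ∀ a b, deg (l a b) = deg a + deg b + c) (u v w : List L) :
    wordBracket deg c l (shuffle deg (word R u) (word R v)) (word R w) =
      commSign R c (wordDeg deg u) •
        shuffle deg (word R u) (wordBracket deg c l (word R v) (word R w)) +
      commSign R (wordDeg deg v) (wordDeg deg w) •
        shuffle deg (wordBracket deg c l (word R u) (word R w)) (word R v) := by
  induction u generalizing v w with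
  | nil =>
    simp only [shuffle_nil_left, wordBracket_nil_left, wordDeg_nil, commSign_zero_right, one_smul,
      map_zero, LinearMap.zero_apply, smul_zero, add_zero]
  | cons a u ihu =>
    induction v generalizing w with
    | nil => 
      simp only [shuffle_nil_right, wordBracket_nil_left, wordDeg_nil, commSign_zero_left, one_smul,
        map_zero, smul_zero, zero_add]
    | cons b v ihv =>
      induction w with
      | nil =>
        simp only [wordBracket_nil_right, map_zero, smul_zero, add_zero, LinearMap.zero_apply]
      | cons e w ihw =>
        have h1 := ihu (b :: v) (e :: w)
        have h2 := ihv (e :: w)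
        -- When `a` and `e` are contracted, the tails occur in a different order on the two sides.
        -- Commutativity and associativity of the shuffle product reorder them; `h4` does this for
        -- the contraction of `b` and `e`.
        have h3 : shuffle deg (shuffle deg (word R u) (word R (b :: v))) (word R w) =
          commSign R (wordDeg deg (b :: v)) (wordDeg deg w) •
            shuffle deg (shuffle deg (word R u) (word R w)) (word R (b :: v)) := by
          rw [shuffle_assoc, shuffle_comm_word, map_smul, shuffle_assoc]
        have h4 := shuffle_assoc deg (word R (a :: u)) (word R v) (word R w)
        clear ihu ihv
        simp only [word_cons, twist_cons, twist_word, twist_shuffle, map_smul, map_add,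
          LinearMap.smul_apply, LinearMap.add_apply, hl,
          twist_wordBracket hl, wordDeg_cons,
          wordBracket_cons_cons,
          shuffle_cons_cons, smul_add, smul_smul, commSign_add_left, commSign_add_right]
          at h1 h2 h3 h4 ihw ⊢
        -- The left side of `ihw` has been expanded into two brackets, beginning with `a` and with
        -- `b`, so it is solved for the first one before rewriting.
        rw [h1, h2, h3, h4, eq_sub_of_add_eq ihw]
        simp only [map_smul, map_add, map_sub, smul_add, smul_smul, smul_sub]
        simp only [mul_comm, mul_left_comm, commSign_comm,
          commSign_mul_self_mul]
        abel

-- The same derivation property in the second argument, where the bracket must also pass the word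
-- `v`: this produces both signs of the second term.
variable {deg c l} in
theorem wordBracket_shuffle_right (hl : ∀ a b, deg (l a b) = deg a + deg b + c) (u v w : List L) :
    wordBracket deg c l (word R u) (shuffle deg (word R v) (word R w)) =
      shuffle deg (wordBracket deg c l (word R u) (word R v)) (word R w) +
      (commSign R (wordDeg deg u) (wordDeg deg v) * commSign R c (wordDeg deg v)) •
        shuffle deg (word R v) (wordBracket deg c l (word R u) (word R w)) := by
  induction u generalizing v w with
  | nil =>
    simp only [wordBracket_nil_left, map_zero, LinearMap.zero_apply, smul_zero, add_zero]
  | cons a u ihu =>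
    induction v generalizing w with
    | nil =>
      simp only [shuffle_nil_left, wordBracket_nil_right, wordDeg_nil, commSign_zero_right,
        one_smul, map_zero, LinearMap.zero_apply, zero_add, mul_one]
    | cons b v ihv =>
      induction w with
      | nil =>
        simp only [shuffle_nil_right, wordBracket_nil_right, map_zero, smul_zero, add_zero]
      | cons e w ihw =>
        have h1 := ihu (b :: v) (e :: w)
        have h2 := ihv (e :: w)
        have h3 := (shuffle_assoc deg (word R u) (word R v) (word R (e :: w))).symm
        -- Reordering of the tails left by the contraction of `a` with `e`; `h3` is the one for the
        -- contraction of `a` with `b`.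
        have h4 : shuffle deg (word R u) (shuffle deg (word R (b :: v)) (word R w)) =
          commSign R (wordDeg deg u) (wordDeg deg (b :: v)) •
            shuffle deg (word R (b :: v)) (shuffle deg (word R u) (word R w)) := by
          rw [← shuffle_assoc, shuffle_comm_word, map_smul, LinearMap.smul_apply, shuffle_assoc]
        clear ihu ihv
        simp only [word_cons, twist_cons, twist_word, twist_shuffle, map_smul, map_add,
          LinearMap.smul_apply, LinearMap.add_apply, hl,
          twist_wordBracket hl, wordDeg_cons,
          wordBracket_cons_cons,
          shuffle_cons_cons, smul_add, smul_smul, commSign_add_left, commSign_add_right]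
          at h1 h2 h3 h4 ihw ⊢
        rw [eq_sub_of_add_eq h1, h2, h3, h4, ihw]
        simp only [map_smul, map_add, map_sub, smul_add, smul_smul, smul_sub]
        simp only [mul_comm, mul_left_comm, commSign_comm,
          commSign_mul_self_mul]
        abel

end Words

section Words

variable {R L M : Type*} [CommRing R] (deg : L → ℤ)

/-! ### Deconcatenation -/

/-- The sum of `β x y` over the cuts `w = x ++ y` of a word. -/
def cutSum [AddCommMonoid M] (β : List L → List L → M) : List L → M
  | [] => β [] []
  | a :: w => β [] (a :: w) + cutSum (fun x y => β (a :: x) y) w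

theorem cutSum_congr [AddCommMonoid M] {β γ : List L → List L → M} {w : List L}
    (h : ∀ x y, x ++ y = w → β x y = γ x y) : cutSum β w = cutSum γ w := by
  induction w generalizing β γ with
  | nil => exact h [] [] rfl
  | cons a w ih =>
    rw [cutSum, cutSum, h [] (a :: w) rfl]
    exact congrArg _ (ih fun x y e => h _ _ (by rw [List.cons_append, e]))

theorem cutSum_add [AddCommMonoid M] (β γ : List L → List L → M) (w : List L) :
    cutSum (fun x y => β x y + γ x y) w = cutSum β w + cutSum γ w := by
  induction w generalizing β γ with
  | nil => rfl
  | cons a w ih => simp only [cutSum, ih]; abel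

theorem map_cutSum {N F : Type*} [AddCommMonoid M] [AddCommMonoid N] [FunLike F M N]
    [AddMonoidHomClass F M N] (f : F) (β : List L → List L → M) (w : List L) :
    f (cutSum β w) = cutSum (fun x y => f (β x y)) w := by
  induction w generalizing β with
  | nil => rfl
  | cons a w ih => simp only [cutSum, map_add, ih]

theorem smul_cutSum [AddCommMonoid M] [Module R M] (r : R) (β : List L → List L → M) (w : List L) :
    r • cutSum β w = cutSum (fun x y => r • β x y) w :=
  map_cutSum (DistribSMul.toAddMonoidHom M r) β w

theorem cutSum_eq_of_right [AddCommMonoid M] {β : List L → List L → M}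
    (h : ∀ x b y, β x (b :: y) = 0) (w : List L) : cutSum β w = β w [] := by
  induction w generalizing β with
  | nil => rfl
  | cons a w ih => rw [cutSum, h, zero_add, ih fun x b y => h _ b y]

theorem cutSum_eq_of_left [AddCommMonoid M] {β : List L → List L → M}
    (h : ∀ a x y, β (a :: x) y = 0) (w : List L) : cutSum β w = β [] w := by
  cases w with
  | nil => rfl
  | cons a w =>
    have : (fun x y => β (a :: x) y) = fun _ _ => 0 := by funext x y; exact h a x y
    rw [cutSum, this, cutSum_eq_of_right (fun _ _ _ => rfl), add_zero]

/-- The deconcatenation coproduct. -/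
noncomputable def deconcat : (List L →₀ R) →ₗ[R] (List L →₀ R) ⊗[R] (List L →₀ R) :=
  wordLift (cutSum fun x y => word R x ⊗ₜ word R y)

theorem deconcat_word (w : List L) :
    deconcat (word R w) = cutSum (fun x y => word R x ⊗ₜ[R] word R y) w :=
  wordLift_word _ _

theorem deconcat_cons (a : L) (t : List L →₀ R) :
    deconcat (consLetter a t) =
      word R [] ⊗ₜ[R] consLetter a t + (consLetter a).rTensor _ (deconcat t) := by
  have : deconcat (R := R) ∘ₗ consLetter a = TensorProduct.mk R _ _ (word R []) ∘ₗ consLetter a +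
      (consLetter a).rTensor (List L →₀ R) ∘ₗ deconcat := by
    refine word_ext fun w => ?_
    simp only [LinearMap.comp_apply, LinearMap.add_apply, TensorProduct.mk_apply, ← word_cons,
      deconcat_word, cutSum, map_cutSum, LinearMap.rTensor_tmul]
  exact LinearMap.congr_fun this t

/-- Deconcatenation is multiplicative for the shuffle product: cutting a shuffle cuts each of the
two words, and the sign comes from moving the prefix `y` of the second word past the suffix `x'` of
the first. -/
theorem deconcat_shuffle (u v : List L) :
    deconcat (shuffle deg (word R u) (word R v)) =
      cutSum (fun x x' => cutSum (fun y y' =>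
        commSign R (wordDeg deg x') (wordDeg deg y) •
          (shuffle deg (word R x) (word R y) ⊗ₜ[R] shuffle deg (word R x') (word R y'))) v) u := by
  induction u generalizing v with
  | nil =>
    simp only [cutSum, shuffle_nil_left, wordDeg_nil, commSign_zero_left, one_smul, deconcat_word]
  | cons a u ihu =>
    induction v with
    | nil =>
      simp only [cutSum, shuffle_nil_right, wordDeg_nil, commSign_zero_right, one_smul,
        deconcat_word]
    | cons b v ihv =>
      have h : shuffle deg (word R (a :: u)) (word R (b :: v)) =
          consLetter a (shuffle deg (word R u) (word R (b :: v))) +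
          commSign R (deg b) (wordDeg deg (a :: u)) •
            consLetter b (shuffle deg (word R (a :: u)) (word R v)) := by
        simp only [shuffle_word, shuffleWord_cons_cons]
      -- If both prefixes are non-empty, their shuffle starts with `a` or with `b`, and the two
      -- cases match the two terms of the recursion for the whole shuffle.
      have hs : ∀ x x' y y', x ++ x' = u →
          commSign R (wordDeg deg x') (wordDeg deg (b :: y)) •
            (shuffle deg (word R (a :: x)) (word R (b :: y)) ⊗ₜ[R]
              shuffle deg (word R x') (word R y')) =
          commSign R (wordDeg deg x') (wordDeg deg (b :: y)) •
            (consLetter a (shuffle deg (word R x) (word R (b :: y))) ⊗ₜ[R]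
              shuffle deg (word R x') (word R y')) +
          commSign R (deg b) (wordDeg deg (a :: u)) • commSign R (wordDeg deg x') (wordDeg deg y) •
            (consLetter b (shuffle deg (word R (a :: x)) (word R y)) ⊗ₜ[R]
              shuffle deg (word R x') (word R y')) := by
        rintro x x' y y' rfl
        rw [shuffle_word, shuffleWord_cons_cons, ← shuffle_word, ← shuffle_word,
          TensorProduct.add_tmul, smul_add, ← TensorProduct.smul_tmul', smul_smul, smul_smul]
        simp only [wordDeg_cons, wordDeg_append, commSign_add_right, ]
        simp only [mul_comm, mul_left_comm, commSign_comm]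
      have hs' : cutSum (fun x x' => cutSum (fun y y' =>
          commSign R (wordDeg deg x') (wordDeg deg (b :: y)) •
            (shuffle deg (word R (a :: x)) (word R (b :: y)) ⊗ₜ[R]
              shuffle deg (word R x') (word R y'))) v) u =
          cutSum (fun x x' => cutSum (fun y y' =>
            commSign R (wordDeg deg x') (wordDeg deg (b :: y)) •
              (consLetter a (shuffle deg (word R x) (word R (b :: y))) ⊗ₜ[R]
                shuffle deg (word R x') (word R y'))) v) u +
          cutSum (fun x x' => cutSum (fun y y' => commSign R (deg b) (wordDeg deg (a :: u)) •
            commSign R (wordDeg deg x') (wordDeg deg y) •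
            (consLetter b (shuffle deg (word R (a :: x)) (word R y)) ⊗ₜ[R]
              shuffle deg (word R x') (word R y'))) v) u := by
        simp only [← cutSum_add]
        exact cutSum_congr fun x x' hx => cutSum_congr fun y y' _ => hs x x' y y' hx
      have hb : ∀ y, commSign R (wordDeg deg (a :: u)) (wordDeg deg (b :: y)) =
          commSign R (deg b) (wordDeg deg (a :: u)) *
            commSign R (wordDeg deg (a :: u)) (wordDeg deg y) := fun y => by
        rw [wordDeg_cons deg b, commSign_add_right, commSign_comm (deg b)]
      rw [h, map_add, map_smul, deconcat_cons, deconcat_cons, ihu, ihv]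
      simp only [cutSum, map_cutSum, map_add, map_smul, LinearMap.rTensor_tmul, cutSum_add,
        shuffle_nil_left, shuffle_nil_right, ← word_cons, hs', smul_add, smul_cutSum, wordDeg_nil,
        commSign_zero_right, one_smul]
      simp only [h, TensorProduct.tmul_add, TensorProduct.tmul_smul, hb, smul_smul]
      abel

-- In each term of the bracket the contraction is a single letter, which a cut leaves wholly on the
-- left or wholly on the right. The other side is then an ordinary shuffle, and a bracket on the
-- right must move past the left factor, whence the sign with `c`.
variable {deg} {c : ℤ} {l : L → L → L} in
theorem deconcat_wordBracket (u v : List L) :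
    deconcat (wordBracket deg c l (word R u) (word R v)) =
      cutSum (fun x x' => cutSum (fun y y' => commSign R (wordDeg deg x') (wordDeg deg y) •
        (wordBracket deg c l (word R x) (word R y) ⊗ₜ[R] shuffle deg (word R x') (word R y') +
          commSign R c (wordDeg deg x + wordDeg deg y) • (shuffle deg (word R x) (word R y) ⊗ₜ[R]
            wordBracket deg c l (word R x') (word R y')))) v) u := by
  -- The summand is made opaque so that the expansions of `cutSum` act on the cuts without unfolding
  -- it; it is unfolded only where a prefix or a first letter is known.
  obtain ⟨G, hG⟩ : ∃ G : List L → List L → List L → List L →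
      (List L →₀ R) ⊗[R] (List L →₀ R), G = fun x x' y y' =>
        commSign R (wordDeg deg x') (wordDeg deg y) •
        (wordBracket deg c l (word R x) (word R y) ⊗ₜ[R] shuffle deg (word R x') (word R y') +
          commSign R c (wordDeg deg x + wordDeg deg y) • (shuffle deg (word R x) (word R y) ⊗ₜ[R]
            wordBracket deg c l (word R x') (word R y'))) := ⟨_, rfl⟩
  suffices h : deconcat (wordBracket deg c l (word R u) (word R v)) =
      cutSum (fun x x' => cutSum (fun y y' => G x x' y y') v) u by rw [h, hG]
  have hl : ∀ x' y y', G [] x' y y' = (commSign R (wordDeg deg x') (wordDeg deg y) *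
      commSign R c (wordDeg deg y)) • (word R y ⊗ₜ[R]
        wordBracket deg c l (word R x') (word R y')) := fun x' y y' => by
    rw [hG]
    simp only [wordBracket_nil_left, TensorProduct.zero_tmul, zero_add, shuffle_nil_left, smul_smul,
      wordDeg_nil]
  have hr : ∀ x x' y', G x x' [] y' = commSign R c (wordDeg deg x) • (word R x ⊗ₜ[R]
        wordBracket deg c l (word R x') (word R y')) := fun x x' y' => by
    rw [hG]
    simp only [wordBracket_nil_right, TensorProduct.zero_tmul, zero_add, shuffle_nil_right,
      smul_smul, wordDeg_nil, commSign_zero_right, one_mul, add_zero]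
  induction u generalizing v with
  | nil =>
    simp only [cutSum, wordBracket_nil_left, map_zero, hl, TensorProduct.tmul_zero, smul_zero]
    rw [cutSum_eq_of_right fun _ _ _ => rfl]
  | cons a u ihu =>
    induction v with
    | nil =>
      simp only [cutSum, hr, wordBracket_nil_right, map_zero, TensorProduct.tmul_zero, smul_zero]
      rw [cutSum_eq_of_right fun _ _ _ => rfl, add_zero]
    | cons b v ihv =>
      have h : wordBracket deg c l (word R (a :: u)) (word R (b :: v)) =
          commSign R c (deg a) • consLetter a (wordBracket deg c l (word R u) (word R (b :: v))) +
          (commSign R (deg b) (wordDeg deg (a :: u)) * commSign R c (deg b)) •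
            consLetter b (wordBracket deg c l (word R (a :: u)) (word R v)) +
          commSign R (deg b) (wordDeg deg u) •
            consLetter (l a b) (shuffle deg (word R u) (word R v)) := by
        simp only [wordBracket_word, bracketWord_cons_cons, shuffle_word]
      have hs : ∀ x x' y y', x ++ x' = u → G (a :: x) x' (b :: y) y' =
          commSign R c (deg a) • (consLetter a).rTensor _ (G x x' (b :: y) y') +
          (commSign R (deg b) (wordDeg deg (a :: u)) * commSign R c (deg b)) •
            (consLetter b).rTensor _ (G (a :: x) x' y y') +
          commSign R (deg b) (wordDeg deg u) • (consLetter (l a b)).rTensor _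
            (commSign R (wordDeg deg x') (wordDeg deg y) •
              (shuffle deg (word R x) (word R y) ⊗ₜ[R] shuffle deg (word R x') (word R y'))) := by
        rintro x x' y y' rfl
        rw [hG]
        simp only [map_smul, map_add, LinearMap.rTensor_tmul, shuffle_word, wordBracket_word,
          shuffleWord_cons_cons, bracketWord_cons_cons, TensorProduct.add_tmul, smul_add,
          ← TensorProduct.smul_tmul', smul_smul, wordDeg_cons, wordDeg_append,
          commSign_add_right]
        simp only [mul_comm, mul_left_comm, commSign_comm]
        abel
      have hs' : cutSum (fun x x' => cutSum (fun y y' => G (a :: x) x' (b :: y) y') v) u =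
          commSign R c (deg a) • (consLetter a).rTensor _
            (cutSum (fun x x' => cutSum (fun y y' => G x x' (b :: y) y') v) u) +
          (commSign R (deg b) (wordDeg deg (a :: u)) * commSign R c (deg b)) •
            (consLetter b).rTensor _
              (cutSum (fun x x' => cutSum (fun y y' => G (a :: x) x' y y') v) u) +
          commSign R (deg b) (wordDeg deg u) • (consLetter (l a b)).rTensor _
            (cutSum (fun x x' => cutSum (fun y y' =>
              commSign R (wordDeg deg x') (wordDeg deg y) • (shuffle deg (word R x) (word R y) ⊗ₜ[R]
                shuffle deg (word R x') (word R y'))) v) u) := by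
        simp only [← cutSum_add, map_cutSum, smul_cutSum]
        exact cutSum_congr fun x x' hx => cutSum_congr fun y y' _ => hs x x' y y' hx
      have h1 : ∀ x x', commSign R c (deg a) • (consLetter a).rTensor _ (G x x' [] (b :: v)) =
          G (a :: x) x' [] (b :: v) := fun x x' => by
        simp only [hr, map_smul, LinearMap.rTensor_tmul, ← word_cons, smul_smul, wordDeg_cons,
          commSign_add_right]
      have h2 : ∀ y y', (commSign R (deg b) (wordDeg deg (a :: u)) * commSign R c (deg b)) •
          (consLetter b).rTensor _ (G [] (a :: u) y y') = G [] (a :: u) (b :: y) y' :=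
        fun y y' => by
        simp only [hl, map_smul, LinearMap.rTensor_tmul, ← word_cons, smul_smul,
          wordDeg_cons deg b, commSign_add_right, commSign_comm (deg b), mul_comm, mul_left_comm, mul_assoc]
      have h3 : G [] (a :: u) [] (b :: v) =
          word R [] ⊗ₜ[R] wordBracket deg c l (word R (a :: u)) (word R (b :: v)) := by
        simp only [hr, wordDeg_nil, commSign_zero_right, one_smul]
      conv_lhs => rw [h]
      simp only [map_add, map_smul, deconcat_cons, ihu, ihv, deconcat_shuffle]
      simp only [cutSum, cutSum_add, hs', map_add, smul_add]
      rw [h3, h]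
      simp only [TensorProduct.tmul_add, TensorProduct.tmul_smul, map_cutSum, smul_cutSum, h1, h2]
      abel

end Words

section Words

variable {R L M : Type*} [CommRing R] (deg : L → ℤ)

theorem cutSum_concat [AddCommMonoid M] (β : List L → List L → M) (w : List L) (b : L) :
    cutSum β (w ++ [b]) = cutSum (fun x y => β x (y ++ [b])) w + β (w ++ [b]) [] := by
  induction w generalizing β with
  | nil => rfl
  | cons a w ih => rw [List.cons_append, cutSum, ih, cutSum, add_assoc]; rfl

/-! ### The antipode and the dual Dynkin map -/

/-- The sign of the antipode on a word. -/
def antipodeSign (R : Type*) [CommRing R] : List L → R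
  | [] => 1
  | a :: v => -(commSign R (deg a) (wordDeg deg v) * antipodeSign R v)

/-- The sign is $(-1)^n$ times the product of the commutation signs of all pairs of letters, so the
last letter can be split off just like the first. -/
theorem antipodeSign_concat (v : List L) (b : L) :
    antipodeSign deg R (v ++ [b]) =
      -(commSign R (deg b) (wordDeg deg v) * antipodeSign deg R v) := by
  induction v with
  | nil => rfl
  | cons a v ih =>
    rw [List.cons_append, antipodeSign, ih, antipodeSign, wordDeg_append, wordDeg_cons,
      wordDeg_cons, wordDeg_nil, add_zero, commSign_add_right, commSign_add_right,
      commSign_comm (deg b) (deg a)]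
    ring

/-- The antipode on a word: the signed reversed word. -/
noncomputable def antipode (R : Type*) [CommRing R] (w : List L) : List L →₀ R :=
  antipodeSign deg R w • word R w.reverse

theorem antipode_nil : antipode deg R ([] : List L) = word R [] := by
  simp [antipode, antipodeSign]

theorem antipode_concat (v : List L) (b : L) :
    antipode deg R (v ++ [b]) =
      -(commSign R (deg b) (wordDeg deg v) • consLetter b (antipode deg R v)) := by
  rw [antipode, antipode, antipodeSign_concat, List.reverse_append, List.reverse_singleton,
    List.singleton_append, word_cons, map_smul, smul_smul, neg_smul]

/-- The convolution of the words, weighted by a function of their length, with the antipode. -/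
noncomputable def weightedConv (k : ℕ → R) (w : List L) : List L →₀ R :=
  cutSum (fun x y => k x.length • shuffle deg (word R x) (antipode deg R y)) w

theorem weightedConv_nil (k : ℕ → R) : weightedConv deg k ([] : List L) = k 0 • word R [] := by
  simp [weightedConv, cutSum, antipode_nil, shuffle_nil_left]

theorem weightedConv_singleton (k : ℕ → R) (a : L) :
    weightedConv deg k [a] = (k 1 - k 0) • word R [a] := by
  have := antipode_concat (R := R) deg [] a
  rw [List.nil_append, wordDeg_nil, commSign_zero_right, one_smul, antipode_nil, ← word_cons]
    at this
  simp only [weightedConv, cutSum, antipode_nil, shuffle_nil_left, shuffle_nil_right, this,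
    List.length_nil, List.length_singleton]
  module

/-- The antipode reverses words, so each shuffle in the convolution starts either with `a`, the
first letter of a prefix, or with `b`, the last letter of the whole word. Removing `a` shortens the
prefix by one, which shifts the weight; removing `b` leaves the prefix unchanged. -/
theorem weightedConv_cons_concat (k : ℕ → R) (a b : L) (w : List L) :
    weightedConv deg k (a :: (w ++ [b])) =
      consLetter a (weightedConv deg (fun n => k (n + 1)) (w ++ [b])) -
        commSign R (deg b) (wordDeg deg (a :: w)) • consLetter b (weightedConv deg k (a :: w)) := by
  have h : ∀ x y, x ++ y = w →
      k (x.length + 1) • shuffle deg (word R (a :: x)) (antipode deg R (y ++ [b])) =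
      k (x.length + 1) • consLetter a (shuffle deg (word R x) (antipode deg R (y ++ [b]))) +
        -(commSign R (deg b) (wordDeg deg (a :: w))) • k (x.length + 1) •
          consLetter b (shuffle deg (word R (a :: x)) (antipode deg R y)) := by
    rintro x y rfl
    rw [antipode_concat, word_cons]
    simp only [map_neg, map_smul, shuffle_cons_cons, twist_word, LinearMap.smul_apply, smul_add,
      smul_smul, wordDeg_cons, wordDeg_append, commSign_add_right, smul_neg, neg_add]
    rw [← neg_smul]
    congr 1
    rw [← neg_smul]
    congr 1
    ring
  have h0 := antipode_concat (R := R) deg (a :: w) b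
  rw [List.cons_append] at h0
  simp only [weightedConv, cutSum, cutSum_concat, List.length_cons, List.length_nil,
    shuffle_nil_left, h0, map_add, map_smul, map_cutSum]
  rw [cutSum_congr h, cutSum_add, ← smul_cutSum]
  simp only [antipode_nil, shuffle_nil_right, word_cons]
  simp only [smul_neg, neg_smul, smul_add, smul_smul, mul_comm]
  abel

/-- This is the antipode identity: the unweighted convolution of the identity with the antipode
vanishes on non-empty words. -/
theorem weightedConv_one : ∀ (n : ℕ) (w : List L), w.length = n + 1 →
    weightedConv deg (fun _ => (1 : R)) w = 0 := by
  intro n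
  induction n with
  | zero =>
    intro w hw
    obtain ⟨a, rfl⟩ := List.length_eq_one_iff.1 hw
    rw [weightedConv_singleton, sub_self, zero_smul]
  | succ n ih =>
    intro w hw
    obtain ⟨a, w, rfl⟩ := List.exists_cons_of_length_eq_add_one hw
    obtain ⟨w, b, rfl⟩ := List.eq_nil_or_concat' w |>.resolve_left (by rintro rfl; simp at hw)
    simp at hw
    rw [weightedConv_cons_concat, ih _ (by simp [hw]), ih _ (by simp [hw])]
    simp

/-- The dual Dynkin map on a word. -/
noncomputable def dynkin (R : Type*) [CommRing R] (w : List L) : List L →₀ R :=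
  weightedConv deg (fun n => (n : R)) w

theorem dynkin_nil : dynkin deg R ([] : List L) = 0 := by
  simp [dynkin, weightedConv_nil]

theorem dynkin_singleton (a : L) : dynkin deg R [a] = word R [a] := by
  simp [dynkin, weightedConv_singleton]

theorem dynkin_cons_concat (a b : L) (w : List L) :
    dynkin deg R (a :: (w ++ [b])) = consLetter a (dynkin deg R (w ++ [b])) -
        commSign R (deg b) (wordDeg deg (a :: w)) • consLetter b (dynkin deg R (a :: w)) := by
  -- The shifted weight `n + 1` splits as `n` plus the constant `1`, and the constant part vanishes
  -- by the antipode identity, as `w ++ [b]` is not empty.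
  have h : weightedConv deg (fun n => ((n + 1 : ℕ) : R)) (w ++ [b]) =
      dynkin deg R (w ++ [b]) + weightedConv deg (fun _ => (1 : R)) (w ++ [b]) := by
    simp only [dynkin, weightedConv, ← cutSum_add, ← add_smul, Nat.cast_add, Nat.cast_one]
  rw [dynkin, weightedConv_cons_concat, h, weightedConv_one deg w.length _ (by simp), add_zero]
  rfl

/-- A linear map vanishing on proper shuffles multiplies the dual Dynkin map of a word by its
length. -/
theorem map_dynkin [AddCommMonoid M] [Module R M] (f : (List L →₀ R) →ₗ[R] M)
    (hf : ∀ a u b v, f (shuffle deg (word R (a :: u)) (word R (b :: v))) = 0) (w : List L) :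
    f (dynkin deg R w) = (w.length : R) • f (word R w) := by
  -- Only the cut with empty right part remains: an empty left part has weight `0`, and all other
  -- cuts give proper shuffles, killed by `f`.
  rw [dynkin, weightedConv, map_cutSum, cutSum_eq_of_right, antipode_nil, shuffle_nil_right,
    map_smul]
  intro x b y
  cases x with
  | nil => simp
  | cons a x =>
    obtain ⟨e, z, h⟩ := List.exists_cons_of_ne_nil (l := (b :: y).reverse) (by simp)
    rw [antipode, h, map_smul, map_smul, map_smul, hf, smul_zero, smul_zero]

end Words
/-! ### The first letter of a shuffle -/

/-- The permutation fixing `0` and acting as `ρ` on the other elements. -/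
def fixZero {n : ℕ} (ρ : Equiv.Perm (Fin n)) : Equiv.Perm (Fin (n + 1)) :=
  Equiv.Perm.decomposeFin.symm (0, ρ)

theorem fixZero_zero {n : ℕ} (ρ : Equiv.Perm (Fin n)) : fixZero ρ 0 = 0 := by
  simp [fixZero]

theorem fixZero_succ {n : ℕ} (ρ : Equiv.Perm (Fin n)) (i : Fin n) :
    fixZero ρ i.succ = (ρ i).succ := by
  simp [fixZero]

theorem fixZero_symm_zero {n : ℕ} (ρ : Equiv.Perm (Fin n)) : (fixZero ρ).symm 0 = 0 := by
  rw [Equiv.symm_apply_eq, fixZero_zero]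

theorem fixZero_symm_succ {n : ℕ} (ρ : Equiv.Perm (Fin n)) (i : Fin n) :
    (fixZero ρ).symm i.succ = (ρ.symm i).succ := by
  rw [Equiv.symm_apply_eq, fixZero_succ, Equiv.apply_symm_apply]

theorem fixZero_injective {n : ℕ} : Function.Injective (fixZero (n := n)) := fun ρ ρ' h => by
  have := Equiv.Perm.decomposeFin.symm.injective h
  exact (Prod.ext_iff.1 this).2

theorem exists_fixZero {n : ℕ} {σ : Equiv.Perm (Fin (n + 1))} (h : σ 0 = 0) :
    ∃ ρ, fixZero ρ = σ := by
  obtain ⟨⟨x, ρ⟩, rfl⟩ := Equiv.Perm.decomposeFin.symm.surjective σ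
  rw [Equiv.Perm.decomposeFin_symm_apply_zero] at h
  exact ⟨ρ, by rw [h]; rfl⟩

theorem koszulSign_fixZero {n : ℕ} (d : Fin (n + 1) → ℤ) (ρ : Equiv.Perm (Fin n)) :
    koszulSign d (fixZero ρ) = koszulSign (fun i => d i.succ) ρ := by
  simp [koszulSign, Fin.prod_univ_succ, fixZero_zero, fixZero_succ]

/-- This permutation brings the letter at `x` to the front, so the inversions are exactly the pairs
formed by `x` and an earlier index. -/
theorem koszulSign_cycleRange {n : ℕ} (d : Fin (n + 1) → ℤ) (x : Fin (n + 1)) :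
    koszulSign d x.cycleRange = (d x * ∑ i with i.val < x.val, d i).negOnePow := by
  have h : ∀ i j : Fin (n + 1), (i < j ∧ x.cycleRange j < x.cycleRange i) ↔ (i < x ∧ x = j) := by
    have hc : ∀ i, (x.cycleRange i).val =
        if i.val < x.val then i.val + 1 else if i.val = x.val then 0 else i.val := by
      intro i
      rcases lt_trichotomy i x with hi | rfl | hi
      · rw [Fin.coe_cycleRange_of_lt hi, if_pos (Fin.lt_def.1 hi)]
      · simp
      · have := Fin.lt_def.1 hi
        rw [Fin.cycleRange_of_gt hi, if_neg this.asymm, if_neg this.ne']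
    intro i j
    rw [Fin.lt_def, Fin.lt_def, Fin.lt_def, hc, hc, Fin.ext_iff]
    split_ifs <;> omega
  simp only [koszulSign, h, ite_and]
  rw [Finset.mul_sum, Finset.sum_filter, negOnePow_sum]
  refine Finset.prod_congr rfl fun i _ => ?_
  by_cases hi : i < x
  · simp [hi, Fin.lt_def.1 hi, mul_comm]
  · simp [hi]

theorem fixZero_mem_battements {n p : ℕ} {ρ : Equiv.Perm (Fin n)} :
    fixZero ρ ∈ battements (n + 1) (p + 1) ↔ ρ ∈ battements n p := by
  rw [mem_battements, mem_battements]
  constructor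
  · rintro ⟨h1, h2⟩
    constructor
    · intro i i' h h'
      have := h1 i.succ i'.succ (by simpa using h) (by simpa using h')
      simpa [fixZero_succ] using this
    · intro i i' h h'
      have := h2 i.succ i'.succ (by simpa using h) (by simpa using h')
      simpa [fixZero_succ] using this
  · rintro ⟨h1, h2⟩
    constructor <;> intro i i' h h' <;>
      induction i using Fin.cases <;> induction i' using Fin.cases <;>
      simp_all [fixZero_zero, fixZero_succ]

theorem val_succAbove {n : ℕ} (x : Fin (n + 1)) (j : Fin n) :
    (x.succAbove j).val = if j.val < x.val then j.val else j.val + 1 := by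
  simp only [Fin.succAbove, Fin.lt_def, Fin.val_castSucc]
  split_ifs <;> simp

/-- The index `p` starts the second block. Sending it to `0` and deleting it leaves `p` letters in
the first block and one letter fewer in the second. -/
theorem fixZero_mul_cycleRange_mem_battements {n p : ℕ} (hp : p < n + 1) {ρ : Equiv.Perm (Fin n)} :
    fixZero ρ * (⟨p, hp⟩ : Fin (n + 1)).cycleRange ∈ battements (n + 1) p ↔
      ρ ∈ battements n p := by
  set x : Fin (n + 1) := ⟨p, hp⟩ with hx
  have hv : ∀ j, (x.succAbove j).val = if j.val < p then j.val else j.val + 1 := val_succAbove x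
  have hs : ∀ j, (fixZero ρ * x.cycleRange) (x.succAbove j) = (ρ j).succ := fun j => by
    rw [Equiv.Perm.mul_apply, Fin.cycleRange_succAbove, fixZero_succ]
  have h0 : (fixZero ρ * x.cycleRange) x = 0 := by
    rw [Equiv.Perm.mul_apply, Fin.cycleRange_self, fixZero_zero]
  rw [mem_battements, mem_battements]
  constructor
  · rintro ⟨h1, h2⟩
    constructor
    · intro i i' h h'
      have := h1 (x.succAbove i) (x.succAbove i') (by simpa using h) (by rw [hv, if_pos h']; exact h')
      simpa [hs] using this
    · intro i i' h h'
      have := h2 (x.succAbove i) (x.succAbove i') (by simpa using h) (by rw [hv]; split_ifs <;> omega)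
      simpa [hs] using this
  · rintro ⟨h1, h2⟩
    constructor <;> intro i i' h h'
    · have e : ∀ i : Fin (n + 1), i.val < p → i ≠ x := fun i h e => by
        rw [e, hx] at h; exact lt_irrefl _ h
      obtain ⟨j', rfl⟩ := Fin.exists_succAbove_eq (e _ h')
      obtain ⟨j, rfl⟩ := Fin.exists_succAbove_eq (e i (lt_trans (Fin.lt_def.1 h) h'))
      rw [hs, hs, Fin.succ_lt_succ_iff]
      refine h1 j j' (by simpa using h) ?_
      rw [hv] at h'
      split_ifs at h' <;> omega
    · have e : i' ≠ x := fun e => by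
        rw [e, Fin.lt_def, hx] at h; simp only at h; omega
      obtain ⟨j', rfl⟩ := Fin.exists_succAbove_eq e
      by_cases hi : i = x
      · rw [hi, h0, hs]; exact Fin.succ_pos _
      obtain ⟨j, rfl⟩ := Fin.exists_succAbove_eq hi
      rw [hs, hs, Fin.succ_lt_succ_iff]
      refine h2 j j' (by simpa using h) ?_
      rw [hv] at h'
      split_ifs at h' <;> omega

/-- The first letter of a shuffle is the first letter of one of the two words. The cases correspond
to `σ 0 = 0` and `σ (p + 1) = 0`; the hypothesis says that the second word is not empty, so that
index `p + 1` exists. -/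
theorem sum_battements_succ {W : Type*} [AddCommMonoid W] {n p : ℕ} (hp : p + 1 < n + 1)
    (F : Equiv.Perm (Fin (n + 1)) → W) :
    ∑ σ ∈ battements (n + 1) (p + 1), F σ = ∑ ρ ∈ battements n p, F (fixZero ρ) +
      ∑ ρ ∈ battements n (p + 1),
        F (fixZero ρ * (⟨p + 1, hp⟩ : Fin (n + 1)).cycleRange) := by
  classical
  set x : Fin (n + 1) := ⟨p + 1, hp⟩ with hx
  have hinj : Function.Injective fun ρ : Equiv.Perm (Fin n) => fixZero ρ * x.cycleRange :=
    fun ρ ρ' h => fixZero_injective (mul_right_cancel h)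
  have h : battements (n + 1) (p + 1) = (battements n p).image fixZero ∪
      (battements n (p + 1)).image fun ρ => fixZero ρ * x.cycleRange := by
    ext σ
    simp only [Finset.mem_union, Finset.mem_image]
    constructor
    · intro hσ
      have hσ' := mem_battements.1 hσ
      by_cases h0 : σ 0 = 0
      · obtain ⟨ρ, rfl⟩ := exists_fixZero h0
        exact Or.inl ⟨ρ, fixZero_mem_battements.1 hσ, rfl⟩
      have hx0 : σ x = 0 := by
        obtain ⟨y, hy⟩ := σ.surjective 0
        rcases lt_or_ge y.val (p + 1) with h | h
        · rcases Nat.eq_zero_or_pos y.val with h' | h'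
          · obtain rfl : y = 0 := Fin.ext h'
            exact absurd hy h0
          · have := hσ'.1 0 y h' h
            rw [hy] at this
            exact absurd this (Fin.not_lt_zero _)
        · rcases h.eq_or_lt with h' | h'
          · rw [← hy, show x = y from Fin.ext h']
          · have := hσ'.2 x y h' le_rfl
            rw [hy] at this
            exact absurd this (Fin.not_lt_zero _)
      obtain ⟨ρ, hρ⟩ := exists_fixZero (σ := σ * x.cycleRange⁻¹) (by
        rw [Equiv.Perm.mul_apply, Equiv.Perm.inv_def, Fin.cycleRange_symm_zero, hx0])
      have hρ' : fixZero ρ * x.cycleRange = σ := by rw [hρ, inv_mul_cancel_right]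
      exact Or.inr ⟨ρ, (fixZero_mul_cycleRange_mem_battements hp).1 (by rwa [← hx, hρ']), hρ'⟩
    · rintro (⟨ρ, hρ, rfl⟩ | ⟨ρ, hρ, rfl⟩)
      · exact fixZero_mem_battements.2 hρ
      · exact (fixZero_mul_cycleRange_mem_battements hp).2 hρ
  have hd : Disjoint ((battements n p).image fixZero)
      ((battements n (p + 1)).image fun ρ => fixZero ρ * x.cycleRange) := by
    rw [Finset.disjoint_left]
    intro σ h1 h2
    obtain ⟨ρ, -, rfl⟩ := Finset.mem_image.1 h1
    obtain ⟨ρ', -, h⟩ := Finset.mem_image.1 h2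
    have := congrArg (fun e : Equiv.Perm (Fin (n + 1)) => e x) h
    simp only [Equiv.Perm.mul_apply, Fin.cycleRange_self, fixZero_zero] at this
    rw [show x = Fin.succ ⟨p, by omega⟩ from rfl, fixZero_succ] at this
    exact Fin.succ_ne_zero _ this.symm
  rw [h, Finset.sum_union hd, Finset.sum_image fixZero_injective.injOn,
    Finset.sum_image hinj.injOn]

section Words

variable {R L : Type*} [CommRing R] (deg : L → ℤ)

/-- Both sides satisfy the same recursion on the first letter: the cyclic permutation bringing
forward the first letter of the second word contributes exactly the sign for passing the whole first
word. When one word is empty, only the identity is a shuffle. -/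
theorem sum_battements_word {n : ℕ} (α : Fin n → L) {p : ℕ} (hp : p ≤ n) :
    ∑ σ ∈ battements n p, ((koszulSign (fun i => deg (α i)) σ : ℤ) : R) •
        word R (List.ofFn fun i => α (σ.symm i)) =
      shuffleWord deg R ((List.ofFn α).take p) ((List.ofFn α).drop p) := by
  have htriv : ∀ {n p : ℕ} (α : Fin n → L), (p = 0 ∨ n ≤ p) →
      ∑ σ ∈ battements n p, ((koszulSign (fun i => deg (α i)) σ : ℤ) : R) •
        word R (List.ofFn fun i => α (σ.symm i)) = word R (List.ofFn α) := by
    intro n p α h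
    rw [battements_trivial h, Finset.sum_singleton, koszulSign_one]
    simp only [Units.val_one, Int.cast_one, one_smul]
    rfl
  induction n generalizing p with
  | zero => rw [htriv α (Or.inr (Nat.zero_le _))]; simp [shuffleWord_nil_left]
  | succ n ih =>
    rcases Nat.eq_zero_or_pos p with rfl | hp0
    · rw [htriv α (Or.inl rfl), List.take_zero, List.drop_zero, shuffleWord_nil_left]
    obtain ⟨p, rfl⟩ := Nat.exists_eq_add_of_le' hp0
    rcases hp.eq_or_lt with hp' | hp'
    · rw [htriv α (Or.inr hp'.ge), List.take_of_length_le (by simp [hp']),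
        List.drop_of_length_le (by simp [hp']), shuffleWord_nil_right]
    set x : Fin (n + 1) := ⟨p + 1, hp'⟩ with hx
    have e1 : (List.ofFn α).take (p + 1) = α 0 :: (List.ofFn fun i => α i.succ).take p := by
      rw [List.ofFn_succ, List.take_succ_cons]
    have e2 : (List.ofFn α).drop (p + 1) = (List.ofFn fun i => α i.succ).drop p := by
      rw [List.ofFn_succ, List.drop_succ_cons]
    have e3 : (List.ofFn α).drop (p + 1) = α x :: (List.ofFn α).drop (p + 2) := by
      rw [List.drop_eq_getElem_cons (by simpa using hp')]
      simp [hx]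
    have e4 : (List.ofFn fun i => α (x.succAbove i)).take (p + 1) =
        (List.ofFn α).take (p + 1) := by
      apply List.ext_getElem
      · simp; omega
      · intro i h1 h2
        simp only [List.getElem_take, List.getElem_ofFn]
        congr 1
        apply Fin.ext
        rw [val_succAbove]
        simp at h1
        simp [hx]
        omega
    have e5 : (List.ofFn fun i => α (x.succAbove i)).drop (p + 1) =
        (List.ofFn α).drop (p + 2) := by
      apply List.ext_getElem
      · simp
      · intro i h1 h2
        simp only [List.getElem_drop, List.getElem_ofFn]
        congr 1
        apply Fin.ext
        rw [val_succAbove, if_neg (by simp [hx]; omega)]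
        simp only
        omega
    have hdeg : ∑ i : Fin (n + 1) with i.val < x.val, deg (α i) =
        wordDeg deg ((List.ofFn α).take (p + 1)) := by
      rw [wordDeg, List.map_take, List.map_ofFn, List.sum_take_ofFn]
      rfl
    have i1 := ih (fun i => α i.succ) (p := p) (by omega)
    have i2 := ih (fun i => α (x.succAbove i)) (p := p + 1) (by omega)
    rw [sum_battements_succ hp', ← hx, e3, e1, shuffleWord_cons_cons, ← e3, e2, ← i1, ← e1, ← e4, ← e5,
      ← i2, e4, map_sum, map_sum, Finset.smul_sum]
    congr 1
    · refine Finset.sum_congr rfl fun ρ _ => ?_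
      rw [koszulSign_fixZero, List.ofFn_succ, map_smul, word_cons]
      simp only [fixZero_symm_zero, fixZero_symm_succ]
    · refine Finset.sum_congr rfl fun ρ _ => ?_
      rw [koszulSign_mul, koszulSign_fixZero, koszulSign_cycleRange, hdeg,
        List.ofFn_succ (f := fun i => α ((fixZero ρ * x.cycleRange).symm i)), map_smul, smul_smul, word_cons]
      have hsymm : ∀ i, (fixZero ρ * x.cycleRange).symm i =
        x.cycleRange.symm ((fixZero ρ).symm i) := fun _ => rfl
      simp only [hsymm, fixZero_symm_zero, fixZero_symm_succ, Fin.cycleRange_symm_zero,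
        Fin.cycleRange_symm_succ]
      rw [Units.val_mul, Int.cast_mul]
      rfl

end Words

section Words

variable {R L : Type*} [CommRing R] (deg : L → ℤ) (c : ℤ) (l : L → L → L)

/-! ### The bracket of words as a contraction of their shuffle product -/

/-- Forgetting the colours of the letters. -/
noncomputable def uncolor : (List (L × Bool) →₀ R) →ₗ[R] (List L →₀ R) :=
  wordLift fun w => word R (w.map Prod.fst)

theorem uncolor_cons (a : L × Bool) (t : List (L × Bool) →₀ R) :
    uncolor (consLetter a t) = consLetter a.1 (uncolor t) := by
  have : uncolor ∘ₗ consLetter a = consLetter a.1 ∘ₗ uncolor (R := R) := word_ext fun w => by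
    simp only [LinearMap.comp_apply, ← word_cons, uncolor, wordLift_word, List.map_cons]
  exact LinearMap.congr_fun this t

theorem wordDeg_map_color (u : List L) (e : Bool) :
    wordDeg (fun x : L × Bool => deg x.1) (u.map fun a => (a, e)) = wordDeg deg u := by
  simp [wordDeg, Function.comp_def]

theorem uncolor_shuffleWord (u v : List L) (e e' : Bool) :
    uncolor (shuffleWord (fun x : L × Bool => deg x.1) R (u.map fun a => (a, e))
      (v.map fun a => (a, e'))) = shuffleWord deg R u v := by
  induction u generalizing v with
  | nil => simp [shuffleWord_nil_left, uncolor, wordLift_word, Function.comp_def]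
  | cons a u ihu =>
    induction v with
    | nil => simp [shuffleWord_nil_right, uncolor, wordLift_word, Function.comp_def]
    | cons b v ihv =>
      have h1 := ihu (b :: v)
      have h2 := wordDeg_map_color deg (a :: u) e
      rw [List.map_cons] at h1 ihv h2
      rw [List.map_cons, List.map_cons, shuffleWord_cons_cons, map_add, map_smul, uncolor_cons,
        uncolor_cons, h1, ihv, shuffleWord_cons_cons, h2]

/-- The contraction of `a` with the first letter of a word, if the colours of these two letters are
`true` and `false`. -/
noncomputable def contractHead (R : Type*) [CommRing R] (a : L × Bool) :
    List (L × Bool) → (List L →₀ R)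
  | [] => 0
  | b :: w => if a.2 = true ∧ b.2 = false then word R (l a.1 b.1 :: w.map Prod.fst) else 0

/-- The sum of the contractions of the pairs of consecutive letters of colours `true`, `false`. -/
noncomputable def contractAll (R : Type*) [CommRing R] : List (L × Bool) → (List L →₀ R)
  | [] => 0
  | a :: w => commSign R c (deg a.1) • consLetter a.1 (contractAll R w) + contractHead l R a w

theorem wordLift_contractAll_cons (a : L × Bool) (t : List (L × Bool) →₀ R) :
    wordLift (contractAll deg c l R) (consLetter a t) =
      commSign R c (deg a.1) • consLetter a.1 (wordLift (contractAll deg c l R) t) +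
        wordLift (contractHead l R a) t := by
  have : wordLift (contractAll deg c l R) ∘ₗ consLetter a =
      commSign R c (deg a.1) • (consLetter a.1 ∘ₗ wordLift (contractAll deg c l R)) +
        wordLift (contractHead l R a) := word_ext fun w => by
    simp only [LinearMap.comp_apply, LinearMap.add_apply, LinearMap.smul_apply, ← word_cons,
      wordLift_word, contractAll]
  exact LinearMap.congr_fun this t

theorem wordLift_contractHead_cons (a b : L × Bool) (t : List (L × Bool) →₀ R) :
    wordLift (contractHead l R a) (consLetter b t) =
      if a.2 = true ∧ b.2 = false then consLetter (l a.1 b.1) (uncolor t) else 0 := by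
  have : wordLift (contractHead l R a) ∘ₗ consLetter b =
      if a.2 = true ∧ b.2 = false then consLetter (l a.1 b.1) ∘ₗ uncolor (R := R) else 0 :=
    word_ext fun w => by
      split_ifs with h
      · simp only [LinearMap.comp_apply, ← word_cons, wordLift_word, contractHead, uncolor, h,
          and_self, if_true]
      · simp only [LinearMap.comp_apply, ← word_cons, wordLift_word, contractHead, h, if_false,
          LinearMap.zero_apply]
  have := LinearMap.congr_fun this t
  split_ifs at this ⊢ <;> exact this

/-- A contraction with `a` occurs only if the next letter comes from the second word, that is if `b`
comes first. This costs the sign for moving `b` past `u`, and the remaining letters are freely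
shuffled. -/
theorem wordLift_contractHead_shuffleWord (a b : L) (u v : List L) :
    wordLift (contractHead l R (a, true)) (shuffleWord (fun x : L × Bool => deg x.1) R
      (u.map fun a => (a, true)) ((b :: v).map fun a => (a, false))) =
      commSign R (deg b) (wordDeg deg u) • consLetter (l a b) (shuffleWord deg R u v) := by
  cases u with
  | nil =>
    simp [shuffleWord_nil_left, wordLift_word, contractHead, wordDeg_nil, commSign_zero_right,
      Function.comp_def, ← word_cons]
  | cons e u =>
    have h := wordDeg_map_color deg (e :: u) true
    have h1 := uncolor_shuffleWord (R := R) deg (e :: u) v true false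
    rw [List.map_cons] at h h1
    rw [List.map_cons, List.map_cons, shuffleWord_cons_cons, map_add, map_smul,
      wordLift_contractHead_cons, wordLift_contractHead_cons, if_neg (by simp), if_pos (by simp),
      zero_add, h, h1]

/-- After shuffling, the colour is the only record of the word a letter comes from. With it, the
bracket is obtained by applying to the plain shuffle product a contraction of neighbours coloured
`true`, `false`; both sides obey the same recursion. -/
theorem wordLift_contractAll_shuffleWord (u v : List L) :
    wordLift (contractAll deg c l R) (shuffleWord (fun x : L × Bool => deg x.1) R
      (u.map fun a => (a, true)) (v.map fun a => (a, false))) = bracketWord deg c l R u v := by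
  -- A word of one colour has no contractible pair, in accordance with the bracket being zero when
  -- one word is empty.
  have hmono : ∀ (w : List L) (e : Bool),
      contractAll deg c l R (w.map fun a => (a, e)) = 0 := by
    intro w e
    induction w with
    | nil => rfl
    | cons a w ih =>
      rw [List.map_cons, contractAll, ih, map_zero, smul_zero, zero_add]
      cases w with
      | nil => rfl
      | cons b w => rw [List.map_cons, contractHead, if_neg (by simp)]
  induction u generalizing v with
  | nil =>
    rw [bracketWord_nil_left, List.map_nil, shuffleWord_nil_left, wordLift_word, hmono]
  | cons a u ihu =>
    induction v with
    | nil => rw [bracketWord_nil_right, List.map_nil, shuffleWord_nil_right, wordLift_word, hmono]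
    | cons b v ihv =>
      have h1 := ihu (b :: v)
      have h2 := wordLift_contractHead_shuffleWord (R := R) deg l a b u v
      have h3 := wordDeg_map_color deg (a :: u) true
      have h0 : ∀ t : List (L × Bool) →₀ R, wordLift (contractHead l R (b, false)) t = 0 := by
        intro t
        have : wordLift (R := R) (contractHead l R (b, false)) = 0 := word_ext fun w => by
          rw [wordLift_word, LinearMap.zero_apply]
          cases w with
          | nil => rfl
          | cons e w => rw [contractHead, if_neg (by simp)]
        rw [this, LinearMap.zero_apply]
      rw [List.map_cons] at h1 h2 h3 ihv
      rw [List.map_cons, List.map_cons, shuffleWord_cons_cons, map_add, map_smul,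
        wordLift_contractAll_cons, wordLift_contractAll_cons, h1, h2, ihv, h3, h0,
        bracketWord_cons_cons, add_zero, smul_smul]
      abel

theorem contractNth_zero {α : Type*} {n : ℕ} (op : α → α → α) (g : Fin (n + 2) → α) :
    Fin.contractNth 0 op g = Fin.cons (op (g 0) (g 1)) fun i => g i.succ.succ := by
  funext k
  induction k using Fin.cases with
  | zero => rw [Fin.contractNth_apply_of_eq _ _ _ _ rfl]; rfl
  | succ k => rw [Fin.contractNth_apply_of_gt _ _ _ _ (by simp)]; rfl

theorem contractNth_succ {α : Type*} {n : ℕ} (j : Fin (n + 1)) (op : α → α → α)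
    (g : Fin (n + 2) → α) :
    Fin.contractNth j.succ op g = Fin.cons (g 0) (Fin.contractNth j op fun i => g i.succ) := by
  funext k
  induction k using Fin.cases with
  | zero => rw [Fin.contractNth_apply_of_lt _ _ _ _ (by simp)]; rfl
  | succ k =>
    rw [Fin.cons_succ]
    rcases lt_trichotomy k.val j.val with h | h | h
    · rw [Fin.contractNth_apply_of_lt _ _ _ _ (by simpa using h),
        Fin.contractNth_apply_of_lt _ _ _ _ h]
      rfl
    · rw [Fin.contractNth_apply_of_eq _ _ _ _ (by simpa using h),
        Fin.contractNth_apply_of_eq _ _ _ _ h]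
      rfl
    · rw [Fin.contractNth_apply_of_gt _ _ _ _ (by simpa using h),
        Fin.contractNth_apply_of_gt _ _ _ _ h]

/-- The index `k = 0` is the contraction at the head. For later positions the contraction passes the
first letter, which supplies its missing contribution to the sign. -/
theorem contractAll_ofFn {n : ℕ} (α : Fin (n + 1) → L) (e : Fin (n + 1) → Bool) :
    contractAll deg c l R (List.ofFn fun i => (α i, e i)) =
      ∑ k : Fin n with e k.castSucc = true ∧ e k.succ = false,
        commSign R c (∑ s with s < k.castSucc, deg (α s)) •
          word R (List.ofFn (Fin.contractNth k.castSucc l α)) := by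
  induction n with
  | zero => simp [contractAll, contractHead]
  | succ n ih =>
    rw [List.ofFn_succ, contractAll, ih (fun i => α i.succ) fun i => e i.succ, Finset.sum_filter,
      Finset.sum_filter, Fin.sum_univ_succ, add_comm, map_sum, Finset.smul_sum]
    congr 1
    · rw [List.ofFn_succ, contractHead]
      refine if_congr Iff.rfl ?_ rfl
      rw [Fin.castSucc_zero, contractNth_zero, List.ofFn_succ]
      simp [commSign_zero_right, List.map_ofFn, Function.comp_def]
    · refine Finset.sum_congr rfl fun k _ => ?_
      rw [apply_ite (consLetter _), map_zero, smul_ite, smul_zero]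
      refine if_congr Iff.rfl ?_ rfl
      have : ∑ s with s < k.succ.castSucc, deg (α s) =
          deg (α 0) + ∑ s with s < k.castSucc, deg (α s.succ) := by
        rw [Finset.sum_filter, Finset.sum_filter, Fin.sum_univ_succ]
        simp
      rw [this, commSign_add_right, ← Fin.succ_castSucc, contractNth_succ, List.ofFn_succ, map_smul,
        smul_smul, word_cons]
      rfl

/-- The shuffle expansion is applied to letters coloured by whether their index is below `p`; the
colour condition on neighbours becomes the condition on the preimages of `k` and `k + 1`. -/
theorem bracketWord_eq_sum {n p : ℕ} (α : Fin (n + 1) → L) (hp : p ≤ n + 1) :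
    bracketWord deg c l R ((List.ofFn α).take p) ((List.ofFn α).drop p) =
      ∑ σ ∈ battements (n + 1) p,
        ∑ k : Fin n with (σ.symm k.castSucc).val < p ∧ p ≤ (σ.symm k.succ).val,
          (((koszulSign (fun i => deg (α i)) σ *
            (c * ∑ s with s < k.castSucc, deg (α (σ.symm s))).negOnePow : ℤˣ) : ℤ) : R) •
            word R (List.ofFn (Fin.contractNth k.castSucc l fun i => α (σ.symm i))) := by
  have h := sum_battements_word (R := R) (fun x : L × Bool => deg x.1)
    (fun i => (α i, decide (i.val < p))) hp
  have e1 : (List.ofFn fun i => (α i, decide (i.val < p))).take p =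
      ((List.ofFn α).take p).map fun a => (a, true) := by
    apply List.ext_getElem
    · simp
    · intro i h1 h2
      have h3 : i < p := by simp at h1; exact h1.1
      simp [h3, -List.ofFn_succ]
  have e2 : (List.ofFn fun i => (α i, decide (i.val < p))).drop p =
      ((List.ofFn α).drop p).map fun a => (a, false) := by
    apply List.ext_getElem
    · simp
    · intro i h1 h2
      simp [-List.ofFn_succ]
  rw [e1, e2] at h
  rw [← wordLift_contractAll_shuffleWord, ← h, map_sum]
  refine Finset.sum_congr rfl fun σ _ => ?_
  rw [map_smul, wordLift_word,
    contractAll_ofFn deg c l (fun i => α (σ.symm i)) fun i => decide ((σ.symm i).val < p),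
    Finset.smul_sum]
  refine Finset.sum_congr ?_ fun k _ => ?_
  · ext k
    simp
  · rw [smul_smul, commSign, ← Int.cast_mul, ← Units.val_mul]

end Words

/-! ### From words to the quotient by shuffles, and cogeneration by $V$ -/

section PacketWords

variable {𝕜 V : Type*} [Field 𝕜] [AddCommGroup V] [Module 𝕜 V] (𝒱 : ℤ → Submodule 𝕜 V)

/-! ### Packets of words of homogeneous letters -/

/-- The homogeneous vectors of `V`, with their degrees. -/
abbrev Letter : Type _ := Σ i : ℤ, 𝒱 i

/-- The degree of a homogeneous vector. -/
abbrev letterDeg (a : Letter 𝒱) : ℤ := a.1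

/-- The packet of a word. -/
noncomputable def wordPacket (w : List (Letter 𝒱)) : Packets 𝒱 :=
  packet 𝒱 fun i : Fin w.length => ((w.get i).2 : V)

/-- The linear extension of `wordPacket`. -/
noncomputable def packetOf : (List (Letter 𝒱) →₀ 𝕜) →ₗ[𝕜] Packets 𝒱 := wordLift (wordPacket 𝒱)

theorem packetOf_word (w : List (Letter 𝒱)) : packetOf 𝒱 (word 𝕜 w) = wordPacket 𝒱 w :=
  wordLift_word _ _

theorem packet_cast {m n : ℕ} (h : m = n) (v : Fin n → V) :
    packet 𝒱 (fun i => v (Fin.cast h i)) = packet 𝒱 v := by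
  subst h
  rfl

theorem wordPacket_ofFn {n : ℕ} (α : Fin n → Letter 𝒱) :
    wordPacket 𝒱 (List.ofFn α) = packet 𝒱 fun i => ((α i).2 : V) := by
  rw [wordPacket, ← packet_cast 𝒱 (List.length_ofFn (f := α))]
  congr 1
  funext i
  exact congrArg (fun a : Letter 𝒱 => (a.2 : V)) (by
    rw [List.get_eq_getElem, List.getElem_ofFn]; rfl)

theorem wordPacket_nil : wordPacket 𝒱 [] = 0 := packet_zero 𝒱 _

theorem packetOf_shuffleWord_ofFn {n p : ℕ} (hp : p ≤ n) (α : Fin n → Letter 𝒱) :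
    packetOf 𝒱 (shuffleWord (letterDeg 𝒱) 𝕜 ((List.ofFn α).take p) ((List.ofFn α).drop p)) =
      cls 𝒱 n (bat p (fun i => (α i).1) fun i => ((α i).2 : V)) := by
  rw [← sum_battements_word (letterDeg 𝒱) α hp, bat, map_sum, map_sum]
  refine Finset.sum_congr rfl fun σ _ => ?_
  rw [map_smul, map_smul, packetOf_word, wordPacket_ofFn]
  rfl

/-- A shuffle of two non-empty words is one of the products `bat` by which the quotient is taken. -/
theorem packetOf_shuffle_cons (a : Letter 𝒱) (u : List (Letter 𝒱)) (b : Letter 𝒱)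
    (v : List (Letter 𝒱)) :
    packetOf 𝒱 (shuffle (letterDeg 𝒱) (word 𝕜 (a :: u)) (word 𝕜 (b :: v))) = 0 := by
  have h := packetOf_shuffleWord_ofFn 𝒱 (n := (a :: u ++ b :: v).length) (p := (a :: u).length)
    (by simp) (a :: u ++ b :: v).get
  rw [List.ofFn_get, List.take_left, List.drop_left] at h
  rw [shuffle_word, h]
  exact cls_of_mem 𝒱 (mem_batImage (by simp) (by simp) fun i => ((a :: u ++ b :: v).get i).2.2)

/-! ### Homogeneous vectors and words span -/

/-- Each argument is the finite sum of its homogeneous components, and multilinearity reduces the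
equality to families of homogeneous vectors. -/
theorem multilinear_ext_homogeneous [DirectSum.Decomposition 𝒱] {W : Type*} [AddCommGroup W]
    [Module 𝕜 W] {n : ℕ} {f g : MultilinearMap 𝕜 (fun _ : Fin n => V) W}
    (h : ∀ α : Fin n → Letter 𝒱, f (fun i => ((α i).2 : V)) = g fun i => ((α i).2 : V)) :
    f = g := by
  classical
  ext v
  have hv : v = fun i => ∑ k ∈ (DirectSum.decompose 𝒱 (v i)).support,
      (DirectSum.decompose 𝒱 (v i) k : V) := by
    funext i
    exact (DirectSum.sum_support_decompose 𝒱 (v i)).symm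
  rw [hv, MultilinearMap.map_sum_finset, MultilinearMap.map_sum_finset]
  exact Finset.sum_congr rfl fun r _ => h fun i => ⟨r i, DirectSum.decompose 𝒱 (v i) (r i)⟩

theorem tensorPower_ext_homogeneous [DirectSum.Decomposition 𝒱] {W : Type*} [AddCommGroup W]
    [Module 𝕜 W] {n : ℕ} {f g : (⨂[𝕜]^n V) →ₗ[𝕜] W}
    (h : ∀ α : Fin n → Letter 𝒱, f (PiTensorProduct.tprod 𝕜 fun i => ((α i).2 : V)) =
      g (PiTensorProduct.tprod 𝕜 fun i => ((α i).2 : V))) :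
    f = g :=
  PiTensorProduct.ext (multilinear_ext_homogeneous 𝒱 h)

theorem packetPower_ext [DirectSum.Decomposition 𝒱] {W : Type*} [AddCommGroup W]
    [Module 𝕜 W] {n : ℕ} {f g : PacketPower 𝒱 n →ₗ[𝕜] W}
    (h : ∀ α : Fin n → Letter 𝒱,
      f (PacketPower.mk 𝒱 n (PiTensorProduct.tprod 𝕜 fun i => ((α i).2 : V))) =
      g (PacketPower.mk 𝒱 n (PiTensorProduct.tprod 𝕜 fun i => ((α i).2 : V)))) :
    f = g :=
  Submodule.linearMap_qext _ (tensorPower_ext_homogeneous 𝒱 h)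

theorem packets_ext [DirectSum.Decomposition 𝒱] {W : Type*} [AddCommGroup W]
    [Module 𝕜 W] {f g : Packets 𝒱 →ₗ[𝕜] W}
    (h : ∀ w, f (wordPacket 𝒱 w) = g (wordPacket 𝒱 w)) : f = g := by
  refine DirectSum.linearMap_ext _ fun n => packetPower_ext 𝒱 fun α => ?_
  have := h (List.ofFn α)
  rw [wordPacket_ofFn] at this
  exact this

theorem span_wordPacket [DirectSum.Decomposition 𝒱] :
    Submodule.span 𝕜 (Set.range (wordPacket 𝒱)) = ⊤ := by
  rw [← Submodule.ker_mkQ (Submodule.span 𝕜 (Set.range (wordPacket 𝒱))), LinearMap.ker_eq_top]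
  refine packets_ext 𝒱 fun w => ?_
  rw [LinearMap.zero_apply, Submodule.mkQ_apply, Submodule.Quotient.mk_eq_zero]
  exact Submodule.subset_span ⟨w, rfl⟩

/-! ### The structure maps on words -/

theorem cogenProj_singleton (a : Letter 𝒱) : cogenProj 𝒱 (wordPacket 𝒱 [a]) = (a.2 : V) := by
  change cogenProj 𝒱 (DirectSum.lof 𝕜 ℕ (fun n => PacketPower 𝒱 (n + 1)) 0 _) = _
  rw [cogenProj, LinearMap.comp_apply, DirectSum.component.lof_self]
  erw [PacketPower.lift_mk]
  simp

theorem cogenProj_of_length_ne {w : List (Letter 𝒱)} (h : w.length ≠ 1) :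
    cogenProj 𝒱 (wordPacket 𝒱 w) = 0 := by
  rcases w with _ | ⟨a, _ | ⟨b, w⟩⟩
  · rw [wordPacket_nil, map_zero]
  · simp at h
  · change cogenProj 𝒱 (DirectSum.lof 𝕜 ℕ (fun n => PacketPower 𝒱 (n + 1)) (w.length + 1) _) = 0
    rw [cogenProj, LinearMap.comp_apply, DirectSum.component.of, dif_neg (by simp), map_zero]

/-- The linear map multiplying a packet of length `n` by `n`. -/
noncomputable def lengthMap : Packets 𝒱 →ₗ[𝕜] Packets 𝒱 :=
  DirectSum.lmap fun n : ℕ => ((n + 1 : ℕ) : 𝕜) • LinearMap.id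

theorem lengthMap_wordPacket (w : List (Letter 𝒱)) :
    lengthMap 𝒱 (wordPacket 𝒱 w) = (w.length : 𝕜) • wordPacket 𝒱 w := by
  cases w with
  | nil => rw [wordPacket_nil, map_zero, smul_zero]
  | cons a w =>
    change lengthMap 𝒱 (DirectSum.lof 𝕜 ℕ (fun n => PacketPower 𝒱 (n + 1)) w.length _) = _
    rw [lengthMap, DirectSum.lmap_lof, LinearMap.smul_apply, map_smul]
    rfl

theorem lengthMap_injective [CharZero 𝕜] : Function.Injective (lengthMap 𝒱) := by
  rw [injective_iff_map_eq_zero]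
  intro z hz
  ext n : 1
  have h := congrArg (fun y : Packets 𝒱 => y n) hz
  simp only [lengthMap, DirectSum.lmap_apply, LinearMap.smul_apply, LinearMap.id_apply,
    DirectSum.zero_apply] at h
  exact (smul_eq_zero.1 h).resolve_left (Nat.cast_ne_zero.2 n.succ_ne_zero)

variable [DirectSum.Decomposition 𝒱]

theorem packetTwist_wordPacket (c : ℤ) (w : List (Letter 𝒱)) :
    packetTwist 𝒱 c (wordPacket 𝒱 w) =
      commSign 𝕜 c (wordDeg (letterDeg 𝒱) w) • wordPacket 𝒱 w := by
  rw [wordPacket, packetTwist_packet 𝒱 c (d := fun i => (w.get i).1) fun i => (w.get i).2.2]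
  have : ∑ i, (w.get i).1 = wordDeg (letterDeg 𝒱) w := by
    rw [wordDeg, ← Fin.sum_univ_fun_getElem]; rfl
  rw [this]
  rfl

theorem volte_wordPacket [CharZero 𝕜] (u v : List (Letter 𝒱)) :
    volte 𝒱 (wordPacket 𝒱 u ⊗ₜ wordPacket 𝒱 v) =
      commSign 𝕜 (wordDeg (letterDeg 𝒱) u) (wordDeg (letterDeg 𝒱) v) •
        (wordPacket 𝒱 v ⊗ₜ[𝕜] wordPacket 𝒱 u) := by
  have h : ∀ w : List (Letter 𝒱), ∑ i, (w.get i).1 = wordDeg (letterDeg 𝒱) w := fun w => by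
    rw [wordDeg, ← Fin.sum_univ_fun_getElem]; rfl
  rw [wordPacket, wordPacket, volte_packet 𝒱 (d := fun i => (u.get i).1)
    (e := fun i => (v.get i).1) (fun i => (u.get i).2.2) fun i => (v.get i).2.2, h, h]
  rfl

theorem cutSum_eq_sum_antidiagonal {L M : Type*} [AddCommMonoid M] (β : List L → List L → M)
    (w : List L) : cutSum β w =
      ∑ x ∈ Finset.HasAntidiagonal.antidiagonal w.length, β (w.take x.1) (w.drop x.1) := by
  induction w generalizing β with
  | nil => simp [cutSum]
  | cons a w ih =>
    rw [cutSum, ih, List.length_cons, Finset.Nat.sum_antidiagonal_succ]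
    simp

/-- The cuts with an empty side are included for uniformity; they contribute nothing, since the
packet of the empty word is zero. -/
theorem cobracket_wordPacket [CharZero 𝕜] (w : List (Letter 𝒱)) :
    cobracket 𝒱 (wordPacket 𝒱 w) =
      cutSum (fun u v => wordPacket 𝒱 u ⊗ₜ[𝕜] wordPacket 𝒱 v) w -
        volte 𝒱 (cutSum (fun u v => wordPacket 𝒱 u ⊗ₜ[𝕜] wordPacket 𝒱 v) w) := by
  cases w with
  | nil => rw [cutSum, wordPacket_nil, map_zero, TensorProduct.zero_tmul, map_zero, sub_zero]
  | cons a w =>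
  have h : cobracket 𝒱 (wordPacket 𝒱 (a :: w)) = tensorCobracket 𝒱 (a :: w).length
      (PiTensorProduct.tprod 𝕜 fun i : Fin (a :: w).length => (((a :: w).get i).2 : V)) := by
    change cobracket 𝒱 (DirectSum.lof 𝕜 ℕ (fun n => PacketPower 𝒱 (n + 1)) w.length _) = _
    rw [cobracket, DirectSum.toModule_lof]
    rfl
  generalize hw : a :: w = w' at h ⊢
  rw [h, tensorCobracket, LinearMap.comp_apply, LinearMap.sum_apply, cutSum_eq_sum_antidiagonal,
    LinearMap.sub_apply, LinearMap.id_apply]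
  suffices hs : ∑ x : Finset.HasAntidiagonal.antidiagonal w'.length, cut 𝒱 x.1.1 x.1.2
      (Finset.HasAntidiagonal.mem_antidiagonal.1 x.2)
        (PiTensorProduct.tprod 𝕜 fun i : Fin w'.length => ((w'.get i).2 : V)) =
      ∑ x : Finset.HasAntidiagonal.antidiagonal w'.length,
        wordPacket 𝒱 (w'.take x.1.1) ⊗ₜ[𝕜] wordPacket 𝒱 (w'.drop x.1.1) by
    exact congrArg (fun t => t - volte 𝒱 t) (hs.trans (Finset.sum_coe_sort
      (Finset.HasAntidiagonal.antidiagonal w'.length)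
      fun x : ℕ × ℕ => wordPacket 𝒱 (w'.take x.1) ⊗ₜ[𝕜] wordPacket 𝒱 (w'.drop x.1)))
  refine Finset.sum_congr rfl fun x _ => ?_
  have hx := Finset.HasAntidiagonal.mem_antidiagonal.1 x.2
  rw [cut_tprod]
  congr 1
  · rw [← wordPacket_ofFn 𝒱 (α := fun i : Fin x.1.1 => w'.get (Fin.cast hx (Fin.castAdd x.1.2 i)))]
    congr 1
    apply List.ext_getElem
    · simp; omega
    · intro i h1 h2
      simp [-List.ofFn_succ]
  · rw [← wordPacket_ofFn 𝒱 (α := fun i : Fin x.1.2 => w'.get (Fin.cast hx (Fin.natAdd x.1.1 i)))]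
    congr 1
    apply List.ext_getElem
    · simp; omega
    · intro i h1 h2
      simp [-List.ofFn_succ]

end PacketWords

section PacketWords

variable {𝕜 V : Type*} [Field 𝕜] [AddCommGroup V] [Module 𝕜 V] (𝒱 : ℤ → Submodule 𝕜 V)

/-! ### The kernel of the cobracket -/

/-- The tensor defined by a linear combination of words. -/
noncomputable def tensorOf : (List (Letter 𝒱) →₀ 𝕜) →ₗ[𝕜] TensorAlgebra 𝕜 V :=
  wordLift fun w => (w.map fun a => TensorAlgebra.ι 𝕜 (a.2 : V)).prod

theorem tensorOf_word (w : List (Letter 𝒱)) :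
    tensorOf 𝒱 (word 𝕜 w) = (w.map fun a => TensorAlgebra.ι 𝕜 (a.2 : V)).prod :=
  wordLift_word _ _

theorem tensorOf_cons (a : Letter 𝒱) (t : List (Letter 𝒱) →₀ 𝕜) :
    tensorOf 𝒱 (consLetter a t) = TensorAlgebra.ι 𝕜 (a.2 : V) * tensorOf 𝒱 t := by
  have : tensorOf 𝒱 ∘ₗ consLetter a =
      LinearMap.mulLeft 𝕜 (TensorAlgebra.ι 𝕜 (a.2 : V)) ∘ₗ tensorOf 𝒱 := word_ext fun w => by
    simp only [LinearMap.comp_apply, ← word_cons, tensorOf_word, List.map_cons, List.prod_cons,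
      LinearMap.mulLeft_apply]
  exact LinearMap.congr_fun this t

/-- The class of a tensor. -/
noncomputable def tensorCls : TensorAlgebra 𝕜 V →ₗ[𝕜] Packets 𝒱 :=
  DirectSum.toModule 𝕜 ℕ _ (cls 𝒱) ∘ₗ TensorAlgebra.toDirectSum.toLinearMap

theorem tensorCls_tensorOf (t : List (Letter 𝒱) →₀ 𝕜) :
    tensorCls 𝒱 (tensorOf 𝒱 t) = packetOf 𝒱 t := by
  have : tensorCls 𝒱 ∘ₗ tensorOf 𝒱 = packetOf 𝒱 := word_ext fun w => by
    have h : (w.map fun a => TensorAlgebra.ι 𝕜 (a.2 : V)).prod =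
        TensorAlgebra.tprod 𝕜 V w.length fun i => ((w.get i).2 : V) := by
      rw [TensorAlgebra.tprod_apply]
      congr 1
      apply List.ext_getElem
      · simp
      · intro i h1 h2
        simp [-List.ofFn_succ]
    rw [LinearMap.comp_apply, tensorOf_word, h, tensorCls, LinearMap.comp_apply,
      AlgHom.toLinearMap_apply, TensorAlgebra.toDirectSum_tensorPower_tprod, packetOf_word,
      ← DirectSum.lof_eq_of 𝕜, DirectSum.toModule_lof]
    rfl
  exact LinearMap.congr_fun this t

variable [DirectSum.Decomposition 𝒱]

theorem cobracket_wordPacket_eq_cutSum [CharZero 𝕜] (w : List (Letter 𝒱)) :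
    cobracket 𝒱 (wordPacket 𝒱 w) =
      cutSum (fun u v => wordPacket 𝒱 u ⊗ₜ[𝕜] wordPacket 𝒱 v) w +
      cutSum (fun u v => -(commSign 𝕜 (wordDeg (letterDeg 𝒱) u) (wordDeg (letterDeg 𝒱) v) •
        (wordPacket 𝒱 v ⊗ₜ[𝕜] wordPacket 𝒱 u))) w := by
  have h : ∀ β : List (Letter 𝒱) → List (Letter 𝒱) → Packets 𝒱 ⊗[𝕜] Packets 𝒱,
      -cutSum β w = cutSum (fun u v => -β u v) w := fun β => map_cutSum negAddMonoidHom β w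
  rw [cobracket_wordPacket, sub_eq_add_neg, map_cutSum, h]
  simp only [volte_wordPacket]

/-- The iteration of the cobracket which is dual to the Dynkin map. -/
noncomputable def iteratedCobracket [CharZero 𝕜] : ℕ → Packets 𝒱 →ₗ[𝕜] TensorAlgebra 𝕜 V
  | 0 => 0
  | N + 1 => TensorAlgebra.ι 𝕜 ∘ₗ cogenProj 𝒱 + LinearMap.mul' 𝕜 (TensorAlgebra 𝕜 V) ∘ₗ
      TensorProduct.map (TensorAlgebra.ι 𝕜 ∘ₗ cogenProj 𝒱) (iteratedCobracket N) ∘ₗ cobracket 𝒱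

/-- Projecting the left factor of the cobracket to $V$ keeps two terms: the first letter split off
with a plus sign, and the last letter brought forward with a minus sign. This is the recursion of
the dual Dynkin map. The bound on the length ensures that the recursion is not truncated. -/
theorem iteratedCobracket_wordPacket [CharZero 𝕜] {N : ℕ} {w : List (Letter 𝒱)}
    (hw : w.length ≤ N) :
    iteratedCobracket 𝒱 N (wordPacket 𝒱 w) = tensorOf 𝒱 (dynkin (letterDeg 𝒱) 𝕜 w) := by
  induction N generalizing w with
  | zero =>
    rw [List.length_eq_zero_iff.1 (Nat.le_zero.1 hw), dynkin_nil, wordPacket_nil, map_zero, map_zero]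
  | succ N ih =>
    rcases List.eq_nil_or_concat' w with rfl | ⟨w, b, rfl⟩
    · rw [dynkin_nil, wordPacket_nil, map_zero, map_zero]
    rw [iteratedCobracket]
    cases w with
    | nil =>
      rw [LinearMap.add_apply, LinearMap.comp_apply, LinearMap.comp_apply, LinearMap.comp_apply,
        List.nil_append, cogenProj_singleton, cobracket_wordPacket_eq_cutSum, dynkin_singleton,
        tensorOf_word]
      simp [cutSum, wordPacket_nil]
    | cons a w =>
      have hN : w.length + 1 ≤ N := by simp at hw; omega
      have h1 : ∀ u v : List (Letter 𝒱), LinearMap.mul' 𝕜 (TensorAlgebra 𝕜 V)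
          (TensorProduct.map (TensorAlgebra.ι 𝕜 ∘ₗ cogenProj 𝒱) (iteratedCobracket 𝒱 N)
            (wordPacket 𝒱 u ⊗ₜ[𝕜] wordPacket 𝒱 v)) =
          TensorAlgebra.ι 𝕜 (cogenProj 𝒱 (wordPacket 𝒱 u)) *
            iteratedCobracket 𝒱 N (wordPacket 𝒱 v) := fun u v => by
        rw [TensorProduct.map_tmul, LinearMap.mul'_apply, LinearMap.comp_apply]
      -- Among the unflipped cuts only the one after the first letter has a left part of length one;
      -- in `hB` it is, after the flip, the one before the last letter.
      have hA : cutSum (fun u v => TensorAlgebra.ι 𝕜 (cogenProj 𝒱 (wordPacket 𝒱 u)) *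
            iteratedCobracket 𝒱 N (wordPacket 𝒱 v)) (a :: (w ++ [b])) =
          TensorAlgebra.ι 𝕜 (a.2 : V) * iteratedCobracket 𝒱 N (wordPacket 𝒱 (w ++ [b])) := by
        rw [cutSum, cutSum_eq_of_left, wordPacket_nil, map_zero, map_zero, zero_mul, zero_add,
          cogenProj_singleton]
        intro e x y
        rw [cogenProj_of_length_ne 𝒱 (by simp), map_zero, zero_mul]
      have hB : cutSum (fun u v => -(commSign 𝕜 (wordDeg (letterDeg 𝒱) u)
            (wordDeg (letterDeg 𝒱) v) • (TensorAlgebra.ι 𝕜 (cogenProj 𝒱 (wordPacket 𝒱 v)) *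
              iteratedCobracket 𝒱 N (wordPacket 𝒱 u)))) (a :: w ++ [b]) =
          -(commSign 𝕜 (letterDeg 𝒱 b) (wordDeg (letterDeg 𝒱) (a :: w)) •
            (TensorAlgebra.ι 𝕜 (b.2 : V) * iteratedCobracket 𝒱 N (wordPacket 𝒱 (a :: w)))) := by
        rw [cutSum_concat, cutSum_eq_of_right, wordPacket_nil, map_zero, map_zero, zero_mul,
          smul_zero, neg_zero, add_zero, List.nil_append, cogenProj_singleton, commSign_comm,
          wordDeg_cons _ b, wordDeg_nil, add_zero]
        intro x e y
        rw [cogenProj_of_length_ne 𝒱 (by simp), map_zero, zero_mul, smul_zero, neg_zero]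
      rw [LinearMap.add_apply, LinearMap.comp_apply, LinearMap.comp_apply, LinearMap.comp_apply,
        cogenProj_of_length_ne 𝒱 (by simp), map_zero, zero_add, cobracket_wordPacket_eq_cutSum,
        map_add, map_add, map_cutSum, map_cutSum, map_cutSum, map_cutSum]
      simp only [map_neg, map_smul, h1]
      rw [hB, List.cons_append, hA, ih (by simpa), ih (by simpa), dynkin_cons_concat, map_sub,
        map_smul, tensorOf_cons, tensorOf_cons, sub_eq_add_neg]

/-- The iterated cobracket is intrinsic on packets, while the Dynkin map is only used on words;
taking classes, it becomes multiplication by the length. A common depth exists because an element is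
a finite combination of words. -/
theorem exists_tensorCls_iteratedCobracket [CharZero 𝕜] (z : Packets 𝒱) :
    ∃ N₀, ∀ N ≥ N₀, tensorCls 𝒱 (iteratedCobracket 𝒱 N z) = lengthMap 𝒱 z := by
  have hz : z ∈ Submodule.span 𝕜 (Set.range (wordPacket 𝒱)) := by
    rw [span_wordPacket]; trivial
  induction hz using Submodule.span_induction with
  | mem z hz =>
    obtain ⟨w, rfl⟩ := hz
    refine ⟨w.length, fun N hN => ?_⟩
    rw [iteratedCobracket_wordPacket 𝒱 hN, tensorCls_tensorOf,
      map_dynkin _ _ (packetOf_shuffle_cons 𝒱), packetOf_word, lengthMap_wordPacket]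
  | zero => exact ⟨0, fun N _ => by simp only [map_zero]⟩
  | add x y _ _ hx hy =>
    obtain ⟨N₁, h₁⟩ := hx
    obtain ⟨N₂, h₂⟩ := hy
    refine ⟨max N₁ N₂, fun N hN => ?_⟩
    rw [map_add, map_add, map_add, h₁ N (le_trans (le_max_left _ _) hN),
      h₂ N (le_trans (le_max_right _ _) hN)]
  | smul r x _ hx =>
    obtain ⟨N₁, h₁⟩ := hx
    exact ⟨N₁, fun N hN => by rw [map_smul, map_smul, map_smul, h₁ N hN]⟩

/-- An element of the kernel of the cobracket without component in `V` vanishes. -/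
theorem eq_zero_of_cobracket_eq_zero [CharZero 𝕜] {z : Packets 𝒱} (hδ : cobracket 𝒱 z = 0)
    (hp : cogenProj 𝒱 z = 0) : z = 0 := by
  obtain ⟨N, hN⟩ := exists_tensorCls_iteratedCobracket 𝒱 z
  apply lengthMap_injective 𝒱
  -- Depth `N + 1` exposes one step of the recursion, which involves the element only through its
  -- projection and its cobracket.
  rw [← hN (N + 1) (Nat.le_succ N), iteratedCobracket]
  simp only [LinearMap.add_apply, LinearMap.comp_apply, hδ, hp, map_zero, add_zero]

end PacketWords
/-! ### Signs depend on parities -/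

theorem negOnePow_mul_congr {x x' y y' : ℤ} (hx : Even (x - x')) (hy : Even (y - y')) :
    (x * y).negOnePow = (x' * y').negOnePow := by
  rw [Int.negOnePow_eq_iff]
  have : x * y - x' * y' = x * (y - y') + (x - x') * y' := by ring
  rw [this]
  exact (hy.mul_left x).add (hx.mul_right y')

theorem koszulSign_congr {n : ℕ} {d d' : Fin n → ℤ} (h : ∀ i, Even (d i - d' i))
    (σ : Equiv.Perm (Fin n)) : koszulSign d σ = koszulSign d' σ := by
  unfold koszulSign
  refine Finset.prod_congr rfl fun i _ => Finset.prod_congr rfl fun j _ => ?_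
  rw [negOnePow_mul_congr (h i) (h j)]

/-! ### Multilinear maps given by formulas with degree-dependent signs -/

section Multilinear

variable {𝕜 V W : Type*} [Field 𝕜] [AddCommGroup V] [Module 𝕜 V] [AddCommGroup W] [Module 𝕜 W]

/-- Each argument enters exactly one entry of the contracted family, and it does so linearly. It is
unchanged, in the same place before position `k` and one place lower after `k + 1`; at `k` and `k +
1` it is one of the two arguments of `l`. -/
theorem contractNth_update {n : ℕ} [DecidableEq (Fin (n + 1))] (l : V →ₗ[𝕜] V →ₗ[𝕜] V)
    (k : Fin n) (v : Fin (n + 1) → V) (i : Fin (n + 1)) :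
    ∃ (j : Fin n) (f : V →ₗ[𝕜] V), ∀ x,
      Fin.contractNth k.castSucc (fun u v => l u v) (Function.update v i x) =
        Function.update (Fin.contractNth k.castSucc (fun u v => l u v) v) j (f x) := by
  have hval : ∀ (m : Fin n) (g : Fin (n + 1) → V),
      Fin.contractNth k.castSucc (fun u v => l u v) g m =
        if m.val < k.val then g m.castSucc else
          if m.val = k.val then l (g m.castSucc) (g m.succ) else g m.succ := fun _ _ => rfl
  rcases lt_trichotomy i.val k.val with hi | hi | hi
  · refine ⟨⟨i.val, by omega⟩, LinearMap.id, fun x => ?_⟩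
    funext m
    simp only [hval, Function.update_apply, Fin.ext_iff, Fin.val_castSucc, Fin.val_succ,
      LinearMap.id_apply]
    split_ifs <;> first | rfl | omega
  · refine ⟨k, l.flip (v k.succ), fun x => ?_⟩
    funext m
    simp only [hval, Function.update_apply, Fin.ext_iff, Fin.val_castSucc, Fin.val_succ,
      LinearMap.flip_apply]
    split_ifs <;> first | rfl | omega | rw [show m = k from Fin.ext ‹m.val = k.val›]
  rcases (Nat.succ_le_of_lt hi).eq_or_lt with hi' | hi'
  · refine ⟨k, l (v k.castSucc), fun x => ?_⟩
    funext m
    simp only [hval, Function.update_apply, Fin.ext_iff, Fin.val_castSucc, Fin.val_succ]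
    split_ifs <;> first | rfl | omega | rw [show m = k from Fin.ext ‹m.val = k.val›]
  · refine ⟨⟨i.val - 1, by omega⟩, LinearMap.id, fun x => ?_⟩
    funext m
    simp only [hval, Function.update_apply, Fin.ext_iff, Fin.val_castSucc, Fin.val_succ,
      LinearMap.id_apply]
    split_ifs <;> first | rfl | omega

/-- The composition of a multilinear map with the contraction of two consecutive arguments. -/
def contractMultilinear {n : ℕ} (l : V →ₗ[𝕜] V →ₗ[𝕜] V) (k : Fin n)
    (f : MultilinearMap 𝕜 (fun _ : Fin n => V) W) :
    MultilinearMap 𝕜 (fun _ : Fin (n + 1) => V) W where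
  toFun v := f (Fin.contractNth k.castSucc (fun u v => l u v) v)
  map_update_add' v i x y := by
    obtain ⟨j, g, h⟩ := contractNth_update l k v i
    rw [h, h, h, map_add, MultilinearMap.map_update_add]
  map_update_smul' v i r x := by
    obtain ⟨j, g, h⟩ := contractNth_update l k v i
    rw [h, h, map_smul, MultilinearMap.map_update_smul]

variable (𝒱 : ℤ → Submodule 𝕜 V) [DirectSum.Decomposition 𝒱]

/-- The projection of `V` onto its odd part (for `e = true`) or its even part. -/
noncomputable def parityProj (e : Bool) : V →ₗ[𝕜] V :=
  (2 : 𝕜)⁻¹ • (LinearMap.id + (if e then (-1 : 𝕜) else 1) • signTwist 𝒱 1)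

theorem parityProj_apply [CharZero 𝕜] (e : Bool) (a : Letter 𝒱) :
    parityProj 𝒱 e (a.2 : V) = if e = decide (Odd a.1) then (a.2 : V) else 0 := by
  rw [parityProj, LinearMap.smul_apply, LinearMap.add_apply, LinearMap.smul_apply,
    LinearMap.id_apply, signTwist_of_mem 𝒱 1 a.2.2, one_mul]
  have half : (2 : 𝕜)⁻¹ • ((a.2 : V) + (a.2 : V)) = a.2 := by
    rw [← two_smul 𝕜, smul_smul, inv_mul_cancel₀ two_ne_zero, one_smul]
  by_cases h : Odd a.1
  · rw [Int.negOnePow_odd _ h]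
    cases e <;> simp [h, half]
  · rw [Int.negOnePow_even _ (Int.not_odd_iff_even.1 h)]
    cases e <;> simp [h, half]

/-- A family of multilinear maps indexed by the parities of the arguments glues to a multilinear
map. -/
theorem exists_multilinear_of_parity [CharZero 𝕜] {n : ℕ}
    (G : (Fin n → Bool) → MultilinearMap 𝕜 (fun _ : Fin n => V) W) :
    ∃ F : MultilinearMap 𝕜 (fun _ : Fin n => V) W, ∀ α : Fin n → Letter 𝒱,
      F (fun i => ((α i).2 : V)) = G (fun i => decide (Odd (α i).1)) fun i => ((α i).2 : V) := by
  refine ⟨∑ e, (G e).compLinearMap fun i => parityProj 𝒱 (e i), fun α => ?_⟩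
  rw [sum_apply, Finset.sum_eq_single fun i => decide (Odd (α i).1)]
  · rw [MultilinearMap.compLinearMap_apply]
    congr 1
    funext i
    rw [parityProj_apply, if_pos rfl]
  · intro e _ he
    obtain ⟨i, hi⟩ := Function.ne_iff.1 he
    rw [MultilinearMap.compLinearMap_apply]
    exact MultilinearMap.map_coord_zero _ i (by rw [parityProj_apply, if_neg hi])
  · intro h
    exact absurd (Finset.mem_univ _) h

end Multilinear

section PacketBracket

variable {𝕜 V : Type*} [Field 𝕜] [AddCommGroup V] [Module 𝕜 V] {𝒱 : ℤ → Submodule 𝕜 V}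
  {c : ℤ} {l : V →ₗ[𝕜] V →ₗ[𝕜] V}

/-! ### The bracket of packets -/

/-- The bracket of two homogeneous vectors, as a homogeneous vector. -/
def letterBracket (hl : ∀ {i j : ℤ} {u v : V}, u ∈ 𝒱 i → v ∈ 𝒱 j → l u v ∈ 𝒱 (i + j + c))
    (a b : Letter 𝒱) : Letter 𝒱 :=
  ⟨a.1 + b.1 + c, l a.2 b.2, hl a.2.2 b.2.2⟩

variable (hl : ∀ {i j : ℤ} {u v : V}, u ∈ 𝒱 i → v ∈ 𝒱 j → l u v ∈ 𝒱 (i + j + c))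

theorem packetOf_bracketWord_ofFn {n p : ℕ} (hp : p ≤ n + 1) (α : Fin (n + 1) → Letter 𝒱) :
    packetOf 𝒱 (bracketWord (letterDeg 𝒱) c (letterBracket hl) 𝕜 ((List.ofFn α).take p)
      ((List.ofFn α).drop p)) =
      ∑ σ ∈ battements (n + 1) p,
        ∑ k : Fin n with (σ.symm k.castSucc).val < p ∧ p ≤ (σ.symm k.succ).val,
          (((koszulSign (fun i => (α i).1) σ *
            (c * ∑ s with s < k.castSucc, (α (σ.symm s)).1).negOnePow : ℤˣ) : ℤ) : 𝕜) •
            packet 𝒱 (Fin.contractNth k.castSucc (fun u v => l u v)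
              fun i => ((α (σ.symm i)).2 : V)) := by
  rw [bracketWord_eq_sum _ _ _ _ hp, map_sum]
  refine Finset.sum_congr rfl fun σ _ => ?_
  rw [map_sum]
  refine Finset.sum_congr rfl fun k _ => ?_
  rw [map_smul, packetOf_word, wordPacket_ofFn]
  congr 2
  exact Fin.comp_contractNth (f := fun a : Letter 𝒱 => (a.2 : V)) _ _ (fun a b => rfl) _ _

/-- The signs depend only on the parities of the degrees. For each choice of parities, represented
by degrees `0` and `1`, the formula is multilinear in arbitrary vectors, and these pieces are glued.
-/
theorem exists_multilinear_bracket [DirectSum.Decomposition 𝒱] [CharZero 𝕜] {n p : ℕ}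
    (hp : p ≤ n + 1) :
    ∃ F : MultilinearMap 𝕜 (fun _ : Fin (n + 1) => V) (Packets 𝒱), ∀ α : Fin (n + 1) → Letter 𝒱,
      F (fun i => ((α i).2 : V)) = packetOf 𝒱 (bracketWord (letterDeg 𝒱) c (letterBracket hl) 𝕜
        ((List.ofFn α).take p) ((List.ofFn α).drop p)) := by
  obtain ⟨F, hF⟩ := exists_multilinear_of_parity 𝒱 fun e : Fin (n + 1) → Bool =>
    ∑ σ ∈ battements (n + 1) p,
      ∑ k : Fin n with (σ.symm k.castSucc).val < p ∧ p ≤ (σ.symm k.succ).val,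
        (((koszulSign (fun i => if e i then 1 else 0) σ *
          (c * ∑ s with s < k.castSucc, if e (σ.symm s) then 1 else 0).negOnePow : ℤˣ) : ℤ) : 𝕜) •
          (contractMultilinear l k
            ((cls 𝒱 n).compMultilinearMap (PiTensorProduct.tprod 𝕜))).domDomCongr σ.symm
  refine ⟨F, fun α => ?_⟩
  have hpar : ∀ i, Even ((if decide (Odd (α i).1) = true then 1 else 0) - (α i).1) := by
    intro i
    by_cases h : Odd (α i).1
    · simpa [h] using odd_one.sub_odd h
    · have h' := Int.not_odd_iff_even.1 h
      simp only [decide_eq_false h]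
      simpa using h'
  rw [hF, packetOf_bracketWord_ofFn hl hp, sum_apply]
  refine Finset.sum_congr rfl fun σ _ => ?_
  rw [sum_apply]
  refine Finset.sum_congr rfl fun k _ => ?_
  rw [smul_apply, koszulSign_congr hpar,
    negOnePow_mul_congr (x := c) (x' := c) (by simp) (?_ : Even ((∑ s with s < k.castSucc,
      if decide (Odd (α (σ.symm s)).1) = true then 1 else 0) -
        ∑ s with s < k.castSucc, (α (σ.symm s)).1))]
  · rfl
  · rw [← Finset.sum_sub_distrib]
    exact Finset.even_sum _ fun s _ => hpar _

end PacketBracket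

section PacketBracket

variable {𝕜 V : Type*} [Field 𝕜] [AddCommGroup V] [Module 𝕜 V] {𝒱 : ℤ → Submodule 𝕜 V}
  {c : ℤ} {l : V →ₗ[𝕜] V →ₗ[𝕜] V}
  (hl : ∀ {i j : ℤ} {u v : V}, u ∈ 𝒱 i → v ∈ 𝒱 j → l u v ∈ 𝒱 (i + j + c))

/-! ### Descent of the bracket to the quotient by shuffles -/

/-- Every term of a bracket starts with some letter, so shuffling a bracket with a non-empty word
gives proper shuffles only. -/
theorem map_bracketWord_eq_zero {R L M : Type*} [CommRing R] [AddCommMonoid M] [Module R M]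
    (deg : L → ℤ) (c : ℤ) (l : L → L → L) (f : (List L →₀ R) →ₗ[R] M)
    (hf : ∀ a t, f (consLetter a t) = 0) (u v : List L) : f (bracketWord deg c l R u v) = 0 := by
  cases u with
  | nil => rw [bracketWord_nil_left, map_zero]
  | cons a u =>
    cases v with
    | nil => rw [bracketWord_nil_right, map_zero]
    | cons b v =>
      rw [bracketWord_cons_cons, map_add, map_add, map_smul, map_smul, map_smul, hf, hf, hf]
      simp only [smul_zero, add_zero]

theorem packetOf_shuffle_bracketWord (a : Letter 𝒱) (u v w : List (Letter 𝒱)) :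
    packetOf 𝒱 (shuffle (letterDeg 𝒱) (word 𝕜 (a :: u))
      (bracketWord (letterDeg 𝒱) c (letterBracket hl) 𝕜 v w)) = 0 := by
  refine map_bracketWord_eq_zero _ _ _
    (packetOf 𝒱 ∘ₗ shuffle (letterDeg 𝒱) (word 𝕜 (a :: u))) (fun b t => ?_) v w
  have : packetOf 𝒱 ∘ₗ shuffle (letterDeg 𝒱) (word 𝕜 (a :: u)) ∘ₗ consLetter b = 0 :=
    word_ext fun x => by
      rw [LinearMap.comp_apply, LinearMap.comp_apply, ← word_cons, packetOf_shuffle_cons,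
        LinearMap.zero_apply]
  exact LinearMap.congr_fun this t

theorem packetOf_bracketWord_shuffle (a : Letter 𝒱) (u v w : List (Letter 𝒱)) :
    packetOf 𝒱 (shuffle (letterDeg 𝒱) (bracketWord (letterDeg 𝒱) c (letterBracket hl) 𝕜 v w)
      (word 𝕜 (a :: u))) = 0 := by
  refine map_bracketWord_eq_zero _ _ _
    (packetOf 𝒱 ∘ₗ (shuffle (letterDeg 𝒱)).flip (word 𝕜 (a :: u))) (fun b t => ?_) v w
  have : packetOf 𝒱 ∘ₗ (shuffle (letterDeg 𝒱)).flip (word 𝕜 (a :: u)) ∘ₗ consLetter b = 0 :=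
    word_ext fun x => by
      rw [LinearMap.comp_apply, LinearMap.comp_apply, ← word_cons, LinearMap.flip_apply,
        packetOf_shuffle_cons, LinearMap.zero_apply]
  exact LinearMap.congr_fun this t

/-- The derivation property writes the bracket of a proper shuffle as shuffles of a non-empty word
with a bracket, and those vanish in the quotient. -/
theorem packetOf_wordBracket_shuffle_left {u v : List (Letter 𝒱)} (hu : u ≠ []) (hv : v ≠ [])
    (w : List (Letter 𝒱)) :
    packetOf 𝒱 (wordBracket (letterDeg 𝒱) c (letterBracket hl)
      (shuffle (letterDeg 𝒱) (word 𝕜 u) (word 𝕜 v)) (word 𝕜 w)) = 0 := by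
  obtain ⟨a, u, rfl⟩ := List.exists_cons_of_ne_nil hu
  obtain ⟨b, v, rfl⟩ := List.exists_cons_of_ne_nil hv
  rw [wordBracket_shuffle_left fun _ _ => rfl, map_add, map_smul, map_smul, wordBracket_word,
    wordBracket_word, packetOf_shuffle_bracketWord hl, packetOf_bracketWord_shuffle hl, smul_zero,
    smul_zero, add_zero]

theorem packetOf_wordBracket_shuffle_right {u v : List (Letter 𝒱)} (hu : u ≠ []) (hv : v ≠ [])
    (w : List (Letter 𝒱)) :
    packetOf 𝒱 (wordBracket (letterDeg 𝒱) c (letterBracket hl) (word 𝕜 w)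
      (shuffle (letterDeg 𝒱) (word 𝕜 u) (word 𝕜 v))) = 0 := by
  obtain ⟨a, u, rfl⟩ := List.exists_cons_of_ne_nil hu
  obtain ⟨b, v, rfl⟩ := List.exists_cons_of_ne_nil hv
  rw [wordBracket_shuffle_right fun _ _ => rfl, map_add, map_smul, wordBracket_word,
    wordBracket_word, packetOf_shuffle_bracketWord hl, packetOf_bracketWord_shuffle hl, smul_zero,
    add_zero]

/-- A linear map given on words by `f` vanishes on the proper shuffle products if `f` does. -/
theorem map_bat_eq_zero {W : Type*} [AddCommGroup W] [Module 𝕜 W] {n p : ℕ} (hp : 0 < p)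
    (hn : p < n) (g : (⨂[𝕜]^n V) →ₗ[𝕜] W) (f : (List (Letter 𝒱) →₀ 𝕜) →ₗ[𝕜] W)
    (hgf : ∀ α : Fin n → Letter 𝒱,
      g (PiTensorProduct.tprod 𝕜 fun i => ((α i).2 : V)) = f (word 𝕜 (List.ofFn α)))
    (hf : ∀ u v, u ≠ [] → v ≠ [] → f (shuffle (letterDeg 𝒱) (word 𝕜 u) (word 𝕜 v)) = 0)
    {d : Fin n → ℤ} {v : Fin n → V} (hv : ∀ i, v i ∈ 𝒱 (d i)) : g (bat p d v) = 0 := by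
  have h := hf ((List.ofFn fun i => (⟨d i, v i, hv i⟩ : Letter 𝒱)).take p)
    ((List.ofFn fun i => (⟨d i, v i, hv i⟩ : Letter 𝒱)).drop p)
    (by rw [← List.length_pos_iff]; simp [-List.ofFn_succ]; omega)
    (by rw [← List.length_pos_iff]; simp [-List.ofFn_succ]; omega)
  rw [shuffle_word, ← sum_battements_word (letterDeg 𝒱) _ hn.le, map_sum] at h
  rw [← h, bat, map_sum]
  refine Finset.sum_congr rfl fun σ _ => ?_
  rw [map_smul, map_smul, ← hgf]

variable [DirectSum.Decomposition 𝒱]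

/-- A bilinear map on tensor powers given on words by `Φ` descends to the quotients by shuffles
if `Φ` vanishes on the proper shuffle products in each argument. -/
theorem exists_packetPower_lift {W : Type*} [AddCommGroup W] [Module 𝕜 W] {m n : ℕ}
    (Φ : (List (Letter 𝒱) →₀ 𝕜) →ₗ[𝕜] (List (Letter 𝒱) →₀ 𝕜) →ₗ[𝕜] W)
    (hleft : ∀ u v w, u ≠ [] → v ≠ [] →
      Φ (shuffle (letterDeg 𝒱) (word 𝕜 u) (word 𝕜 v)) (word 𝕜 w) = 0)
    (hright : ∀ u v w, u ≠ [] → v ≠ [] →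
      Φ (word 𝕜 w) (shuffle (letterDeg 𝒱) (word 𝕜 u) (word 𝕜 v)) = 0)
    (T : (⨂[𝕜]^m V) →ₗ[𝕜] (⨂[𝕜]^n V) →ₗ[𝕜] W)
    (hT : ∀ (α : Fin m → Letter 𝒱) (β : Fin n → Letter 𝒱),
      T (PiTensorProduct.tprod 𝕜 fun i => ((α i).2 : V))
        (PiTensorProduct.tprod 𝕜 fun i => ((β i).2 : V)) =
        Φ (word 𝕜 (List.ofFn α)) (word 𝕜 (List.ofFn β))) :
    ∃ B : PacketPower 𝒱 m →ₗ[𝕜] PacketPower 𝒱 n →ₗ[𝕜] W,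
      ∀ (α : Fin m → Letter 𝒱) (β : Fin n → Letter 𝒱),
        B (PacketPower.mk 𝒱 m (PiTensorProduct.tprod 𝕜 fun i => ((α i).2 : V)))
          (PacketPower.mk 𝒱 n (PiTensorProduct.tprod 𝕜 fun i => ((β i).2 : V))) =
          Φ (word 𝕜 (List.ofFn α)) (word 𝕜 (List.ofFn β)) := by
  -- The second argument is passed to the quotient first; the resulting map is then flipped and the
  -- first argument is treated in the same way.
  have h1 : batImage 𝒱 n ≤ LinearMap.ker T.flip := batImage_le fun r hr hr' d v hv => by
    rw [LinearMap.mem_ker]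
    refine tensorPower_ext_homogeneous 𝒱 fun α => ?_
    exact map_bat_eq_zero hr hr' (T (PiTensorProduct.tprod 𝕜 fun i => ((α i).2 : V)))
      (Φ (word 𝕜 (List.ofFn α))) (hT α) (fun u v hu hv => hright u v _ hu hv) hv
  have h2 : batImage 𝒱 m ≤ LinearMap.ker (PacketPower.lift 𝒱 n T.flip h1).flip :=
    batImage_le fun r hr hr' d v hv => by
    rw [LinearMap.mem_ker]
    refine packetPower_ext 𝒱 fun β => ?_
    rw [LinearMap.flip_apply, PacketPower.lift_mk, LinearMap.zero_apply]
    exact map_bat_eq_zero hr hr' (T.flip (PiTensorProduct.tprod 𝕜 fun i => ((β i).2 : V)))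
      (Φ.flip (word 𝕜 (List.ofFn β))) (fun α => hT α β)
      (fun u v hu hv => hleft u v _ hu hv) hv
  exact ⟨PacketPower.lift 𝒱 m _ h2, fun α β => by
    rw [PacketPower.lift_mk, LinearMap.flip_apply, PacketPower.lift_mk, LinearMap.flip_apply, hT]⟩

variable [CharZero 𝕜]

/-- The bracket is multilinear in all the letters of both words together, so the multilinear map is
read through the identification of a product of two tensor powers with a single one. -/
theorem exists_tensor_bracket (p q : ℕ) :
    ∃ T : (⨂[𝕜]^(p + 1) V) →ₗ[𝕜] (⨂[𝕜]^(q + 1) V) →ₗ[𝕜] Packets 𝒱,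
      ∀ (α : Fin (p + 1) → Letter 𝒱) (β : Fin (q + 1) → Letter 𝒱),
        T (PiTensorProduct.tprod 𝕜 fun i => ((α i).2 : V))
          (PiTensorProduct.tprod 𝕜 fun i => ((β i).2 : V)) =
          packetOf 𝒱 (wordBracket (letterDeg 𝒱) c (letterBracket hl) (word 𝕜 (List.ofFn α))
            (word 𝕜 (List.ofFn β))) := by
  obtain ⟨F, hF⟩ := exists_multilinear_bracket (𝒱 := 𝒱) (c := c) (l := l) (n := p + 1 + q) (p := p + 1) hl (by omega)
  refine ⟨TensorProduct.curry (PiTensorProduct.lift F ∘ₗ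
    (TensorPower.mulEquiv (R := 𝕜) (M := V) (n := p + 1) (m := q + 1)).toLinearMap),
    fun α β => ?_⟩
  rw [TensorProduct.curry_apply, LinearMap.comp_apply, LinearEquiv.coe_coe, ← TensorPower.gMul_def,
    TensorPower.tprod_mul_tprod, PiTensorProduct.lift.tprod]
  have h := hF (Fin.append α β :)
  have e : List.ofFn (Fin.append α β) = List.ofFn α ++ List.ofFn β := List.ofFn_fin_append α β
  have e1 : (List.ofFn α ++ List.ofFn β).take (p + 1) = List.ofFn α := by
    rw [List.take_left' (by simp)]
  have e2 : (List.ofFn α ++ List.ofFn β).drop (p + 1) = List.ofFn β := by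
    rw [List.drop_left' (by simp)]
  have h' : packetOf 𝒱 (bracketWord (letterDeg 𝒱) c (letterBracket hl) 𝕜
      ((List.ofFn (Fin.append α β)).take (p + 1)) ((List.ofFn (Fin.append α β)).drop (p + 1))) =
      packetOf 𝒱 (bracketWord (letterDeg 𝒱) c (letterBracket hl) 𝕜 (List.ofFn α)
        (List.ofFn β)) := by rw [e, e1, e2]
  rw [wordBracket_word]
  refine Eq.trans ?_ (h.trans h')
  congr 1
  funext i
  refine Fin.addCases (fun x => ?_) (fun y => ?_) i
  · rw [Fin.append_left]
    exact congrArg (fun a : Letter 𝒱 => (a.2 : V)) (Fin.append_left α β x).symm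
  · rw [Fin.append_right]
    exact congrArg (fun a : Letter 𝒱 => (a.2 : V)) (Fin.append_right α β y).symm

theorem exists_packetPower_bracket (p q : ℕ) :
    ∃ B : PacketPower 𝒱 (p + 1) →ₗ[𝕜] PacketPower 𝒱 (q + 1) →ₗ[𝕜] Packets 𝒱,
      ∀ (α : Fin (p + 1) → Letter 𝒱) (β : Fin (q + 1) → Letter 𝒱),
        B (PacketPower.mk 𝒱 (p + 1) (PiTensorProduct.tprod 𝕜 fun i => ((α i).2 : V)))
          (PacketPower.mk 𝒱 (q + 1) (PiTensorProduct.tprod 𝕜 fun i => ((β i).2 : V))) =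
          packetOf 𝒱 (wordBracket (letterDeg 𝒱) c (letterBracket hl) (word 𝕜 (List.ofFn α))
            (word 𝕜 (List.ofFn β))) := by
  obtain ⟨T, hT⟩ := exists_tensor_bracket (𝒱 := 𝒱) (c := c) (l := l) hl p q
  exact exists_packetPower_lift
    ((wordBracket (letterDeg 𝒱) c (letterBracket hl)).compr₂ (packetOf 𝒱))
    (fun u v w hu hv => packetOf_wordBracket_shuffle_left hl hu hv w)
    (fun u v w hu hv => packetOf_wordBracket_shuffle_right hl hu hv w) T hT

theorem exists_packet_bracket :
    ∃ m : Packets 𝒱 ⊗[𝕜] Packets 𝒱 →ₗ[𝕜] Packets 𝒱, ∀ u v : List (Letter 𝒱),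
      m (wordPacket 𝒱 u ⊗ₜ wordPacket 𝒱 v) =
        packetOf 𝒱 (bracketWord (letterDeg 𝒱) c (letterBracket hl) 𝕜 u v) := by
  choose B hB using fun p q => exists_packetPower_bracket (𝒱 := 𝒱) (c := c) (l := l) hl p q
  refine ⟨TensorProduct.lift (DirectSum.toModule 𝕜 ℕ _ fun p =>
    (DirectSum.toModule 𝕜 ℕ _ fun q => (B p q).flip).flip), fun u v => ?_⟩
  rw [TensorProduct.lift.tmul]
  cases u with
  | nil => rw [wordPacket_nil, map_zero, LinearMap.zero_apply, bracketWord_nil_left, map_zero]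
  | cons a u =>
    cases v with
    | nil => rw [wordPacket_nil, map_zero, bracketWord_nil_right, map_zero]
    | cons b v =>
      have h := hB u.length v.length (a :: u).get (b :: v).get
      rw [wordBracket_word] at h
      have e1 : List.ofFn (a :: u).get = a :: u := List.ofFn_get _
      have e2 : List.ofFn (b :: v).get = b :: v := List.ofFn_get _
      erw [e1, e2] at h
      rw [← h]
      change DirectSum.toModule 𝕜 ℕ (Packets 𝒱 →ₗ[𝕜] Packets 𝒱) _
        (DirectSum.lof 𝕜 ℕ (fun n => PacketPower 𝒱 (n + 1)) u.length _)
        (DirectSum.lof 𝕜 ℕ (fun n => PacketPower 𝒱 (n + 1)) v.length _) = _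
      rw [DirectSum.toModule_lof, LinearMap.flip_apply, DirectSum.toModule_lof]
      rfl

end PacketBracket

section HomogeneousWords

variable {R L M : Type*} [CommRing R] (deg : L → ℤ)

/-! ### Homogeneous combinations of words -/

/-- The span of the words of degree `k` and length `n`. -/
noncomputable def homogeneousWords (R : Type*) [CommRing R] (k : ℤ) (n : ℕ) :
    Submodule R (List L →₀ R) :=
  Submodule.span R {t | ∃ w, wordDeg deg w = k ∧ w.length = n ∧ t = word R w}

theorem word_mem_homogeneousWords (w : List L) :
    word R w ∈ homogeneousWords deg R (wordDeg deg w) w.length :=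
  Submodule.subset_span ⟨w, rfl, rfl, rfl⟩

theorem consLetter_mem_homogeneousWords (a : L) {k : ℤ} {n : ℕ} {t : List L →₀ R}
    (ht : t ∈ homogeneousWords deg R k n) :
    consLetter a t ∈ homogeneousWords deg R (deg a + k) (n + 1) := by
  refine (Submodule.span_le (p := (homogeneousWords deg R (deg a + k) (n + 1)).comap
    (consLetter a))).2 ?_ ht
  rintro _ ⟨w, rfl, rfl, rfl⟩
  rw [SetLike.mem_coe, Submodule.mem_comap, ← word_cons]
  exact Submodule.subset_span ⟨a :: w, wordDeg_cons _ _ _, rfl, rfl⟩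

theorem shuffleWord_mem_homogeneousWords (u v : List L) :
    shuffleWord deg R u v ∈
      homogeneousWords deg R (wordDeg deg u + wordDeg deg v) (u.length + v.length) := by
  induction u generalizing v with
  | nil =>
    rw [shuffleWord_nil_left, wordDeg_nil, zero_add, List.length_nil, zero_add]
    exact word_mem_homogeneousWords deg v
  | cons a u ihu =>
    induction v with
    | nil =>
      rw [shuffleWord_nil_right, wordDeg_nil, add_zero]
      exact word_mem_homogeneousWords deg _
    | cons b v ihv =>
      rw [shuffleWord_cons_cons]
      refine Submodule.add_mem _ ?_ (Submodule.smul_mem _ _ ?_)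
      · convert consLetter_mem_homogeneousWords deg a (ihu (b :: v)) using 2 <;>
          simp only [wordDeg_cons, List.length_cons] <;> omega
      · convert consLetter_mem_homogeneousWords deg b ihv using 2 <;>
          simp only [wordDeg_cons, List.length_cons] <;> omega

-- A contraction replaces two letters by one and adds `c` to the degree. The truncated subtraction
-- is harmless: when a word is empty the bracket is zero.
variable {deg} in
theorem bracketWord_mem_homogeneousWords {c : ℤ} {l : L → L → L}
    (hl : ∀ a b, deg (l a b) = deg a + deg b + c) (u v : List L) :
    bracketWord deg c l R u v ∈
      homogeneousWords deg R (wordDeg deg u + wordDeg deg v + c) (u.length + v.length - 1) := by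
  induction u generalizing v with
  | nil => rw [bracketWord_nil_left]; exact Submodule.zero_mem _
  | cons a u ihu =>
    induction v with
    | nil => rw [bracketWord_nil_right]; exact Submodule.zero_mem _
    | cons b v ihv =>
      rw [bracketWord_cons_cons]
      refine Submodule.add_mem _ (Submodule.add_mem _ (Submodule.smul_mem _ _ ?_)
        (Submodule.smul_mem _ _ ?_)) (Submodule.smul_mem _ _ ?_)
      · convert consLetter_mem_homogeneousWords deg a (ihu (b :: v)) using 2 <;>
          simp only [wordDeg_cons, List.length_cons] <;> omega
      · convert consLetter_mem_homogeneousWords deg b ihv using 2 <;>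
          simp only [wordDeg_cons, List.length_cons] <;> omega
      · convert consLetter_mem_homogeneousWords deg (l a b)
          (shuffleWord_mem_homogeneousWords deg u v) using 2 <;>
          simp only [wordDeg_cons, List.length_cons, hl] <;> omega

/-! ### Cuts of two words -/

/-- Only pairs of cuts with at least one empty right part contribute. The pair with both right parts
empty would be counted twice, hence the requirement that its term vanish. -/
theorem cutSum_cutSum_of_right [AddCommMonoid M] {β : List L → List L → List L → List L → M}
    (h : ∀ x a x' y b y', β x (a :: x') y (b :: y') = 0) {u v : List L} (h' : β u [] v [] = 0) :
    cutSum (fun x x' => cutSum (fun y y' => β x x' y y') v) u =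
      cutSum (fun x x' => β x x' v []) u + cutSum (fun y y' => β u [] y y') v := by
  induction u generalizing β with
  | nil => rw [cutSum, cutSum, h', zero_add]
  | cons a u ih =>
    rw [cutSum, cutSum, ih (β := fun x => β (a :: x)) (fun x => h _) h', add_assoc,
      cutSum_eq_of_right fun y b y' => h _ _ _ _ _ _]

theorem cutSum_cutSum_of_left [AddCommMonoid M] {β : List L → List L → List L → List L → M}
    (h : ∀ a x x' b y y', β (a :: x) x' (b :: y) y' = 0) {u v : List L} (h' : β [] u [] v = 0) :
    cutSum (fun x x' => cutSum (fun y y' => β x x' y y') v) u =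
      cutSum (fun x x' => β x x' [] v) u + cutSum (fun y y' => β [] u y y') v := by
  cases u with
  | nil => rw [cutSum, cutSum, h', zero_add]
  | cons a u =>
    rw [cutSum, cutSum, h', zero_add, add_comm]
    congr 1
    exact cutSum_congr fun x x' _ => cutSum_eq_of_left (fun b y y' => h _ _ _ _ _ _) v

end HomogeneousWords

section PacketBracket

variable {𝕜 V : Type*} [Field 𝕜] [AddCommGroup V] [Module 𝕜 V] (𝒱 : ℤ → Submodule 𝕜 V)

/-! ### Degrees -/

theorem wordPacket_mem_packetDegree (w : List (Letter 𝒱)) :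
    wordPacket 𝒱 w ∈ packetDegree 𝒱 (wordDeg (letterDeg 𝒱) w) := by
  cases w with
  | nil => rw [wordPacket_nil]; exact Submodule.zero_mem _
  | cons a w =>
    refine Submodule.subset_span ⟨_, fun i => ((a :: w).get i).1, _, by simp,
      fun i => ((a :: w).get i).2.2, ?_, rfl⟩
    rw [wordDeg, ← Fin.sum_univ_fun_getElem]
    rfl

/-- The empty word may be included in the spanning set because its packet is zero. -/
theorem packetDegree_eq_span (k : ℤ) : packetDegree 𝒱 k =
    Submodule.span 𝕜 {X | ∃ w, wordDeg (letterDeg 𝒱) w = k ∧ X = wordPacket 𝒱 w} := by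
  apply le_antisymm
  · refine Submodule.span_le.2 ?_
    rintro _ ⟨n, d, v, -, hv, rfl, rfl⟩
    refine Submodule.subset_span ⟨List.ofFn fun i => ⟨d i, v i, hv i⟩, ?_, ?_⟩
    · rw [wordDeg, List.map_ofFn, List.sum_ofFn]
      rfl
    · rw [wordPacket_ofFn]
  · refine Submodule.span_le.2 ?_
    rintro _ ⟨w, rfl, rfl⟩
    exact wordPacket_mem_packetDegree 𝒱 w

theorem packetOf_mem_packetDegree {k : ℤ} {n : ℕ} {t : List (Letter 𝒱) →₀ 𝕜}
    (ht : t ∈ homogeneousWords (letterDeg 𝒱) 𝕜 k n) : packetOf 𝒱 t ∈ packetDegree 𝒱 k := by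
  refine (Submodule.span_le (p := (packetDegree 𝒱 k).comap (packetOf 𝒱))).2 ?_ ht
  rintro _ ⟨w, rfl, rfl, rfl⟩
  rw [SetLike.mem_coe, Submodule.mem_comap, packetOf_word]
  exact wordPacket_mem_packetDegree 𝒱 w

theorem cogenProj_packetOf {k : ℤ} {n : ℕ} (hn : n ≠ 1) {t : List (Letter 𝒱) →₀ 𝕜}
    (ht : t ∈ homogeneousWords (letterDeg 𝒱) 𝕜 k n) : cogenProj 𝒱 (packetOf 𝒱 t) = 0 := by
  refine (Submodule.span_le (p := LinearMap.ker (cogenProj 𝒱 ∘ₗ packetOf 𝒱))).2 ?_ ht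
  rintro _ ⟨w, rfl, rfl, rfl⟩
  rw [SetLike.mem_coe, LinearMap.mem_ker, LinearMap.comp_apply, packetOf_word,
    cogenProj_of_length_ne 𝒱 hn]

variable {c : ℤ} {l : V →ₗ[𝕜] V →ₗ[𝕜] V}
  (hl : ∀ {i j : ℤ} {u v : V}, u ∈ 𝒱 i → v ∈ 𝒱 j → l u v ∈ 𝒱 (i + j + c))
 {m : Packets 𝒱 ⊗[𝕜] Packets 𝒱 →ₗ[𝕜] Packets 𝒱}

theorem apply_wordPacket_mem
    (hm : ∀ u v : List (Letter 𝒱), m (wordPacket 𝒱 u ⊗ₜ wordPacket 𝒱 v) =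
      packetOf 𝒱 (bracketWord (letterDeg 𝒱) c (letterBracket hl) 𝕜 u v))
    (u v : List (Letter 𝒱)) : m (wordPacket 𝒱 u ⊗ₜ wordPacket 𝒱 v) ∈
    packetDegree 𝒱 (wordDeg (letterDeg 𝒱) u + wordDeg (letterDeg 𝒱) v + c) := by
  rw [hm]
  exact packetOf_mem_packetDegree 𝒱 (bracketWord_mem_homogeneousWords (fun _ _ => rfl) u v)

theorem isOfDegree_of_apply_wordPacket
    (hm : ∀ u v : List (Letter 𝒱), m (wordPacket 𝒱 u ⊗ₜ wordPacket 𝒱 v) =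
      packetOf 𝒱 (bracketWord (letterDeg 𝒱) c (letterBracket hl) 𝕜 u v)) : IsOfDegree 𝒱 c m := by
  intro x y X Y hX hY
  rw [packetDegree_eq_span] at hX hY
  induction hX using Submodule.span_induction with
  | mem X hX =>
    obtain ⟨u, rfl, rfl⟩ := hX
    induction hY using Submodule.span_induction with
    | mem Y hY =>
      obtain ⟨v, rfl, rfl⟩ := hY
      exact apply_wordPacket_mem 𝒱 hl hm u v
    | zero => rw [TensorProduct.tmul_zero, map_zero]; exact Submodule.zero_mem _
    | add Y Y' _ _ h h' =>
      rw [TensorProduct.tmul_add, map_add]; exact Submodule.add_mem _ h h'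
    | smul r Y _ h => rw [TensorProduct.tmul_smul, map_smul]; exact Submodule.smul_mem _ _ h
  | zero => rw [TensorProduct.zero_tmul, map_zero]; exact Submodule.zero_mem _
  | add X X' _ _ h h' => rw [TensorProduct.add_tmul, map_add]; exact Submodule.add_mem _ h h'
  | smul r X _ h =>
    rw [← TensorProduct.smul_tmul', map_smul]; exact Submodule.smul_mem _ _ h

variable [DirectSum.Decomposition 𝒱]

theorem volte_of_mem [CharZero 𝕜] {x y : ℤ} {X Y : Packets 𝒱} (hX : X ∈ packetDegree 𝒱 x)
    (hY : Y ∈ packetDegree 𝒱 y) : volte 𝒱 (X ⊗ₜ Y) = commSign 𝕜 x y • (Y ⊗ₜ[𝕜] X) := by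
  rw [packetDegree_eq_span] at hX hY
  induction hX using Submodule.span_induction with
  | mem X hX =>
    obtain ⟨u, rfl, rfl⟩ := hX
    induction hY using Submodule.span_induction with
    | mem Y hY =>
      obtain ⟨v, rfl, rfl⟩ := hY
      exact volte_wordPacket 𝒱 u v
    | zero => rw [TensorProduct.tmul_zero, TensorProduct.zero_tmul, map_zero, smul_zero]
    | add Y Y' _ _ h h' =>
      rw [TensorProduct.tmul_add, TensorProduct.add_tmul, map_add, smul_add, h, h']
    | smul r Y _ h =>
      rw [TensorProduct.tmul_smul, ← TensorProduct.smul_tmul', map_smul, h, smul_comm]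
  | zero => rw [TensorProduct.tmul_zero, TensorProduct.zero_tmul, map_zero, smul_zero]
  | add X X' _ _ h h' =>
    rw [TensorProduct.tmul_add, TensorProduct.add_tmul, map_add, smul_add, h, h']
  | smul r X _ h =>
    rw [TensorProduct.tmul_smul, ← TensorProduct.smul_tmul', map_smul, h, smul_comm]

variable {𝒱}

theorem packets_ext₂ {W : Type*} [AddCommGroup W] [Module 𝕜 W]
    {f g : Packets 𝒱 ⊗[𝕜] Packets 𝒱 →ₗ[𝕜] W}
    (h : ∀ u v, f (wordPacket 𝒱 u ⊗ₜ wordPacket 𝒱 v) = g (wordPacket 𝒱 u ⊗ₜ wordPacket 𝒱 v)) :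
    f = g :=
  TensorProduct.ext <| packets_ext 𝒱 fun u => packets_ext 𝒱 fun v => h u v

/-- A bracket of words of lengths `p` and `q` has length `p + q - 1`, so for non-empty words it
meets $V$ only when both are single letters, and then it is their bracket by `l`. -/
theorem extends_of_apply_wordPacket
    (hm : ∀ u v : List (Letter 𝒱), m (wordPacket 𝒱 u ⊗ₜ wordPacket 𝒱 v) =
      packetOf 𝒱 (bracketWord (letterDeg 𝒱) c (letterBracket hl) 𝕜 u v)) : Extends 𝒱 l m := by
  suffices h : cogenProj 𝒱 ∘ₗ m =
      TensorProduct.lift (l.compl₁₂ (cogenProj 𝒱) (cogenProj 𝒱)) from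
    fun X Y => LinearMap.congr_fun h (X ⊗ₜ Y)
  refine packets_ext₂ fun u v => ?_
  rw [LinearMap.comp_apply, TensorProduct.lift.tmul, LinearMap.compl₁₂_apply, hm]
  by_cases h : u.length = 1 ∧ v.length = 1
  · obtain ⟨a, rfl⟩ := List.length_eq_one_iff.1 h.1
    obtain ⟨b, rfl⟩ := List.length_eq_one_iff.1 h.2
    rw [bracketWord_cons_cons, bracketWord_nil_left, bracketWord_nil_right, map_zero, map_zero,
      smul_zero, smul_zero, zero_add, zero_add, shuffleWord_nil_left, ← word_cons, wordDeg_nil,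
      commSign_zero_right, one_smul, packetOf_word, cogenProj_singleton, cogenProj_singleton,
      cogenProj_singleton]
    rfl
  · have h0 : l (cogenProj 𝒱 (wordPacket 𝒱 u)) (cogenProj 𝒱 (wordPacket 𝒱 v)) = 0 := by
      by_cases hu : u.length = 1
      · rw [cogenProj_of_length_ne 𝒱 fun hv => h ⟨hu, hv⟩, map_zero]
      · rw [cogenProj_of_length_ne 𝒱 hu, map_zero, LinearMap.zero_apply]
    rw [h0]
    cases u with
    | nil => rw [bracketWord_nil_left, map_zero, map_zero]
    | cons a u =>
      cases v with
      | nil => rw [bracketWord_nil_right, map_zero, map_zero]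
      | cons b v =>
        refine cogenProj_packetOf 𝒱 ?_ (bracketWord_mem_homogeneousWords (fun _ _ => rfl) _ _)
        simp only [List.length_cons] at h ⊢
        omega

end PacketBracket

/-! ### The identity $(\ast)$: uniqueness and existence -/

section Compatible

variable {𝕜 V : Type*} [Field 𝕜] [AddCommGroup V] [Module 𝕜 V]
  {𝒱 : ℤ → Submodule 𝕜 V}

variable {c : ℤ} {l : V →ₗ[𝕜] V →ₗ[𝕜] V}
  (hl : ∀ {i j : ℤ} {u v : V}, u ∈ 𝒱 i → v ∈ 𝒱 j → l u v ∈ 𝒱 (i + j + c))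
  {m : Packets 𝒱 ⊗[𝕜] Packets 𝒱 →ₗ[𝕜] Packets 𝒱}

/-- In the quotient the shuffle factor beside a bracket vanishes unless one of its words is empty,
so only one of the two words is really cut. The result is the unflipped half of the right side of
$(\ast)$. -/
theorem map_packetOf_deconcat_wordBracket
    (hm : ∀ u v : List (Letter 𝒱), m (wordPacket 𝒱 u ⊗ₜ wordPacket 𝒱 v) =
      packetOf 𝒱 (bracketWord (letterDeg 𝒱) c (letterBracket hl) 𝕜 u v))
    (u v : List (Letter 𝒱)) :
    TensorProduct.map (packetOf 𝒱) (packetOf 𝒱) (deconcat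
      (wordBracket (letterDeg 𝒱) c (letterBracket hl) (word 𝕜 u) (word 𝕜 v))) =
      cutSum (fun x x' =>
        commSign 𝕜 (wordDeg (letterDeg 𝒱) x') (wordDeg (letterDeg 𝒱) v) •
          (m (wordPacket 𝒱 x ⊗ₜ wordPacket 𝒱 v) ⊗ₜ wordPacket 𝒱 x') +
        commSign 𝕜 c (wordDeg (letterDeg 𝒱) x) •
          (wordPacket 𝒱 x ⊗ₜ m (wordPacket 𝒱 x' ⊗ₜ wordPacket 𝒱 v))) u +
      cutSum (fun y y' =>
        m (wordPacket 𝒱 u ⊗ₜ wordPacket 𝒱 y) ⊗ₜ wordPacket 𝒱 y' +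
        (commSign 𝕜 (wordDeg (letterDeg 𝒱) u) (wordDeg (letterDeg 𝒱) y) *
          commSign 𝕜 c (wordDeg (letterDeg 𝒱) y)) •
          (wordPacket 𝒱 y ⊗ₜ m (wordPacket 𝒱 u ⊗ₜ wordPacket 𝒱 y'))) v := by
  have hw : ∀ u v, packetOf 𝒱 (wordBracket (letterDeg 𝒱) c (letterBracket hl) (word 𝕜 u)
      (word 𝕜 v)) = m (wordPacket 𝒱 u ⊗ₜ wordPacket 𝒱 v) := fun u v => by
    rw [wordBracket_word, hm]
  rw [deconcat_wordBracket]
  simp only [map_cutSum, map_smul, map_add, TensorProduct.map_tmul, hw, smul_add, smul_smul,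
    cutSum_add]
  rw [cutSum_cutSum_of_right (β := fun x x' y y' =>
      commSign 𝕜 (wordDeg (letterDeg 𝒱) x') (wordDeg (letterDeg 𝒱) y) •
        (m (wordPacket 𝒱 x ⊗ₜ wordPacket 𝒱 y) ⊗ₜ[𝕜]
          packetOf 𝒱 (shuffle (letterDeg 𝒱) (word 𝕜 x') (word 𝕜 y')))),
    cutSum_cutSum_of_left (β := fun x x' y y' =>
      (commSign 𝕜 (wordDeg (letterDeg 𝒱) x') (wordDeg (letterDeg 𝒱) y) *
        commSign 𝕜 c (wordDeg (letterDeg 𝒱) x + wordDeg (letterDeg 𝒱) y)) •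
        (packetOf 𝒱 (shuffle (letterDeg 𝒱) (word 𝕜 x) (word 𝕜 y)) ⊗ₜ[𝕜]
          m (wordPacket 𝒱 x' ⊗ₜ wordPacket 𝒱 y')))]
  · simp only [shuffle_nil_left, shuffle_nil_right, packetOf_word, wordDeg_nil,
      commSign_zero_left, commSign_zero_right, one_smul, one_mul, add_zero, zero_add]
    abel
  · intro a x x' b y y'
    rw [packetOf_shuffle_cons, TensorProduct.zero_tmul, smul_zero]
  · rw [shuffle_nil_left, packetOf_word, wordPacket_nil, TensorProduct.zero_tmul, smul_zero]
  · intro x a x' y b y'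
    rw [packetOf_shuffle_cons, TensorProduct.tmul_zero, smul_zero]
  · rw [shuffle_nil_left, packetOf_word, wordPacket_nil, TensorProduct.tmul_zero, smul_zero]

variable [CharZero 𝕜] [DirectSum.Decomposition 𝒱]

/-! ### The compatibility of a bracket with the cobracket on words -/

/-- Each cut of `u` or of `v` yields four terms: the bracket on the left or on the right, for the
cut itself or for its flip. This explicit form serves both uniqueness and existence. -/
theorem compatible_rhs_wordPacket (c : ℤ) (m : Packets 𝒱 ⊗[𝕜] Packets 𝒱 →ₗ[𝕜] Packets 𝒱)
    (u v : List (Letter 𝒱)) :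
    (bracketLeft 𝒱 m ∘ₗ (volte₂₃ 𝒱 ∘ₗ cobracketLeft 𝒱 + cobracketRight 𝒱) +
      bracketRight 𝒱 c m ∘ₗ (cobracketLeft 𝒱 + volte₁₂ 𝒱 ∘ₗ cobracketRight 𝒱))
        (wordPacket 𝒱 u ⊗ₜ wordPacket 𝒱 v) =
      cutSum (fun x x' =>
        commSign 𝕜 (wordDeg (letterDeg 𝒱) x') (wordDeg (letterDeg 𝒱) v) •
          (m (wordPacket 𝒱 x ⊗ₜ wordPacket 𝒱 v) ⊗ₜ wordPacket 𝒱 x') +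
        commSign 𝕜 c (wordDeg (letterDeg 𝒱) x) •
          (wordPacket 𝒱 x ⊗ₜ m (wordPacket 𝒱 x' ⊗ₜ wordPacket 𝒱 v)) -
        (commSign 𝕜 (wordDeg (letterDeg 𝒱) x) (wordDeg (letterDeg 𝒱) x') *
          commSign 𝕜 (wordDeg (letterDeg 𝒱) x) (wordDeg (letterDeg 𝒱) v)) •
          (m (wordPacket 𝒱 x' ⊗ₜ wordPacket 𝒱 v) ⊗ₜ wordPacket 𝒱 x) -
        (commSign 𝕜 (wordDeg (letterDeg 𝒱) x) (wordDeg (letterDeg 𝒱) x') *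
          commSign 𝕜 c (wordDeg (letterDeg 𝒱) x')) •
          (wordPacket 𝒱 x' ⊗ₜ m (wordPacket 𝒱 x ⊗ₜ wordPacket 𝒱 v))) u +
      cutSum (fun y y' =>
        m (wordPacket 𝒱 u ⊗ₜ wordPacket 𝒱 y) ⊗ₜ wordPacket 𝒱 y' +
        (commSign 𝕜 (wordDeg (letterDeg 𝒱) u) (wordDeg (letterDeg 𝒱) y) *
          commSign 𝕜 c (wordDeg (letterDeg 𝒱) y)) •
          (wordPacket 𝒱 y ⊗ₜ m (wordPacket 𝒱 u ⊗ₜ wordPacket 𝒱 y')) -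
        commSign 𝕜 (wordDeg (letterDeg 𝒱) y) (wordDeg (letterDeg 𝒱) y') •
          (m (wordPacket 𝒱 u ⊗ₜ wordPacket 𝒱 y') ⊗ₜ wordPacket 𝒱 y) -
        (commSign 𝕜 (wordDeg (letterDeg 𝒱) y) (wordDeg (letterDeg 𝒱) y') *
          (commSign 𝕜 (wordDeg (letterDeg 𝒱) u) (wordDeg (letterDeg 𝒱) y') *
            commSign 𝕜 c (wordDeg (letterDeg 𝒱) y'))) •
          (wordPacket 𝒱 y' ⊗ₜ m (wordPacket 𝒱 u ⊗ₜ wordPacket 𝒱 y))) v := by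
  have h23 : ∀ x y z : List (Letter 𝒱),
      volte₂₃ 𝒱 ((wordPacket 𝒱 x ⊗ₜ wordPacket 𝒱 y) ⊗ₜ wordPacket 𝒱 z) =
        commSign 𝕜 (wordDeg (letterDeg 𝒱) y) (wordDeg (letterDeg 𝒱) z) •
          ((wordPacket 𝒱 x ⊗ₜ[𝕜] wordPacket 𝒱 z) ⊗ₜ[𝕜] wordPacket 𝒱 y) := fun x y z => by
    simp only [volte₂₃, LinearMap.comp_apply, LinearEquiv.coe_coe, TensorProduct.assoc_tmul,
      LinearMap.lTensor_tmul, volte_wordPacket, TensorProduct.tmul_smul, map_smul,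
      TensorProduct.assoc_symm_tmul]
  have h12 : ∀ x y z : List (Letter 𝒱),
      volte₁₂ 𝒱 ((wordPacket 𝒱 x ⊗ₜ wordPacket 𝒱 y) ⊗ₜ wordPacket 𝒱 z) =
        commSign 𝕜 (wordDeg (letterDeg 𝒱) x) (wordDeg (letterDeg 𝒱) y) •
          ((wordPacket 𝒱 y ⊗ₜ[𝕜] wordPacket 𝒱 x) ⊗ₜ[𝕜] wordPacket 𝒱 z) := fun x y z => by
    rw [volte₁₂, LinearMap.rTensor_tmul, volte_wordPacket]
    rfl
  have hL : ∀ x y z : List (Letter 𝒱),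
      bracketLeft 𝒱 m ((wordPacket 𝒱 x ⊗ₜ wordPacket 𝒱 y) ⊗ₜ wordPacket 𝒱 z) =
        m (wordPacket 𝒱 x ⊗ₜ wordPacket 𝒱 y) ⊗ₜ[𝕜] wordPacket 𝒱 z := fun x y z => rfl
  have hR : ∀ x y z : List (Letter 𝒱),
      bracketRight 𝒱 c m ((wordPacket 𝒱 x ⊗ₜ wordPacket 𝒱 y) ⊗ₜ wordPacket 𝒱 z) =
        commSign 𝕜 c (wordDeg (letterDeg 𝒱) x) •
          (wordPacket 𝒱 x ⊗ₜ[𝕜] m (wordPacket 𝒱 y ⊗ₜ wordPacket 𝒱 z)) := fun x y z => by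
    rw [bracketRight, LinearMap.comp_apply, LinearEquiv.coe_coe, TensorProduct.assoc_tmul,
      TensorProduct.map_tmul, packetTwist_wordPacket, TensorProduct.smul_tmul']
  have hδL : cobracketLeft 𝒱 (wordPacket 𝒱 u ⊗ₜ wordPacket 𝒱 v) =
      cutSum (fun x x' => (wordPacket 𝒱 x ⊗ₜ wordPacket 𝒱 x') ⊗ₜ wordPacket 𝒱 v -
        commSign 𝕜 (wordDeg (letterDeg 𝒱) x) (wordDeg (letterDeg 𝒱) x') •
          ((wordPacket 𝒱 x' ⊗ₜ[𝕜] wordPacket 𝒱 x) ⊗ₜ[𝕜] wordPacket 𝒱 v)) u := by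
    rw [cobracketLeft, LinearMap.rTensor_tmul, cobracket_wordPacket_eq_cutSum, ← cutSum_add]
    refine (map_cutSum ((TensorProduct.mk 𝕜 _ _).flip (wordPacket 𝒱 v)) _ u).trans ?_
    simp only [LinearMap.flip_apply, TensorProduct.mk_apply, TensorProduct.add_tmul,
      TensorProduct.neg_tmul, TensorProduct.smul_tmul', sub_eq_add_neg]
  have hδR : cobracketRight 𝒱 (wordPacket 𝒱 u ⊗ₜ wordPacket 𝒱 v) =
      cutSum (fun y y' => (wordPacket 𝒱 u ⊗ₜ wordPacket 𝒱 y) ⊗ₜ wordPacket 𝒱 y' -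
        commSign 𝕜 (wordDeg (letterDeg 𝒱) y) (wordDeg (letterDeg 𝒱) y') •
          ((wordPacket 𝒱 u ⊗ₜ[𝕜] wordPacket 𝒱 y') ⊗ₜ[𝕜] wordPacket 𝒱 y)) v := by
    rw [cobracketRight, LinearMap.comp_apply, LinearMap.lTensor_tmul,
      cobracket_wordPacket_eq_cutSum, ← cutSum_add]
    refine (map_cutSum ((TensorProduct.assoc 𝕜 (Packets 𝒱) (Packets 𝒱)
      (Packets 𝒱)).symm.toLinearMap ∘ₗ TensorProduct.mk 𝕜 _ _ (wordPacket 𝒱 u)) _ v).trans ?_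
    simp only [LinearMap.comp_apply, TensorProduct.mk_apply, map_add, map_neg, map_smul,
      LinearEquiv.coe_coe, TensorProduct.assoc_symm_tmul, sub_eq_add_neg]
  simp only [LinearMap.add_apply, LinearMap.comp_apply, map_add, hδL, hδR, map_cutSum, map_sub,
    map_smul, h23, h12, hL, hR, smul_smul]
  rw [add_assoc, add_left_comm (cutSum _ v), ← add_assoc, ← add_assoc, add_assoc, ← cutSum_add,
    ← cutSum_add]
  congr 1 <;> refine cutSum_congr fun x x' _ => ?_
  · abel
  · simp only [mul_assoc]
    abel

/-! ### Uniqueness -/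

theorem eq_of_extends_of_isCompatible {c : ℤ} {l : V →ₗ[𝕜] V →ₗ[𝕜] V}
    {m m' : Packets 𝒱 ⊗[𝕜] Packets 𝒱 →ₗ[𝕜] Packets 𝒱} (he : Extends 𝒱 l m)
    (he' : Extends 𝒱 l m') (hc : IsCompatible 𝒱 c m) (hc' : IsCompatible 𝒱 c m') : m = m' := by
  refine packets_ext₂ fun u v => ?_
  induction hN : u.length + v.length using Nat.strong_induction_on generalizing u v with
  | _ N ih =>
    subst hN
    rw [← sub_eq_zero]
    -- The two brackets have the same projection to $V$, so it remains to compare their cobrackets.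
    refine eq_zero_of_cobracket_eq_zero 𝒱 ?_ (by rw [map_sub, he, he', sub_self])
    have h := LinearMap.congr_fun hc (wordPacket 𝒱 u ⊗ₜ wordPacket 𝒱 v)
    have h' := LinearMap.congr_fun hc' (wordPacket 𝒱 u ⊗ₜ wordPacket 𝒱 v)
    rw [LinearMap.comp_apply, compatible_rhs_wordPacket] at h h'
    rw [map_sub, h, h', sub_eq_zero]
    congr 1
    · refine cutSum_congr fun x x' hx => ?_
      -- Cuts with an empty side vanish. Otherwise both parts are strictly shorter than `u` and the
      -- induction hypothesis applies to each.
      rcases eq_or_ne x [] with rfl | hne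
      · rw [List.nil_append] at hx
        subst hx
        simp only [wordPacket_nil, TensorProduct.zero_tmul, TensorProduct.tmul_zero, map_zero]
      rcases eq_or_ne x' [] with rfl | hne'
      · simp only [wordPacket_nil, TensorProduct.zero_tmul, TensorProduct.tmul_zero, map_zero]
      have := List.length_pos_iff.2 hne
      have := List.length_pos_iff.2 hne'
      have hlen : x.length + x'.length = u.length := by rw [← hx, List.length_append]
      rw [ih _ (by omega) x v rfl, ih _ (by omega) x' v rfl]
    · refine cutSum_congr fun y y' hy => ?_
      rcases eq_or_ne y [] with rfl | hne
      · simp only [wordPacket_nil, TensorProduct.zero_tmul, TensorProduct.tmul_zero, map_zero]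
      rcases eq_or_ne y' [] with rfl | hne'
      · simp only [wordPacket_nil, TensorProduct.zero_tmul, TensorProduct.tmul_zero, map_zero]
      have := List.length_pos_iff.2 hne
      have := List.length_pos_iff.2 hne'
      have hlen : y.length + y'.length = v.length := by rw [← hy, List.length_append]
      rw [ih _ (by omega) u y rfl, ih _ (by omega) u y' rfl]

/-! ### Existence -/

theorem cobracket_packetOf (t : List (Letter 𝒱) →₀ 𝕜) :
    cobracket 𝒱 (packetOf 𝒱 t) =
      TensorProduct.map (packetOf 𝒱) (packetOf 𝒱) (deconcat t) -
        volte 𝒱 (TensorProduct.map (packetOf 𝒱) (packetOf 𝒱) (deconcat t)) := by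
  have : cobracket 𝒱 ∘ₗ packetOf 𝒱 = (LinearMap.id - volte 𝒱) ∘ₗ
      TensorProduct.map (packetOf 𝒱) (packetOf 𝒱) ∘ₗ deconcat := word_ext fun w => by
    have h : TensorProduct.map (packetOf 𝒱) (packetOf 𝒱) (deconcat (word 𝕜 w)) =
        cutSum (fun u v => wordPacket 𝒱 u ⊗ₜ[𝕜] wordPacket 𝒱 v) w := by
      rw [deconcat_word, map_cutSum]
      simp only [TensorProduct.map_tmul, packetOf_word]
    rw [LinearMap.comp_apply, LinearMap.comp_apply, LinearMap.comp_apply, packetOf_word,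
      cobracket_wordPacket, h]
    rfl
  exact LinearMap.congr_fun this t

/-- The cobracket of the bracket is `T - τ T`, with `T` its deconcatenation in the quotient. The
term `T` is the unflipped half of the right side, and `-τ T` is the flipped half because the bracket
has degree `c`. -/
theorem isCompatible_of_apply_wordPacket
    (hm : ∀ u v : List (Letter 𝒱), m (wordPacket 𝒱 u ⊗ₜ wordPacket 𝒱 v) =
      packetOf 𝒱 (bracketWord (letterDeg 𝒱) c (letterBracket hl) 𝕜 u v)) :
    IsCompatible 𝒱 c m := by
  refine packets_ext₂ fun u v => ?_
  have hd := apply_wordPacket_mem 𝒱 hl hm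
  have hw := wordPacket_mem_packetDegree (𝕜 := 𝕜) 𝒱
  have hv₁ := fun x y z => volte_of_mem 𝒱 (hd x y) (hw z)
  have hv₂ := fun x y z => volte_of_mem 𝒱 (hw z) (hd x y)
  have hneg : ∀ (β : List (Letter 𝒱) → List (Letter 𝒱) → Packets 𝒱 ⊗[𝕜] Packets 𝒱) w,
      -cutSum β w = cutSum (fun u v => -β u v) w := fun β => map_cutSum negAddMonoidHom β
  rw [compatible_rhs_wordPacket, LinearMap.comp_apply, hm, ← wordBracket_word, cobracket_packetOf,
    map_packetOf_deconcat_wordBracket hl hm, map_add, map_cutSum, map_cutSum]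
  simp only [map_add, map_smul, hv₁, hv₂]
  rw [sub_eq_add_neg, neg_add, hneg, hneg, add_add_add_comm, ← cutSum_add, ← cutSum_add]
  congr 1
  · refine cutSum_congr fun x x' hx => ?_
    -- Flipping `x'` with the bracket of `x` and `v` includes its commutation sign with `v`, which
    -- cancels the one already present; `e2` has the analogous cancellation with `c`.
    have e1 : commSign 𝕜 (wordDeg (letterDeg 𝒱) x') (wordDeg (letterDeg 𝒱) v) *
        commSign 𝕜 (wordDeg (letterDeg 𝒱) x + wordDeg (letterDeg 𝒱) v + c)
          (wordDeg (letterDeg 𝒱) x') =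
        commSign 𝕜 (wordDeg (letterDeg 𝒱) x) (wordDeg (letterDeg 𝒱) x') *
          commSign 𝕜 c (wordDeg (letterDeg 𝒱) x') := by
      rw [commSign_add_left, commSign_add_left, commSign_comm (wordDeg (letterDeg 𝒱) v)]
      linear_combination (commSign 𝕜 (wordDeg (letterDeg 𝒱) x) (wordDeg (letterDeg 𝒱) x') *
        commSign 𝕜 c (wordDeg (letterDeg 𝒱) x')) *
        commSign_mul_self (R := 𝕜) (wordDeg (letterDeg 𝒱) x') (wordDeg (letterDeg 𝒱) v)
    have e2 : commSign 𝕜 c (wordDeg (letterDeg 𝒱) x) *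
        commSign 𝕜 (wordDeg (letterDeg 𝒱) x)
          (wordDeg (letterDeg 𝒱) x' + wordDeg (letterDeg 𝒱) v + c) =
        commSign 𝕜 (wordDeg (letterDeg 𝒱) x) (wordDeg (letterDeg 𝒱) x') *
          commSign 𝕜 (wordDeg (letterDeg 𝒱) x) (wordDeg (letterDeg 𝒱) v) := by
      rw [commSign_add_right, commSign_add_right, commSign_comm _ c]
      linear_combination (commSign 𝕜 (wordDeg (letterDeg 𝒱) x) (wordDeg (letterDeg 𝒱) x') *
        commSign 𝕜 (wordDeg (letterDeg 𝒱) x) (wordDeg (letterDeg 𝒱) v)) *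
        commSign_mul_self (R := 𝕜) c (wordDeg (letterDeg 𝒱) x)
    rw [smul_smul, smul_smul, e1, e2]
    abel
  · refine cutSum_congr fun y y' hy => ?_
    have e1 : commSign 𝕜 (wordDeg (letterDeg 𝒱) u + wordDeg (letterDeg 𝒱) y + c)
          (wordDeg (letterDeg 𝒱) y') =
        commSign 𝕜 (wordDeg (letterDeg 𝒱) y) (wordDeg (letterDeg 𝒱) y') *
          (commSign 𝕜 (wordDeg (letterDeg 𝒱) u) (wordDeg (letterDeg 𝒱) y') *
            commSign 𝕜 c (wordDeg (letterDeg 𝒱) y')) := by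
      rw [commSign_add_left, commSign_add_left]
      ring
    have e2 : commSign 𝕜 (wordDeg (letterDeg 𝒱) u) (wordDeg (letterDeg 𝒱) y) *
          commSign 𝕜 c (wordDeg (letterDeg 𝒱) y) *
        commSign 𝕜 (wordDeg (letterDeg 𝒱) y)
          (wordDeg (letterDeg 𝒱) u + wordDeg (letterDeg 𝒱) y' + c) =
        commSign 𝕜 (wordDeg (letterDeg 𝒱) y) (wordDeg (letterDeg 𝒱) y') := by
      rw [commSign_add_right, commSign_add_right, commSign_comm _ c,
        commSign_comm (wordDeg (letterDeg 𝒱) y) (wordDeg (letterDeg 𝒱) u)]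
      linear_combination (commSign 𝕜 (wordDeg (letterDeg 𝒱) y) (wordDeg (letterDeg 𝒱) y') *
        (commSign 𝕜 c (wordDeg (letterDeg 𝒱) y)) ^ 2) *
        commSign_mul_self (R := 𝕜) (wordDeg (letterDeg 𝒱) u) (wordDeg (letterDeg 𝒱) y) +
        commSign 𝕜 (wordDeg (letterDeg 𝒱) y) (wordDeg (letterDeg 𝒱) y') *
        commSign_mul_self (R := 𝕜) c (wordDeg (letterDeg 𝒱) y)
    rw [smul_smul, e1, e2]
    abel

end Compatible
-- The sign twist only rescales homogeneous vectors, and the two shifts of the arguments against the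
-- single shift of the value account for the degree `b - a + 1`.
theorem DiffABAlgebra.shiftedBracket_mem {𝕜 A : Type*} [Field 𝕜] [AddCommGroup A]
    [Module 𝕜 A] {𝒜 : ℤ → Submodule 𝕜 A} [DirectSum.Decomposition 𝒜] {a b : ℤ}
    (S : DiffABAlgebra 𝒜 a b) {i j : ℤ} {u v : A} (hu : u ∈ shifted 𝒜 a i)
    (hv : v ∈ shifted 𝒜 a j) : S.shiftedBracket u v ∈ shifted 𝒜 a (i + j + (b - a + 1)) := by
  rw [shiftedBracket, LinearMap.comp_apply, signTwist_of_mem (shifted 𝒜 a) _ hu, Units.smul_def,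
    map_zsmul, LinearMap.smul_apply]
  refine zsmul_mem ?_ _
  have h : i + (-a + 1) + (j + (-a + 1)) + b = i + j + (b - a + 1) + (-a + 1) := by ring
  have := S.bracket_mem hu hv
  rw [h] at this
  exact this

end ABAlgebra

theorem proposition4p1 {𝕜 A : Type*} [Field 𝕜] [CharZero 𝕜] [AddCommGroup A] [Module 𝕜 A]
    (𝒜 : ℤ → Submodule 𝕜 A) [DirectSum.Decomposition 𝒜] (a b : ℤ) (S : DiffABAlgebra 𝒜 a b) :
    (∃! ℓ₂ : HSpace 𝒜 a ⊗[𝕜] HSpace 𝒜 a →ₗ[𝕜] HSpace 𝒜 a,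
      IsOfDegree (shifted 𝒜 a) (b - a + 1) ℓ₂ ∧
      Extends (shifted 𝒜 a) S.shiftedBracket ℓ₂ ∧
      IsCompatible (shifted 𝒜 a) (b - a + 1) ℓ₂) ∧
    ∀ ℓ₂ : HSpace 𝒜 a ⊗[𝕜] HSpace 𝒜 a →ₗ[𝕜] HSpace 𝒜 a,
      IsOfDegree (shifted 𝒜 a) (b - a + 1) ℓ₂ →
      Extends (shifted 𝒜 a) S.shiftedBracket ℓ₂ →
      IsCompatible (shifted 𝒜 a) (b - a + 1) ℓ₂ →
      -- `X` has `p + 1` letters and `Y` has `q + 1` letters; `k` stands for the positions `k, k+1`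
      ∀ (p q : ℕ) (α : Fin (p + 1 + (q + 1)) → A) (d : Fin (p + 1 + (q + 1)) → ℤ),
        (∀ i, α i ∈ shifted 𝒜 a (d i)) →
        ℓ₂ (packet (shifted 𝒜 a) (fun i : Fin (p + 1) => α (Fin.castAdd (q + 1) i)) ⊗ₜ[𝕜]
            packet (shifted 𝒜 a) (fun j : Fin (q + 1) => α (Fin.natAdd (p + 1) j))) =
          ∑ σ ∈ battements (p + 1 + (q + 1)) (p + 1),
            ∑ k : Fin (p + 1 + q) with
                (σ.symm k.castSucc).val < p + 1 ∧ p + 1 ≤ (σ.symm k.succ).val,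
              (((koszulSign d σ *
                ((b - a + 1) * ∑ s with s < k.castSucc, d (σ.symm s)).negOnePow : ℤˣ) : ℤ) : 𝕜) •
              packet (shifted 𝒜 a)
                (Fin.contractNth k.castSucc (fun u v => S.shiftedBracket u v)
                  (fun i => α (σ.symm i))) := by
  have hl : ∀ {i j : ℤ} {u v : A}, u ∈ shifted 𝒜 a i → v ∈ shifted 𝒜 a j →
      S.shiftedBracket u v ∈ shifted 𝒜 a (i + j + (b - a + 1)) := fun hu hv =>
    S.shiftedBracket_mem hu hv
  obtain ⟨m, hm⟩ := exists_packet_bracket (𝒱 := shifted 𝒜 a) (c := b - a + 1)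
    (l := S.shiftedBracket) hl
  have he := extends_of_apply_wordPacket
    (𝒱 := shifted 𝒜 a) (c := b - a + 1) (l := S.shiftedBracket) hl hm
  have hc := isCompatible_of_apply_wordPacket
    (𝒱 := shifted 𝒜 a) (c := b - a + 1) (l := S.shiftedBracket) hl hm
  have hd := isOfDegree_of_apply_wordPacket (shifted 𝒜 a) (c := b - a + 1)
    (l := S.shiftedBracket) hl hm
  refine ⟨⟨m, ⟨hd, he, hc⟩, fun m' h =>
    eq_of_extends_of_isCompatible h.2.1 he h.2.2 hc⟩, fun ℓ₂ _ he' hc' p q α d hα => ?_⟩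
  rw [eq_of_extends_of_isCompatible he' he hc' hc]
  -- The `p + q + 2` letters are written as `(p + 1 + q) + 1`, which agrees definitionally with `p +
  -- 1 + (q + 1)`; the first `p + 1` of them form the first word.
  have h := packetOf_bracketWord_ofFn (𝒱 := shifted 𝒜 a) (c := b - a + 1)
    (l := S.shiftedBracket) hl (n := p + 1 + q) (p := p + 1) (by omega)
    fun i => (⟨d i, α i, hα i⟩ : Letter (shifted 𝒜 a))
  refine Eq.trans ?_ h
  rw [← hm]
  congr 2
  · rw [← wordPacket_ofFn (shifted 𝒜 a) (α := fun i : Fin (p + 1) =>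
      ⟨d (Fin.castAdd (q + 1) i), α (Fin.castAdd (q + 1) i), hα _⟩)]
    congr 1
    apply List.ext_getElem
    · simp [-List.ofFn_succ]; omega
    · intro i h1 h2
      simp [-List.ofFn_succ]
  · rw [← wordPacket_ofFn (shifted 𝒜 a) (α := fun j : Fin (q + 1) =>
      ⟨d (Fin.natAdd (p + 1) j), α (Fin.natAdd (p + 1) j), hα _⟩)]
    congr 1
    apply List.ext_getElem
    · simp [-List.ofFn_succ]; omega
    · intro i h1 h2
      simp [-List.ofFn_succ]
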